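/- Let $\mathbb U=\{z=x+iy: y>0\}$. Fix $C^\infty$ functions $\varphi,\psi:\mathbb R\to\mathbb R$ supported in $[-1,1]$ with $\varphi$ even, $\psi$ odd, $\int_{\mathbb R}\varphi(x)\,dx=1$ and $\int_{\mathbb R}\psi(x)x\,dx=1$. Let $H^{1/2}$ be the space of locally integrable functions $u:\mathbb R\to\mathbb C$ with $$\|u\|_{H^{1/2}}^2=\frac1{4\pi^2}\int_{\mathbb R}\int_{\mathbb R}\frac{|u(s)-u(t)|^2}{|s-t|^2}\,ds\,dt<\infty$$ (a seminorm that vanishes exactly on the a.e. constant functions). Let $\mathcal L(\mathbb U)$ be the space of (classes of) measurable functions $\mu$ on $\mathbb U$ with $$\|\mu\|_{\mathrm{WP}}=\|\mu\|_\infty+\Big(\frac1\pi\iint_{\mathbb U}\frac{|\mu(z)|^2}{y^2}\,dx\,dy\Big)^{1/2}<\infty,$$ and let $\mathcal M(\mathbb U)=\{\mu\in\mathcal L(\mathbb U):\|\mu\|_\infty<1\}$. For $u\in H^{1/2}$ put $$\gamma_u(x)=\frac{\int_0^xe^{u(t)}dt}{\int_0^1e^{u(t)}dt},\qquad \rho_u(x+iy)=\varphi_y*\gamma_u(x)-i\,\psi_y*\gamma_u(x)\quad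 (y>0),$$ where $\phi_y(x)=y^{-1}\phi(y^{-1}x)$ and $\phi_y*v(x)=\int_{\mathbb R}\phi_y(x-t)v(t)\,dt$. **Lemma 6.1.** There are constants $\delta>0$ and $C$, depending only on $\varphi$ and $\psi$, such that, with $H^{1/2}_\delta=\{u\in H^{1/2}:\|u\|_{H^{1/2}}<\delta\}$, the following hold. 1. For every $u\in H^{1/2}_\delta$, $e^u$ is locally integrable, $\int_0^1e^{u(t)}dt\ne0$, and $\rho_u$ is a quasiconformal mapping of $\mathbb U$ onto an open subset of $\mathbb C$; moreover $\partial\rho_u\ne0$ almost everywhere in $\mathbb U$, and the Beltrami coefficient $\Lambda(u)=\bar\partial\rho_u/\partial\rho_u$ belongs to $\mathcal M(\mathbb U)$ and satisfies $\|\Lambda(u)\|_{\mathrm{WP}}\le C\|u\|_{H^{1/2}}$. 2. The map $\Lambda:H^{1/2}_\delta\to\mathcal M(\mathbb U)\subset\mathcal L(\mathbb U)$ is holomorphic, that is, complex Fréchet differentiable at every point of $H^{1/2}_\delta$ with respect to the norms $\|\cdot\|_{H^{1/2}}$ and $\|\cdot\|_{\mathrm{WP}}$. -/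

import Mathlib

open MeasureTheory Set
namespace WeilPetersson

noncomputable section

open scoped ENNReal

/-! ### An `L²` seminorm of the form `√(c ∫ ‖g‖²)` (auxiliary facts) -/

theorem lintegral_sq_eq {X : Type*} [MeasurableSpace X] (m : Measure X) (g : X → ℂ) :
    ∫⁻ x, ENNReal.ofReal (‖g x‖ ^ 2) ∂m = eLpNorm g 2 m ^ 2 := by
  have h := eLpNorm_nnreal_pow_eq_lintegral (μ := m) (f := g) (p := 2) two_ne_zero
  have h2 : eLpNorm g 2 m ^ 2 = eLpNorm g ((2 : NNReal) : ℝ≥0∞) m ^ ((2 : NNReal) : ℝ) := by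
    rw [NNReal.coe_ofNat, ENNReal.coe_ofNat, ENNReal.rpow_ofNat]
  rw [h2, h]
  refine lintegral_congr fun x => ?_
  rw [NNReal.coe_ofNat, ENNReal.rpow_ofNat, ENNReal.ofReal_pow (norm_nonneg _), ofReal_norm]

theorem sqrt_mul_toReal_sq (c : ℝ) (hc : 0 ≤ c) (a : ℝ≥0∞) :
    Real.sqrt (c * (a ^ 2).toReal) = Real.sqrt c * a.toReal := by
  rw [Real.sqrt_mul hc, ENNReal.toReal_pow, Real.sqrt_sq ENNReal.toReal_nonneg]

/-! ### The Sobolev class `H^{1/2}` on the real line -/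

/-- `∫∫ |u(s) - u(t)|² / |s - t|² ds dt`, as an extended nonnegative real. -/
def halfEnergy (u : ℝ → ℂ) : ℝ≥0∞ :=
  ∫⁻ p : ℝ × ℝ, ENNReal.ofReal (‖u p.1 - u p.2‖ ^ 2 / (p.1 - p.2) ^ 2)

/-- The difference quotient of `u`, as a function on the plane. -/
def diffQuot (u : ℝ → ℂ) (p : ℝ × ℝ) : ℂ := (u p.1 - u p.2) / ((p.1 - p.2 : ℝ) : ℂ)

theorem halfEnergy_eq (u : ℝ → ℂ) : halfEnergy u = eLpNorm (diffQuot u) 2 volume ^ 2 := by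
  rw [← lintegral_sq_eq]
  refine lintegral_congr fun p => ?_
  rw [diffQuot, norm_div, div_pow, Complex.norm_real, Real.norm_eq_abs, sq_abs]

theorem halfEnergy_lt_top_iff (u : ℝ → ℂ) :
    halfEnergy u < ∞ ↔ eLpNorm (diffQuot u) 2 volume < ∞ := by
  rw [halfEnergy_eq, ENNReal.pow_lt_top_iff]; simp

theorem aestronglyMeasurable_diffQuot {u : ℝ → ℂ} (hu : AEStronglyMeasurable u volume) :
    AEStronglyMeasurable (diffQuot u) volume := by
  have h1 : AEStronglyMeasurable (fun p : ℝ × ℝ => u p.1) volume :=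
    hu.comp_quasiMeasurePreserving Measure.quasiMeasurePreserving_fst
  have h2 : AEStronglyMeasurable (fun p : ℝ × ℝ => u p.2) volume :=
    hu.comp_quasiMeasurePreserving Measure.quasiMeasurePreserving_snd
  have h3 : Measurable (fun p : ℝ × ℝ => ((p.1 - p.2 : ℝ) : ℂ)) := by fun_prop
  exact ((h1.sub h2).aemeasurable.div h3.aemeasurable).aestronglyMeasurable

theorem diffQuot_add (u v : ℝ → ℂ) : diffQuot (u + v) = diffQuot u + diffQuot v := by
  funext p; simp only [diffQuot, Pi.add_apply]; ring

theorem diffQuot_smul (c : ℂ) (u : ℝ → ℂ) : diffQuot (c • u) = c • diffQuot u := by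
  funext p; simp only [diffQuot, Pi.smul_apply, smul_eq_mul]; ring

/-- The locally integrable functions `u : ℝ → ℂ` with
`∫∫ |u(s) - u(t)|² / |s - t|² ds dt < ∞`, as a complex vector space. -/
def halfSubmodule : Submodule ℂ (ℝ → ℂ) where
  carrier := {u | LocallyIntegrable u volume ∧ halfEnergy u < ∞}
  zero_mem' := ⟨locallyIntegrable_zero, by simp [halfEnergy]⟩
  add_mem' := by
    rintro u v ⟨hu, hu'⟩ ⟨hv, hv'⟩
    refine ⟨hu.add hv, ?_⟩
    rw [halfEnergy_lt_top_iff] at *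
    rw [diffQuot_add]
    exact lt_of_le_of_lt (eLpNorm_add_le
      (aestronglyMeasurable_diffQuot hu.aestronglyMeasurable)
      (aestronglyMeasurable_diffQuot hv.aestronglyMeasurable) one_le_two)
      (ENNReal.add_lt_top.2 ⟨hu', hv'⟩)
  smul_mem' := by
    rintro c u ⟨hu, hu'⟩
    refine ⟨hu.smul c, ?_⟩
    rw [halfEnergy_lt_top_iff] at *
    rw [diffQuot_smul, eLpNorm_const_smul]
    exact ENNReal.mul_lt_top enorm_lt_top hu'

/-- The Sobolev class `H^{1/2}` of complex-valued functions on the real line, with the seminorm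
`‖u‖² = (1 / 4π²) ∫∫ |u(s) - u(t)|² / |s - t|² ds dt` (which vanishes exactly on the functions
that are almost everywhere constant). -/
def HHalf : Type := halfSubmodule

namespace HHalf

instance : AddCommGroup HHalf := inferInstanceAs (AddCommGroup halfSubmodule)

instance : Module ℂ HHalf := inferInstanceAs (Module ℂ halfSubmodule)

/-- The underlying function. -/
def toFun (u : HHalf) : ℝ → ℂ := u.1

instance : CoeFun HHalf (fun _ => ℝ → ℂ) := ⟨toFun⟩

instance : Norm HHalf :=
  ⟨fun u => Real.sqrt (1 / (4 * Real.pi ^ 2) * (halfEnergy u).toReal)⟩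

theorem norm_def (u : HHalf) :
    ‖u‖ = Real.sqrt (1 / (4 * Real.pi ^ 2) * (halfEnergy u).toReal) := rfl

theorem norm_eq (u : HHalf) :
    ‖u‖ = Real.sqrt (1 / (4 * Real.pi ^ 2)) * (eLpNorm (diffQuot u) 2 volume).toReal := by
  rw [norm_def, halfEnergy_eq, sqrt_mul_toReal_sq _ (by positivity)]

theorem core : SeminormedSpace.Core ℂ HHalf where
  norm_nonneg u := Real.sqrt_nonneg _
  norm_smul c u := by
    have h : toFun (c • u) = c • toFun u := rfl
    rw [norm_eq, norm_eq, h, diffQuot_smul, eLpNorm_const_smul, ENNReal.toReal_mul,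
      toReal_enorm]
    ring
  norm_triangle u v := by
    have h : toFun (u + v) = toFun u + toFun v := rfl
    rw [norm_eq, norm_eq, norm_eq, h, diffQuot_add, ← mul_add]
    have hu : eLpNorm (diffQuot u.toFun) 2 volume < ∞ := (halfEnergy_lt_top_iff _).1 u.2.2
    have hv : eLpNorm (diffQuot v.toFun) 2 volume < ∞ := (halfEnergy_lt_top_iff _).1 v.2.2
    refine mul_le_mul_of_nonneg_left ?_ (Real.sqrt_nonneg _)
    rw [← ENNReal.toReal_add hu.ne hv.ne]
    exact ENNReal.toReal_mono (ENNReal.add_lt_top.2 ⟨hu, hv⟩).ne (eLpNorm_add_le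
      (aestronglyMeasurable_diffQuot u.2.1.aestronglyMeasurable)
      (aestronglyMeasurable_diffQuot v.2.1.aestronglyMeasurable) one_le_two)

instance : SeminormedAddCommGroup HHalf := SeminormedAddCommGroup.ofCore core

instance : NormedSpace ℂ HHalf where
  norm_smul_le c u := (core.norm_smul c u).le

end HHalf

/-! ### The space `𝓛(𝕌)` and its subset `𝓜(𝕌)` -/

/-- The upper half plane `𝕌`. -/
def upperHalf : Set ℂ := {z | 0 < z.im}

/-- `∫_𝕌 |μ(z)|² / y² dx dy`, as an extended nonnegative real. -/
def hypEnergy (μ : ℂ → ℂ) : ℝ≥0∞ :=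
  ∫⁻ z in upperHalf, ENNReal.ofReal (‖μ z‖ ^ 2 / z.im ^ 2)

/-- The function `μ(z) / y`. -/
def divIm (μ : ℂ → ℂ) (z : ℂ) : ℂ := μ z / (z.im : ℂ)

theorem hypEnergy_eq (μ : ℂ → ℂ) :
    hypEnergy μ = eLpNorm (divIm μ) 2 (volume.restrict upperHalf) ^ 2 := by
  rw [← lintegral_sq_eq]
  refine lintegral_congr fun p => ?_
  rw [divIm, norm_div, div_pow, Complex.norm_real, Real.norm_eq_abs, sq_abs]

theorem hypEnergy_lt_top_iff (μ : ℂ → ℂ) :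
    hypEnergy μ < ∞ ↔ eLpNorm (divIm μ) 2 (volume.restrict upperHalf) < ∞ := by
  rw [hypEnergy_eq, ENNReal.pow_lt_top_iff]; simp

theorem hypEnergy_congr {μ ν : ℂ → ℂ} (h : μ =ᵐ[volume.restrict upperHalf] ν) :
    hypEnergy μ = hypEnergy ν :=
  lintegral_congr_ae (h.mono fun z hz => by simp only [hz])

theorem aestronglyMeasurable_divIm {μ : ℂ → ℂ}
    (hμ : AEStronglyMeasurable μ (volume.restrict upperHalf)) :
    AEStronglyMeasurable (divIm μ) (volume.restrict upperHalf) := by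
  have h3 : Measurable (fun z : ℂ => (z.im : ℂ)) := by fun_prop
  exact (hμ.aemeasurable.div h3.aemeasurable).aestronglyMeasurable

theorem divIm_add (μ ν : ℂ → ℂ) : divIm (μ + ν) = divIm μ + divIm ν := by
  funext p; simp only [divIm, Pi.add_apply]; ring

theorem divIm_smul (c : ℂ) (μ : ℂ → ℂ) : divIm (c • μ) = c • divIm μ := by
  funext p; simp only [divIm, Pi.smul_apply, smul_eq_mul]; ring

/-- The classes `μ ∈ L^∞(𝕌)` with `∫_𝕌 |μ(z)|² / y² dx dy < ∞`. -/
def wpSubmodule : Submodule ℂ (Lp ℂ ∞ (volume.restrict upperHalf)) where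
  carrier := {μ | hypEnergy μ < ∞}
  zero_mem' := by
    rw [mem_ofPred_eq, hypEnergy_congr (Lp.coeFn_zero ℂ ∞ (volume.restrict upperHalf))]
    simp [hypEnergy]
  add_mem' := by
    intro μ ν hμ hν
    rw [mem_ofPred_eq] at *
    rw [hypEnergy_congr (Lp.coeFn_add μ ν)]
    rw [hypEnergy_lt_top_iff] at *
    rw [divIm_add]
    exact lt_of_le_of_lt (eLpNorm_add_le
      (aestronglyMeasurable_divIm (Lp.aestronglyMeasurable μ))
      (aestronglyMeasurable_divIm (Lp.aestronglyMeasurable ν)) one_le_two)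
      (ENNReal.add_lt_top.2 ⟨hμ, hν⟩)
  smul_mem' := by
    intro c μ hμ
    rw [mem_ofPred_eq] at *
    rw [hypEnergy_congr (Lp.coeFn_smul c μ)]
    rw [hypEnergy_lt_top_iff] at *
    rw [divIm_smul, eLpNorm_const_smul]
    exact ENNReal.mul_lt_top enorm_lt_top hμ

/-- The space `𝓛(𝕌)` of (classes of) measurable functions on `𝕌` with finite norm
`‖μ‖_∞ + ((1 / π) ∫_𝕌 |μ(z)|² / y² dx dy)^{1/2}`. -/
def WPSpace : Type := wpSubmodule

namespace WPSpace

instance : AddCommGroup WPSpace := inferInstanceAs (AddCommGroup wpSubmodule)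

instance : Module ℂ WPSpace := inferInstanceAs (Module ℂ wpSubmodule)

/-- The underlying element of `L^∞(𝕌)`. -/
def toLp (μ : WPSpace) : Lp ℂ ∞ (volume.restrict upperHalf) := μ.1

/-- The norm of `𝓛(𝕌)`; here `‖μ.toLp‖` is the essential supremum of `|μ|` over `𝕌`. -/
instance : Norm WPSpace :=
  ⟨fun μ => ‖μ.toLp‖ + Real.sqrt (1 / Real.pi * (hypEnergy μ.toLp).toReal)⟩

theorem norm_def (μ : WPSpace) :
    ‖μ‖ = ‖μ.toLp‖ + Real.sqrt (1 / Real.pi * (hypEnergy μ.toLp).toReal) := rfl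

theorem norm_eq (μ : WPSpace) :
    ‖μ‖ = ‖μ.toLp‖ + Real.sqrt (1 / Real.pi) *
      (eLpNorm (divIm μ.toLp) 2 (volume.restrict upperHalf)).toReal := by
  rw [norm_def, hypEnergy_eq, sqrt_mul_toReal_sq _ (by positivity)]

theorem core : NormedSpace.Core ℂ WPSpace where
  norm_nonneg μ := add_nonneg (norm_nonneg _) (Real.sqrt_nonneg _)
  norm_smul c μ := by
    have h : (c • μ).toLp = c • μ.toLp := rfl
    rw [norm_def, hypEnergy_congr (h ▸ Lp.coeFn_smul c μ.toLp), hypEnergy_eq,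
      sqrt_mul_toReal_sq _ (by positivity), norm_eq, h, norm_smul, divIm_smul,
      eLpNorm_const_smul, ENNReal.toReal_mul, toReal_enorm]
    ring
  norm_triangle μ ν := by
    have h : (μ + ν).toLp = μ.toLp + ν.toLp := rfl
    rw [norm_def, hypEnergy_congr (h ▸ Lp.coeFn_add μ.toLp ν.toLp), hypEnergy_eq,
      sqrt_mul_toReal_sq _ (by positivity), norm_eq, norm_eq, h, divIm_add]
    have hμ := (hypEnergy_lt_top_iff _).1 μ.2
    have hν := (hypEnergy_lt_top_iff _).1 ν.2
    have key : (eLpNorm (divIm μ.toLp + divIm ν.toLp) 2 (volume.restrict upperHalf)).toReal ≤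
        (eLpNorm (divIm μ.toLp) 2 (volume.restrict upperHalf)).toReal +
        (eLpNorm (divIm ν.toLp) 2 (volume.restrict upperHalf)).toReal := by
      refine (ENNReal.toReal_mono (ENNReal.add_lt_top.2 ⟨hμ, hν⟩).ne (eLpNorm_add_le
        (aestronglyMeasurable_divIm (Lp.aestronglyMeasurable μ.toLp))
        (aestronglyMeasurable_divIm (Lp.aestronglyMeasurable ν.toLp)) one_le_two)).trans ?_
      exact (ENNReal.toReal_add hμ.ne hν.ne).le
    have key2 := mul_le_mul_of_nonneg_left key (Real.sqrt_nonneg (1 / Real.pi))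
    have key3 := norm_add_le μ.toLp ν.toLp
    linarith
  norm_eq_zero_iff μ := by
    constructor
    · intro h
      have h0 : ‖μ.toLp‖ = 0 := le_antisymm
        ((le_add_of_nonneg_right (Real.sqrt_nonneg _)).trans h.le) (norm_nonneg _)
      exact Subtype.ext (norm_eq_zero.1 h0)
    · rintro rfl
      have h : (0 : WPSpace).toLp = 0 := rfl
      rw [norm_def, hypEnergy_congr (h ▸ Lp.coeFn_zero ℂ ∞ (volume.restrict upperHalf)), h]
      simp [hypEnergy]

instance : NormedAddCommGroup WPSpace := NormedAddCommGroup.ofCore core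

instance : NormedSpace ℂ WPSpace := NormedSpace.ofCore core

end WPSpace

/-- `𝓜(𝕌)`: the elements of `𝓛(𝕌)` in the open unit ball of `L^∞(𝕌)`. -/
def wpBeltrami : Set WPSpace := {μ | ‖μ.toLp‖ < 1}

/-! ### Quasiconformal mappings and Beltrami coefficients -/

/-- `∂f = (f_x - i f_y) / 2`. -/
def dz (f : ℂ → ℂ) (z : ℂ) : ℂ :=
  (lineDeriv ℝ f z 1 - Complex.I * lineDeriv ℝ f z Complex.I) / 2

/-- `∂̄f = (f_x + i f_y) / 2`. -/
def dzbar (f : ℂ → ℂ) (z : ℂ) : ℂ :=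
  (lineDeriv ℝ f z 1 + Complex.I * lineDeriv ℝ f z Complex.I) / 2

/-- `f` is absolutely continuous on lines in `Ω`: for every closed rectangle
`[a, b] × [c, d] ⊆ Ω`, it is absolutely continuous on almost every horizontal and almost every
vertical segment of the rectangle. -/
def IsACL (f : ℂ → ℂ) (Ω : Set ℂ) : Prop :=
  ∀ a b c d : ℝ, a ≤ b → c ≤ d → Icc a b ×ℂ Icc c d ⊆ Ω →
    (∀ᵐ y ∂(volume.restrict (Icc c d)),
      AbsolutelyContinuousOnInterval (fun x : ℝ => f ⟨x, y⟩) a b) ∧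
    (∀ᵐ x ∂(volume.restrict (Icc a b)),
      AbsolutelyContinuousOnInterval (fun y : ℝ => f ⟨x, y⟩) c d)

/-- The analytic definition of a quasiconformal mapping on `Ω` (for a nonempty open set `Ω`):
a homeomorphism of `Ω` onto an open subset of the plane which is absolutely continuous on lines
and satisfies `|∂̄f| ≤ k |∂f|` almost everywhere in `Ω`, for a constant `k < 1`. -/
structure IsQuasiconformalOn (f : ℂ → ℂ) (Ω : Set ℂ) : Prop where
  isOpenEmbedding : Topology.IsOpenEmbedding (Ω.domRestrict f)
  acl : IsACL f Ω
  dilatation : ∃ k : ℝ, 0 ≤ k ∧ k < 1 ∧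
    ∀ᵐ z ∂(volume.restrict Ω), ‖dzbar f z‖ ≤ k * ‖dz f z‖

/-- `μ` is the Beltrami coefficient `∂̄f / ∂f` of `f` on `Ω` (determined almost everywhere). -/
def IsBeltramiCoeffOn (μ f : ℂ → ℂ) (Ω : Set ℂ) : Prop :=
  ∀ᵐ z ∂(volume.restrict Ω), dz f z ≠ 0 ∧ μ z = dzbar f z / dz f z

/-! ### Semmes' construction -/

/-- `γ_u(x) = ∫₀ˣ e^{u(t)} dt / ∫₀¹ e^{u(t)} dt`. -/
def gammaCurve (u : ℝ → ℂ) (x : ℝ) : ℂ :=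
  (∫ t in (0 : ℝ)..x, Complex.exp (u t)) / ∫ t in (0 : ℝ)..1, Complex.exp (u t)

/-- `(φ_y * v)(x) = ∫ φ_y(x - t) v(t) dt`, where `φ_y(x) = y⁻¹ φ(y⁻¹ x)`. -/
def dilConv (φ : ℝ → ℝ) (y : ℝ) (v : ℝ → ℂ) (x : ℝ) : ℂ :=
  ∫ t : ℝ, ((y⁻¹ * φ (y⁻¹ * (x - t)) : ℝ) : ℂ) * v t

/-- `ρ_u(x + i y) = (φ_y * γ_u)(x) - i (ψ_y * γ_u)(x)`. -/
def semmesExt (φ ψ : ℝ → ℝ) (u : ℝ → ℂ) (z : ℂ) : ℂ :=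
  dilConv φ z.im (gammaCurve u) z.re - Complex.I * dilConv ψ z.im (gammaCurve u) z.re

end

end WeilPetersson

open WeilPetersson
open scoped ContDiff

/-!
Write `K = φ - i ψ`. Since `γ_u' = e^u / ∫₀¹ e^u`, differentiating the convolutions gives
`2 ∂ρ_u = a_y * γ_u'` and `2 ∂̄ρ_u = b_y * γ_u'` with `a(s) = (1 + i s) K(s)` and
`b(s) = (1 - i s) K(s)`; the parity and moment conditions on `φ` and `ψ` say that `∫ a = 2` and
`∫ b = 0`. Hence `Λ(u) = (b_y * e^u) / (a_y * e^u)`, a quotient that does not change when a constant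
is added to `u`, so that on each interval `I = (x - y, x + y]` one may subtract from `u` its mean.

*Exponential integrability.* The energy `∫∫_{I × I} |u(s) - u(t)|² / |s - t|²` is superadditive: if
the means over the two halves of `I` differ by `Δ`, either half carries at most the energy of `I`
minus `|Δ|² / 2`. With `cosh (p Δ / 2) ≤ exp (p² Δ² / 8)` an induction over dyadic subdivisions
shows that the mean over `I` of `exp (p Re (u - u_I))` is at most `exp (p² q / 4)`, where `q` is the
energy on `I × I` (`lintegral_exp_sub_mean_le`). This replaces the John–Nirenberg inequality.

*Estimates for `Λ`.* By Hölder's inequality `Λ(u)`, its formal derivative in the direction `h`, and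
the second order remainder are bounded at `x + i y` by constants times `osc u`, `osc h` and
`‖h‖ osc h` respectively, where `osc` is the mean square oscillation over `I`
(`norm_beltramiFun_le`, `norm_beltramiDeriv_le`, `norm_beltramiFun_remainder_le`). The oscillation
is bounded by `2 π ‖h‖`, and by Tonelli's theorem its square is integrable against `dx dy / y²` with
integral at most the energy (`lintegral_osc_sq_le`).
So a bound by `osc h` is a bound in `𝓛(𝕌)`, and `Λ` is Fréchet differentiable.

*Quasiconformality.* On every interval `γ_u'` is close in `L¹` mean to a nonzero constant `c`, so
`ρ_u - c z` is small compared with `c z` at the corresponding scale. For two points whose distance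
is small compared with their height this follows from bounds on the partial derivatives
(`norm_smoothExt_sub_sub_le_near`), for two points far apart from a bound on `γ_u - c x` itself
(`norm_smoothExt_sub_sub_le_far`). Together these estimates give injectivity, and the first one also
shows that `ρ_u` is open and continuous.
-/

namespace WeilPetersson

open MeasureTheory Set Filter Topology
open scoped ENNReal

/-! ### Mean values and mean oscillation on intervals -/

/-- The uniform probability measure on the interval `(x - r, x + r]`. -/
noncomputable def unifMeasure (x r : ℝ) : Measure ℝ :=
  (ENNReal.ofReal (2 * r))⁻¹ • volume.restrict (Ioc (x - r) (x + r))

/-- The mean of `u` over the interval `(x - r, x + r]`. -/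
noncomputable def mean (u : ℝ → ℂ) (x r : ℝ) : ℂ := ∫ t, u t ∂(unifMeasure x r)

/-- The mean square oscillation of `u` over `(x - r, x + r]`: the `L²` norm of `u s - u t` when
`s` and `t` are independent and uniformly distributed on the interval. -/
noncomputable def osc (u : ℝ → ℂ) (x r : ℝ) : ℝ≥0∞ :=
  eLpNorm (fun p : ℝ × ℝ => u p.1 - u p.2) 2 ((unifMeasure x r).prod (unifMeasure x r))

theorem isProbabilityMeasure_unifMeasure (x : ℝ) {r : ℝ} (hr : 0 < r) :
    IsProbabilityMeasure (unifMeasure x r) := by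
  constructor
  rw [unifMeasure, Measure.smul_apply, Measure.restrict_apply_univ, Real.volume_Ioc, smul_eq_mul]
  rw [show x + r - (x - r) = 2 * r by ring]
  refine ENNReal.inv_mul_cancel ?_ ENNReal.ofReal_ne_top
  rw [ne_eq, ENNReal.ofReal_eq_zero]; linarith

theorem inv_ofReal_ne_top {r : ℝ} (hr : 0 < r) : (ENNReal.ofReal (2 * r))⁻¹ ≠ ⊤ := by
  rw [ENNReal.inv_ne_top, ne_eq, ENNReal.ofReal_eq_zero]; linarith

instance (x r : ℝ) : SFinite (unifMeasure x r) := by unfold unifMeasure; infer_instance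

theorem unifMeasure_ac (x r : ℝ) : unifMeasure x r ≪ volume :=
  (Measure.smul_absolutelyContinuous).trans Measure.absolutelyContinuous_restrict

theorem integrable_unifMeasure {E : Type*} [NormedAddCommGroup E] {u : ℝ → E}
    (hu : LocallyIntegrable u volume) (x : ℝ)
    {r : ℝ} (hr : 0 < r) : Integrable u (unifMeasure x r) :=
  ((hu.integrableOn_isCompact isCompact_Icc).mono_set Ioc_subset_Icc_self).integrable.smul_measure
    (inv_ofReal_ne_top hr)

theorem lintegral_unifMeasure (f : ℝ → ℝ≥0∞) (x r : ℝ) :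
    ∫⁻ t, f t ∂(unifMeasure x r) =
      (ENNReal.ofReal (2 * r))⁻¹ * ∫⁻ t in Ioc (x - r) (x + r), f t := by
  rw [unifMeasure, lintegral_smul_measure, smul_eq_mul]

theorem prod_unifMeasure (x x' r r' : ℝ) :
    (unifMeasure x r).prod (unifMeasure x' r') =
      ((ENNReal.ofReal (2 * r))⁻¹ * (ENNReal.ofReal (2 * r'))⁻¹) •
        volume.restrict (Ioc (x - r) (x + r) ×ˢ Ioc (x' - r') (x' + r')) := by
  rw [unifMeasure, unifMeasure, Measure.prod_smul_left, Measure.prod_smul_right,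
    Measure.prod_restrict, smul_smul, Measure.volume_eq_prod]

/-- Jensen's inequality for the square and a probability measure. -/
theorem ofReal_norm_integral_sq_le {X : Type*} [MeasurableSpace X] (m : Measure X)
    [IsProbabilityMeasure m] {f : X → ℂ} (hf : AEStronglyMeasurable f m) :
    ENNReal.ofReal (‖∫ x, f x ∂m‖ ^ 2) ≤ ∫⁻ x, ENNReal.ofReal (‖f x‖ ^ 2) ∂m := by
  rw [lintegral_sq_eq, ENNReal.ofReal_pow (norm_nonneg _), ofReal_norm]
  gcongr
  refine (enorm_integral_le_lintegral_enorm f).trans ?_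
  rw [← eLpNorm_one_eq_lintegral_enorm]
  exact eLpNorm_le_eLpNorm_of_exponent_le one_le_two hf

/-- Cauchy–Schwarz in the inner variable of a product with a probability measure. -/
theorem eLpNorm_integral_prod_le {X Y : Type*} [MeasurableSpace X] [MeasurableSpace Y]
    (m : Measure X) (m' : Measure Y) [SFinite m] [IsProbabilityMeasure m'] {F : X × Y → ℂ}
    (hF : AEStronglyMeasurable F (m.prod m')) :
    eLpNorm (fun s => ∫ t, F (s, t) ∂m') 2 m ≤ eLpNorm F 2 (m.prod m') := by
  rw [← ENNReal.pow_le_pow_left_iff two_ne_zero, ← lintegral_sq_eq, ← lintegral_sq_eq,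
    lintegral_prod _ (by fun_prop)]
  refine lintegral_mono_ae ?_
  filter_upwards [hF.prodMk_left] with s hs
  exact ofReal_norm_integral_sq_le m' hs

theorem aestronglyMeasurable_sub_prod {u : ℝ → ℂ} (hu : AEStronglyMeasurable u volume)
    (x x' r r' : ℝ) : AEStronglyMeasurable (fun p : ℝ × ℝ => u p.1 - u p.2)
      ((unifMeasure x r).prod (unifMeasure x' r')) :=
  (hu.mono_ac (unifMeasure_ac x r)).comp_fst.sub (hu.mono_ac (unifMeasure_ac x' r')).comp_snd

theorem eLpNorm_sub_mean_le {u : ℝ → ℂ} (hu : LocallyIntegrable u volume) (x : ℝ) {r : ℝ}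
    (hr : 0 < r) :
    eLpNorm (fun t => u t - mean u x r) 2 (unifMeasure x r) ≤ osc u x r := by
  have := isProbabilityMeasure_unifMeasure x hr
  refine le_trans (le_of_eq ?_) (eLpNorm_integral_prod_le (unifMeasure x r) (unifMeasure x r)
    (aestronglyMeasurable_sub_prod hu.aestronglyMeasurable x x r r))
  congr 1
  funext s
  change _ = ∫ t, (u s - u t) ∂(unifMeasure x r)
  rw [integral_sub (integrable_const _) (integrable_unifMeasure hu x hr)]
  simp [mean]

theorem norm_mean_sub_mean_sq_le {u : ℝ → ℂ} (hu : LocallyIntegrable u volume) (x x' : ℝ) {r : ℝ}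
    (hr : 0 < r) :
    ENNReal.ofReal (‖mean u x r - mean u x' r‖ ^ 2) ≤
      ∫⁻ p, ENNReal.ofReal (‖u p.1 - u p.2‖ ^ 2) ∂((unifMeasure x r).prod (unifMeasure x' r)) := by
  have := isProbabilityMeasure_unifMeasure x hr
  have := isProbabilityMeasure_unifMeasure x' hr
  refine le_trans (le_of_eq ?_) (ofReal_norm_integral_sq_le _
    (aestronglyMeasurable_sub_prod hu.aestronglyMeasurable x x' r r))
  rw [integral_sub ((integrable_unifMeasure hu x hr).comp_fst _)
    ((integrable_unifMeasure hu x' hr).comp_snd _), integral_fun_fst, integral_fun_snd]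
  simp [mean]

theorem ofReal_norm_sub_sq_le (u : ℝ → ℂ) {s t d : ℝ} (h : |s - t| ≤ d) :
    ENNReal.ofReal (‖u s - u t‖ ^ 2) ≤
      ENNReal.ofReal (d ^ 2) * ENNReal.ofReal (‖diffQuot u (s, t)‖ ^ 2) := by
  rw [← ENNReal.ofReal_mul (sq_nonneg _), ← mul_pow]
  refine ENNReal.ofReal_le_ofReal (pow_le_pow_left₀ (norm_nonneg _) ?_ _)
  rcases eq_or_ne s t with rfl | hst
  · simp [diffQuot]
  · have h0 : 0 < |s - t| := abs_pos.2 (sub_ne_zero.2 hst)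
    rw [diffQuot, norm_div, Complex.norm_real, Real.norm_eq_abs, ← mul_div_assoc, le_div_iff₀ h0,
      mul_comm]
    gcongr

/-- The part of the `H^{1/2}` energy of `u` that is carried by `S ⊆ ℝ × ℝ`. -/
noncomputable def energyOn (u : ℝ → ℂ) (S : Set (ℝ × ℝ)) : ℝ≥0∞ :=
  ∫⁻ p in S, ENNReal.ofReal (‖diffQuot u p‖ ^ 2)

theorem lintegral_prod_unifMeasure_le (u : ℝ → ℂ) {x x' r r' d : ℝ}
    (h : ∀ s ∈ Ioc (x - r) (x + r), ∀ t ∈ Ioc (x' - r') (x' + r'), |s - t| ≤ d) :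
    ∫⁻ p, ENNReal.ofReal (‖u p.1 - u p.2‖ ^ 2) ∂((unifMeasure x r).prod (unifMeasure x' r')) ≤
      ((ENNReal.ofReal (2 * r))⁻¹ * (ENNReal.ofReal (2 * r'))⁻¹) * (ENNReal.ofReal (d ^ 2) *
        energyOn u (Ioc (x - r) (x + r) ×ˢ Ioc (x' - r') (x' + r'))) := by
  rw [prod_unifMeasure, lintegral_smul_measure, smul_eq_mul, energyOn,
    ← lintegral_const_mul' _ _ ENNReal.ofReal_ne_top]
  exact mul_le_mul_right (setLIntegral_mono' (measurableSet_Ioc.prod measurableSet_Ioc)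
    fun p hp => ofReal_norm_sub_sq_le u (h _ hp.1 _ hp.2)) _

theorem osc_le {u : ℝ → ℂ} (x : ℝ) {r : ℝ} (hr : 0 < r) :
    osc u x r ≤ eLpNorm (diffQuot u) 2 volume := by
  rw [← ENNReal.pow_le_pow_left_iff two_ne_zero, osc, ← lintegral_sq_eq, ← lintegral_sq_eq]
  refine (lintegral_prod_unifMeasure_le u (d := 2 * r) fun s hs t ht => ?_).trans ?_
  · rw [abs_le]
    constructor <;> linarith [hs.1, hs.2, ht.1, ht.2]
  · have h0 : ENNReal.ofReal (2 * r) ≠ 0 := by rw [ne_eq, ENNReal.ofReal_eq_zero]; linarith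
    rw [ENNReal.ofReal_pow (by positivity), ← mul_assoc, sq, mul_mul_mul_comm,
      ENNReal.inv_mul_cancel h0 ENNReal.ofReal_ne_top, one_mul, one_mul]
    exact setLIntegral_le_lintegral _ (fun p => ENNReal.ofReal (‖diffQuot u p‖ ^ 2))

/-- The interaction energy of two adjacent intervals of the same length controls the difference of
the means. -/
theorem norm_mean_sub_mean_sq_le_energyOn {u : ℝ → ℂ} (hu : LocallyIntegrable u volume) (x x' : ℝ)
    {r : ℝ} (hr : 0 < r) (h : |x - x'| ≤ 2 * r) :
    ENNReal.ofReal (‖mean u x r - mean u x' r‖ ^ 2 / 4) ≤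
      energyOn u (Ioc (x - r) (x + r) ×ˢ Ioc (x' - r) (x' + r)) := by
  have h1 := (norm_mean_sub_mean_sq_le hu x x' hr).trans
    (lintegral_prod_unifMeasure_le u (d := 4 * r) fun s hs t ht => by
      rw [abs_le] at *; constructor <;> linarith [hs.1, hs.2, ht.1, ht.2])
  have h0 : ENNReal.ofReal (2 * r) ≠ 0 := by rw [ne_eq, ENNReal.ofReal_eq_zero]; linarith
  have h2 : (ENNReal.ofReal (2 * r))⁻¹ * (ENNReal.ofReal (2 * r))⁻¹ *
      ENNReal.ofReal ((4 * r) ^ 2) = ENNReal.ofReal 4 := by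
    rw [show (4 * r) ^ 2 = 4 * (2 * r) ^ 2 by ring, ENNReal.ofReal_mul (p := 4) (by norm_num),
      ENNReal.ofReal_pow (p := 2 * r) (by positivity)]
    have hb : ENNReal.ofReal (2 * r) ≠ ⊤ := ENNReal.ofReal_ne_top
    generalize ENNReal.ofReal (2 * r) = b at h0 hb ⊢
    rw [show b⁻¹ * b⁻¹ * (ENNReal.ofReal 4 * b ^ 2) = ENNReal.ofReal 4 * ((b⁻¹ * b) * (b⁻¹ * b)) by
      ring, ENNReal.inv_mul_cancel h0 hb, one_mul, mul_one]
  rw [← mul_assoc, h2] at h1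
  rw [div_eq_inv_mul, ENNReal.ofReal_mul (by norm_num), ENNReal.ofReal_inv_of_pos (by norm_num)]
  rw [mul_comm, ← div_eq_mul_inv]
  exact ENNReal.div_le_of_le_mul' h1

/-! ### Dyadic means and a Trudinger inequality -/

theorem intervalIntegrable_of_locallyIntegrable {E : Type*} [NormedAddCommGroup E] {u : ℝ → E}
    (hu : LocallyIntegrable u volume) (a b : ℝ) : IntervalIntegrable u volume a b :=
  (hu.integrableOn_isCompact isCompact_uIcc).intervalIntegrable

theorem mean_eq (u : ℝ → ℂ) (x : ℝ) {r : ℝ} (hr : 0 < r) :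
    mean u x r = ((2 * r)⁻¹ : ℝ) • ∫ t in (x - r)..(x + r), u t := by
  rw [mean, unifMeasure, integral_smul_measure, intervalIntegral.integral_of_le (by linarith),
    ENNReal.toReal_inv, ENNReal.toReal_ofReal (by positivity)]

theorem mean_eq_average (u : ℝ → ℂ) (x : ℝ) {r : ℝ} (hr : 0 < r) :
    mean u x r = ⨍ t in Metric.closedBall x r, u t := by
  rw [mean_eq u x hr, setAverage_eq, Real.closedBall_eq_Icc, integral_Icc_eq_integral_Ioc,
    intervalIntegral.integral_of_le (by linarith), Real.volume_real_Icc_of_le (by linarith)]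
  congr 2; ring

theorem mean_eq_half_add {u : ℝ → ℂ} (hu : LocallyIntegrable u volume) (x : ℝ) {r : ℝ}
    (hr : 0 < r) :
    mean u x r = (mean u (x - r / 2) (r / 2) + mean u (x + r / 2) (r / 2)) / 2 := by
  rw [mean_eq u _ hr, mean_eq u _ (half_pos hr), mean_eq u _ (half_pos hr),
    show x - r / 2 - r / 2 = x - r by ring, show x - r / 2 + r / 2 = x by ring,
    show x + r / 2 - r / 2 = x by ring, show x + r / 2 + r / 2 = x + r by ring,
    ← intervalIntegral.integral_add_adjacent_intervals
      (intervalIntegrable_of_locallyIntegrable hu (x - r) x)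
      (intervalIntegrable_of_locallyIntegrable hu x (x + r)), ← smul_add, Complex.real_smul,
      Complex.real_smul]
  push_cast
  have : (r : ℂ) ≠ 0 := by exact_mod_cast hr.ne'
  field_simp

/-- The mean of `u` over the interval of the `n`-th dyadic subdivision of `(x - r, x + r]` that
contains `t`. -/
noncomputable def dyadicMean (u : ℝ → ℂ) : ℕ → ℝ → ℝ → ℝ → ℂ
  | 0, x, r, _ => mean u x r
  | n + 1, x, r, t =>
    if t ≤ x then dyadicMean u n (x - r / 2) (r / 2) t else dyadicMean u n (x + r / 2) (r / 2) t

theorem measurable_dyadicMean (u : ℝ → ℂ) (n : ℕ) (x r : ℝ) :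
    Measurable (dyadicMean u n x r) := by
  induction n generalizing x r with
  | zero => exact measurable_const
  | succ n ih => exact Measurable.ite measurableSet_Iic (ih _ _) (ih _ _)

theorem exists_dyadicMean_eq (u : ℝ → ℂ) (n : ℕ) (x r t : ℝ) (ht : t ∈ Ioc (x - r) (x + r)) :
    ∃ w, dyadicMean u n x r t = mean u w (r / 2 ^ n) ∧
      t ∈ Ioc (w - r / 2 ^ n) (w + r / 2 ^ n) := by
  induction n generalizing x r with
  | zero => exact ⟨x, by simp [dyadicMean], by simpa using ht⟩
  | succ n ih =>
    have e : r / 2 ^ (n + 1) = r / 2 / 2 ^ n := by rw [pow_succ']; field_simp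
    rw [e]
    by_cases h : t ≤ x
    · obtain ⟨w, h1, h2⟩ := ih (x - r / 2) (r / 2) ⟨by linarith [ht.1], by linarith⟩
      exact ⟨w, by rw [dyadicMean, if_pos h, h1], h2⟩
    · obtain ⟨w, h1, h2⟩ := ih (x + r / 2) (r / 2) ⟨by linarith, by linarith [ht.2]⟩
      exact ⟨w, by rw [dyadicMean, if_neg h, h1], h2⟩

theorem ae_tendsto_dyadicMean {u : ℝ → ℂ} (hu : LocallyIntegrable u volume) (x : ℝ) {r : ℝ}
    (hr : 0 < r) :
    ∀ᵐ t, t ∈ Ioc (x - r) (x + r) → Tendsto (fun n => dyadicMean u n x r t) atTop (𝓝 (u t)) := by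
  filter_upwards [IsUnifLocDoublingMeasure.ae_tendsto_average (μ := volume) hu 1] with t ht htJ
  choose w hw1 hw2 using fun n => exists_dyadicMean_eq u n x r t htJ
  have hpos : ∀ n : ℕ, 0 < r / 2 ^ n := fun n => by positivity
  have hlim : Tendsto (fun n : ℕ => r / 2 ^ n) atTop (𝓝[>] 0) := by
    refine tendsto_nhdsWithin_iff.2 ⟨?_, Eventually.of_forall hpos⟩
    have := (tendsto_pow_atTop_nhds_zero_of_lt_one (r := (1 / 2 : ℝ)) (by norm_num)
      (by norm_num)).const_mul r
    simpa [div_eq_mul_inv] using this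
  refine (ht w _ hlim (Eventually.of_forall fun n => ?_)).congr fun n => ?_
  · rw [Real.closedBall_eq_Icc, one_mul]
    exact Ioc_subset_Icc_self (hw2 n)
  · rw [hw1, mean_eq_average u _ (hpos n)]

theorem energyOn_add_le (u : ℝ → ℂ) {S T R : Set (ℝ × ℝ)} {Q : Set (ℝ × ℝ)}
    (hT : MeasurableSet T) (hR : MeasurableSet R) (hST : Disjoint S T) (hSR : Disjoint S R)
    (hTR : Disjoint T R) (hSQ : S ⊆ Q) (hTQ : T ⊆ Q) (hRQ : R ⊆ Q) :
    energyOn u S + energyOn u T + energyOn u R ≤ energyOn u Q := by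
  unfold energyOn
  rw [← lintegral_union hT hST, ← lintegral_union hR (hSR.union_left hTR)]
  exact lintegral_mono_set (union_subset (union_subset hSQ hTQ) hRQ)

/-- An interval whose two halves have means differing by `Δ` leaves at most the energy
`q - |Δ|² / 2` to either half. -/
theorem energyOn_half_le {u : ℝ → ℂ} (hu : LocallyIntegrable u volume) {x x' X r q : ℝ}
    (hr : 0 < r) (hq0 : 0 ≤ q) (hd : |x - x'| ≤ 2 * r)
    (hdisj : Disjoint (Ioc (x - r) (x + r)) (Ioc (x' - r) (x' + r)))
    (h1 : Ioc (x - r) (x + r) ⊆ Ioc (X - 2 * r) (X + 2 * r))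
    (h2 : Ioc (x' - r) (x' + r) ⊆ Ioc (X - 2 * r) (X + 2 * r))
    (hq : energyOn u (Ioc (X - 2 * r) (X + 2 * r) ×ˢ Ioc (X - 2 * r) (X + 2 * r))
      ≤ ENNReal.ofReal q) :
    0 ≤ q - ‖mean u x r - mean u x' r‖ ^ 2 / 2 ∧
    energyOn u (Ioc (x - r) (x + r) ×ˢ Ioc (x - r) (x + r)) ≤
      ENNReal.ofReal (q - ‖mean u x r - mean u x' r‖ ^ 2 / 2) := by
  have hc1 := norm_mean_sub_mean_sq_le_energyOn hu x x' hr hd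
  have hc2 := norm_mean_sub_mean_sq_le_energyOn hu x' x hr (by rwa [abs_sub_comm])
  rw [norm_sub_rev] at hc2
  set D := ‖mean u x r - mean u x' r‖
  have hD : 0 ≤ D ^ 2 / 4 := by positivity
  have hsum := energyOn_add_le u (measurableSet_Ioc.prod measurableSet_Ioc)
    (measurableSet_Ioc.prod measurableSet_Ioc)
    (disjoint_prod.2 (Or.inr hdisj)) (disjoint_prod.2 (Or.inl hdisj))
    (disjoint_prod.2 (Or.inl hdisj)) (prod_mono h1 h1) (prod_mono h1 h2) (prod_mono h2 h1)
  have key : energyOn u (Ioc (x - r) (x + r) ×ˢ Ioc (x - r) (x + r)) + ENNReal.ofReal (D ^ 2 / 2)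
      ≤ ENNReal.ofReal q := by
    rw [show D ^ 2 / 2 = D ^ 2 / 4 + D ^ 2 / 4 by ring, ENNReal.ofReal_add hD hD, ← add_assoc]
    exact (add_le_add (add_le_add le_rfl hc1) hc2).trans (hsum.trans hq)
  have hqD : D ^ 2 / 2 ≤ q := by
    have h3 := (le_add_self).trans key
    by_contra hlt
    push Not at hlt
    exact absurd h3 (not_le.2 ((ENNReal.ofReal_lt_ofReal_iff_of_nonneg hq0).2 hlt))
  refine ⟨by linarith, ?_⟩
  rw [ENNReal.ofReal_sub _ (by positivity)]
  exact ENNReal.le_sub_of_add_le_right ENNReal.ofReal_ne_top key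

/-- The inductive step: the energy `d ^ 2 / 2` lost by either half pays for replacing the means
`a`, `b` over the halves by their average. -/
theorem exp_add_exp_le (a b p d q : ℝ) (hd : (a - b) ^ 2 ≤ d ^ 2) :
    Real.exp (p * a + p ^ 2 * (q - d ^ 2 / 2) / 4) + Real.exp (p * b + p ^ 2 * (q - d ^ 2 / 2) / 4)
      ≤ 2 * Real.exp (p * ((a + b) / 2) + p ^ 2 * q / 4) := by
  have h := Real.cosh_le_exp_half_sq (p * (a - b) / 2)
  rw [Real.cosh_eq] at h
  have h2 : Real.exp ((p * (a - b) / 2) ^ 2 / 2) ≤ Real.exp (p ^ 2 * d ^ 2 / 8) := by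
    refine Real.exp_le_exp.2 ?_
    have := mul_le_mul_of_nonneg_left hd (sq_nonneg p)
    linarith [this, show (p * (a - b) / 2) ^ 2 / 2 = p ^ 2 * (a - b) ^ 2 / 8 by ring]
  have e1 : p * a + p ^ 2 * (q - d ^ 2 / 2) / 4 =
    p * (a - b) / 2 + (p * ((a + b) / 2) + p ^ 2 * q / 4 - p ^ 2 * d ^ 2 / 8) := by ring
  have e2 : p * b + p ^ 2 * (q - d ^ 2 / 2) / 4 =
    -(p * (a - b) / 2) + (p * ((a + b) / 2) + p ^ 2 * q / 4 - p ^ 2 * d ^ 2 / 8) := by ring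
  have e3 : p * ((a + b) / 2) + p ^ 2 * q / 4 =
    p ^ 2 * d ^ 2 / 8 + (p * ((a + b) / 2) + p ^ 2 * q / 4 - p ^ 2 * d ^ 2 / 8) := by ring
  generalize p * ((a + b) / 2) + p ^ 2 * q / 4 - p ^ 2 * d ^ 2 / 8 = c at e1 e2 e3
  rw [e1, e2, e3]
  rw [Real.exp_add, Real.exp_add, Real.exp_add, ← add_mul, ← mul_assoc]
  gcongr
  linarith

/-- Exponential integrability of the dyadic means, with a bound that does not depend on the depth of
the subdivision. -/
theorem lintegral_exp_dyadicMean_le {u : ℝ → ℂ} (hu : LocallyIntegrable u volume) (p : ℝ) (n : ℕ)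
    (x r q : ℝ) (hr : 0 < r) (hq0 : 0 ≤ q)
    (hq : energyOn u (Ioc (x - r) (x + r) ×ˢ Ioc (x - r) (x + r)) ≤ ENNReal.ofReal q) :
    ∫⁻ t in Ioc (x - r) (x + r), ENNReal.ofReal (Real.exp (p * (dyadicMean u n x r t).re)) ≤
      ENNReal.ofReal (2 * r * Real.exp (p * (mean u x r).re + p ^ 2 * q / 4)) := by
  induction n generalizing x r q with
  | zero =>
    simp only [dyadicMean]
    rw [lintegral_const, Measure.restrict_apply_univ, Real.volume_Ioc,
      ← ENNReal.ofReal_mul (Real.exp_nonneg _)]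
    refine ENNReal.ofReal_le_ofReal ?_
    rw [mul_comm, show x + r - (x - r) = 2 * r by ring]
    gcongr
    have : 0 ≤ p ^ 2 * q / 4 := by positivity
    linarith
  | succ n ih =>
    have hr2 : 0 < r / 2 := half_pos hr
    have e1 : x - r / 2 - r / 2 = x - r := by ring
    have e2 : x - r / 2 + r / 2 = x := by ring
    have e3 : x + r / 2 - r / 2 = x := by ring
    have e4 : x + r / 2 + r / 2 = x + r := by ring
    have e5 : 2 * (r / 2) = r := by ring
    have hdisj : Disjoint (Ioc (x - r) x) (Ioc x (x + r)) :=
      disjoint_left.2 fun t ht ht' => absurd ht.2 (not_le.2 ht'.1)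
    have hs1 : Ioc (x - r) x ⊆ Ioc (x - r) (x + r) := Ioc_subset_Ioc_right (by linarith)
    have hs2 : Ioc x (x + r) ⊆ Ioc (x - r) (x + r) := Ioc_subset_Ioc_left (by linarith)
    obtain ⟨hn1, he1⟩ := energyOn_half_le hu (x := x - r / 2) (x' := x + r / 2) (X := x)
      (r := r / 2) (q := q) hr2 hq0 (by rw [abs_le]; constructor <;> linarith)
      (by rwa [e1, e2, e3, e4]) (by rwa [e1, e2, e5]) (by rwa [e3, e4, e5]) (by rwa [e5])
    obtain ⟨hn2, he2⟩ := energyOn_half_le hu (x := x + r / 2) (x' := x - r / 2) (X := x)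
      (r := r / 2) (q := q) hr2 hq0 (by rw [abs_le]; constructor <;> linarith)
      (by rw [e1, e2, e3, e4]; exact hdisj.symm) (by rwa [e3, e4, e5]) (by rwa [e1, e2, e5])
      (by rwa [e5])
    rw [norm_sub_rev] at hn2 he2
    set a := mean u (x - r / 2) (r / 2) with ha
    set b := mean u (x + r / 2) (r / 2) with hb
    have i1 := ih (x - r / 2) (r / 2) _ hr2 hn1 he1
    have i2 := ih (x + r / 2) (r / 2) _ hr2 hn2 he2
    rw [e1, e2, e5, ← ha] at i1
    rw [e3, e4, e5, ← hb] at i2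
    have hmean : (mean u x r).re = (a.re + b.re) / 2 := by
      rw [mean_eq_half_add hu x hr, ← Complex.ofReal_ofNat, Complex.div_ofReal_re, Complex.add_re]
    have hab : (a.re - b.re) ^ 2 ≤ ‖a - b‖ ^ 2 := by
      rw [← Complex.sub_re, ← sq_abs]
      exact pow_le_pow_left₀ (abs_nonneg _) (Complex.abs_re_le_norm _) _
    have j1 : ∫⁻ t in Ioc (x - r) x,
        ENNReal.ofReal (Real.exp (p * (dyadicMean u (n + 1) x r t).re)) =
        ∫⁻ t in Ioc (x - r) x,
          ENNReal.ofReal (Real.exp (p * (dyadicMean u n (x - r / 2) (r / 2) t).re)) :=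
      setLIntegral_congr_fun measurableSet_Ioc fun t ht => by
        simp only [dyadicMean, if_pos ht.2]
    have j2 : ∫⁻ t in Ioc x (x + r),
        ENNReal.ofReal (Real.exp (p * (dyadicMean u (n + 1) x r t).re)) =
        ∫⁻ t in Ioc x (x + r),
          ENNReal.ofReal (Real.exp (p * (dyadicMean u n (x + r / 2) (r / 2) t).re)) :=
      setLIntegral_congr_fun measurableSet_Ioc fun t ht => by
        simp only [dyadicMean, if_neg (not_le.2 ht.1)]
    rw [← Ioc_union_Ioc_eq_Ioc (b := x) (by linarith) (by linarith),
      lintegral_union measurableSet_Ioc hdisj, j1, j2]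
    refine (add_le_add i1 i2).trans ?_
    rw [← ENNReal.ofReal_add (by positivity) (by positivity)]
    refine ENNReal.ofReal_le_ofReal ?_
    rw [← mul_add, hmean]
    have := mul_le_mul_of_nonneg_left (exp_add_exp_le a.re b.re p ‖a - b‖ q hab) hr.le
    linarith

/-- A Trudinger type inequality: functions of finite `H^{1/2}` energy on an interval have
sub-Gaussian fluctuations there. -/
theorem lintegral_exp_sub_mean_le {u : ℝ → ℂ} (hu : LocallyIntegrable u volume) (p x : ℝ)
    {r q : ℝ} (hr : 0 < r) (hq0 : 0 ≤ q)
    (hq : energyOn u (Ioc (x - r) (x + r) ×ˢ Ioc (x - r) (x + r)) ≤ ENNReal.ofReal q) :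
    ∫⁻ t, ENNReal.ofReal (Real.exp (p * (u t - mean u x r).re)) ∂(unifMeasure x r) ≤
      ENNReal.ofReal (Real.exp (p ^ 2 * q / 4)) := by
  have h1 : ∫⁻ t in Ioc (x - r) (x + r), ENNReal.ofReal (Real.exp (p * (u t).re)) ≤
      ENNReal.ofReal (2 * r * Real.exp (p * (mean u x r).re + p ^ 2 * q / 4)) := by
    have hmeas : ∀ n, Measurable fun t =>
        ENNReal.ofReal (Real.exp (p * (dyadicMean u n x r t).re)) := fun n => by
      have := measurable_dyadicMean u n x r
      fun_prop
    calc ∫⁻ t in Ioc (x - r) (x + r), ENNReal.ofReal (Real.exp (p * (u t).re))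
        = ∫⁻ t in Ioc (x - r) (x + r), liminf (fun n =>
            ENNReal.ofReal (Real.exp (p * (dyadicMean u n x r t).re))) atTop := by
          refine setLIntegral_congr_fun_ae measurableSet_Ioc ?_
          filter_upwards [ae_tendsto_dyadicMean hu x hr] with t ht htJ
          have hc : Continuous fun z : ℂ => ENNReal.ofReal (Real.exp (p * z.re)) :=
            ENNReal.continuous_ofReal.comp (by fun_prop)
          exact ((hc.tendsto _).comp (ht htJ)).liminf_eq.symm
      _ ≤ liminf (fun n => ∫⁻ t in Ioc (x - r) (x + r),
            ENNReal.ofReal (Real.exp (p * (dyadicMean u n x r t).re))) atTop :=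
          lintegral_liminf_le hmeas
      _ ≤ _ := by
          refine liminf_le_of_le (by isBoundedDefault) fun b hb => ?_
          obtain ⟨n, hn⟩ := hb.exists
          exact hn.trans (lintegral_exp_dyadicMean_le hu p n x r q hr hq0 hq)
  have h2 : ∀ t, ENNReal.ofReal (Real.exp (p * (u t - mean u x r).re)) =
      ENNReal.ofReal (Real.exp (-(p * (mean u x r).re))) *
        ENNReal.ofReal (Real.exp (p * (u t).re)) := fun t => by
    rw [← ENNReal.ofReal_mul (Real.exp_nonneg _), ← Real.exp_add, Complex.sub_re]
    congr 2; ring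
  simp_rw [h2]
  rw [lintegral_const_mul' _ _ ENNReal.ofReal_ne_top, lintegral_unifMeasure,
    ← ENNReal.ofReal_inv_of_pos (by positivity)]
  refine (mul_le_mul_right (mul_le_mul_right h1 _) _).trans ?_
  rw [← ENNReal.ofReal_mul (by positivity), ← ENNReal.ofReal_mul (by positivity)]
  refine ENNReal.ofReal_le_ofReal (le_of_eq ?_)
  rw [inv_mul_cancel_left₀ (by positivity), ← Real.exp_add]
  congr 1; ring

/-! ### Moments of elements of `H^{1/2}` and the hyperbolic integral of the oscillation -/

theorem HHalf.locallyIntegrable (u : HHalf) : LocallyIntegrable u volume := u.2.1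

theorem HHalf.eLpNorm_diffQuot (u : HHalf) :
    eLpNorm (diffQuot u) 2 volume = ENNReal.ofReal (2 * Real.pi * ‖u‖) := by
  have h : eLpNorm (diffQuot u) 2 volume < ⊤ := (halfEnergy_lt_top_iff _).1 u.2.2
  rw [HHalf.norm_eq, show (1 : ℝ) / (4 * Real.pi ^ 2) = ((2 * Real.pi)⁻¹) ^ 2 by ring,
    Real.sqrt_sq (by positivity), mul_inv_cancel_left₀ (by positivity), ENNReal.ofReal_toReal h.ne]

theorem HHalf.energyOn_le (u : HHalf) (S : Set (ℝ × ℝ)) :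
    energyOn u S ≤ ENNReal.ofReal ((2 * Real.pi * ‖u‖) ^ 2) := by
  rw [ENNReal.ofReal_pow (by positivity), ← HHalf.eLpNorm_diffQuot, ← lintegral_sq_eq]
  exact setLIntegral_le_lintegral _ (fun p => ENNReal.ofReal (‖diffQuot u p‖ ^ 2))

theorem HHalf.osc_le (u : HHalf) (x : ℝ) {r : ℝ} (hr : 0 < r) :
    osc u x r ≤ ENNReal.ofReal (2 * Real.pi * ‖u‖) := by
  rw [← HHalf.eLpNorm_diffQuot]; exact WeilPetersson.osc_le x hr

theorem lintegral_pow_four_eq {X : Type*} [MeasurableSpace X] (m : Measure X) (g : X → ℂ) :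
    ∫⁻ x, ENNReal.ofReal (‖g x‖ ^ 4) ∂m = eLpNorm g 4 m ^ 4 := by
  have h := eLpNorm_nnreal_pow_eq_lintegral (μ := m) (f := g) (p := 4) four_ne_zero
  have h2 : eLpNorm g 4 m ^ 4 = eLpNorm g ((4 : NNReal) : ℝ≥0∞) m ^ ((4 : NNReal) : ℝ) := by
    rw [NNReal.coe_ofNat, ENNReal.coe_ofNat, ENNReal.rpow_ofNat]
  rw [h2, h]
  refine lintegral_congr fun x => ?_
  rw [NNReal.coe_ofNat, ENNReal.rpow_ofNat, ENNReal.ofReal_pow (norm_nonneg _), ofReal_norm]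

theorem HHalf.eLpNorm_exp_sub_mean_le (u : HHalf) (x : ℝ) {r : ℝ} (hr : 0 < r) :
    eLpNorm (fun t => Complex.exp (u t - mean u x r)) 4 (unifMeasure x r) ≤
      ENNReal.ofReal (Real.exp ((2 * Real.pi * ‖u‖) ^ 2)) := by
  rw [← ENNReal.pow_le_pow_left_iff four_ne_zero, ← lintegral_pow_four_eq,
    ← ENNReal.ofReal_pow (Real.exp_nonneg _), ← Real.exp_nat_mul]
  convert lintegral_exp_sub_mean_le u.locallyIntegrable 4 x hr (sq_nonneg _)
    (u.energyOn_le _) using 4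
  · rw [Complex.norm_exp, ← Real.exp_nat_mul]; norm_num
  · norm_num; ring

theorem mean_smul (c : ℂ) (u : ℝ → ℂ) (x r : ℝ) : mean (c • u) x r = c * mean u x r :=
  integral_const_mul _ _

theorem pow_four_le_exp_add_exp (x : ℝ) : x ^ 4 ≤ 24 * (Real.exp x + Real.exp (-x)) := by
  have h := Real.pow_div_factorial_le_exp |x| (abs_nonneg x) 4
  have h4 : |x| ^ 4 = x ^ 4 := by rw [show 4 = 2 * 2 from rfl, pow_mul, sq_abs, ← pow_mul]
  have h2 : Real.exp |x| ≤ Real.exp x + Real.exp (-x) := by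
    rcases abs_cases x with h | h <;> rw [h.1] <;>
      linarith [Real.exp_pos x, Real.exp_pos (-x)]
  rw [h4, show ((Nat.factorial 4 : ℕ) : ℝ) = 24 by norm_num [Nat.factorial]] at h
  linarith

theorem norm_pow_four_le (z : ℂ) {p : ℝ} (hp : 0 < p) :
    ‖z‖ ^ 4 ≤ 192 / p ^ 4 * (Real.exp (p * z.re) + Real.exp (-p * z.re) +
      Real.exp (p * (-Complex.I * z).re) + Real.exp (-p * (-Complex.I * z).re)) := by
  have h1 := pow_four_le_exp_add_exp (p * z.re)
  have h2 := pow_four_le_exp_add_exp (p * z.im)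
  have h3 : ‖z‖ ^ 4 ≤ 8 * (z.re ^ 4 + z.im ^ 4) := by
    have e : ‖z‖ ^ 4 = (z.re ^ 2 + z.im ^ 2) ^ 2 := by
      rw [show ‖z‖ ^ 4 = (‖z‖ ^ 2) ^ 2 by ring, ← Complex.normSq_eq_norm_sq, Complex.normSq_apply]
      ring
    rw [e]
    nlinarith [sq_nonneg (z.re ^ 2 - z.im ^ 2), sq_nonneg (z.re ^ 2), sq_nonneg (z.im ^ 2)]
  have e : (-Complex.I * z).re = z.im := by simp
  rw [e, div_mul_eq_mul_div, le_div_iff₀ (by positivity), neg_mul, neg_mul]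
  have h4 := mul_le_mul_of_nonneg_right h3 (pow_pos hp 4).le
  rw [mul_pow] at h1 h2
  linarith

theorem lintegral_norm_pow_four_le {X : Type*} [MeasurableSpace X] (m : Measure X) {k : X → ℂ}
    (hk : AEMeasurable k m) {p : ℝ} (hp : 0 < p) {A B C D : ℝ≥0∞}
    (h1 : ∫⁻ t, ENNReal.ofReal (Real.exp (p * (k t).re)) ∂m ≤ A)
    (h2 : ∫⁻ t, ENNReal.ofReal (Real.exp (-p * (k t).re)) ∂m ≤ B)
    (h3 : ∫⁻ t, ENNReal.ofReal (Real.exp (p * (-Complex.I * k t).re)) ∂m ≤ C)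
    (h4 : ∫⁻ t, ENNReal.ofReal (Real.exp (-p * (-Complex.I * k t).re)) ∂m ≤ D) :
    ∫⁻ t, ENNReal.ofReal (‖k t‖ ^ 4) ∂m ≤ ENNReal.ofReal (192 / p ^ 4) * (A + B + C + D) := by
  have hc : ∀ (p' : ℝ) (c : ℂ),
      AEMeasurable (fun t => ENNReal.ofReal (Real.exp (p' * (c * k t).re))) m := fun p' c =>
    (ENNReal.continuous_ofReal.comp (by fun_prop : Continuous fun z : ℂ =>
      Real.exp (p' * (c * z).re))).measurable.comp_aemeasurable hk
  have hc1 : ∀ p' : ℝ, AEMeasurable (fun t => ENNReal.ofReal (Real.exp (p' * (k t).re))) m :=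
    fun p' => by simpa using hc p' 1
  refine le_trans (lintegral_mono fun t => (?_ : _ ≤ ENNReal.ofReal (192 / p ^ 4) * (
    ENNReal.ofReal (Real.exp (p * (k t).re)) + ENNReal.ofReal (Real.exp (-p * (k t).re)) +
    ENNReal.ofReal (Real.exp (p * (-Complex.I * k t).re)) +
    ENNReal.ofReal (Real.exp (-p * (-Complex.I * k t).re))))) ?_
  · rw [← ENNReal.ofReal_add (by positivity) (by positivity),
      ← ENNReal.ofReal_add (by positivity) (by positivity),
      ← ENNReal.ofReal_add (by positivity) (by positivity), ← ENNReal.ofReal_mul (by positivity)]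
    exact ENNReal.ofReal_le_ofReal (norm_pow_four_le _ hp)
  · rw [lintegral_const_mul' _ _ ENNReal.ofReal_ne_top,
      lintegral_add_right' _ (hc (-p) _), lintegral_add_right' _ (hc p _),
      lintegral_add_right' _ (hc1 (-p))]
    exact mul_le_mul_right (add_le_add (add_le_add (add_le_add h1 h2) h3) h4) _

theorem HHalf.eLpNorm_sub_mean_four_le (u : HHalf) (x : ℝ) {r : ℝ} (hr : 0 < r) :
    eLpNorm (fun t => u t - mean u x r) 4 (unifMeasure x r) ≤
      ENNReal.ofReal (8 * Real.pi * ‖u‖) := by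
  have key : ∀ s : ℝ, ‖u‖ < s →
      eLpNorm (fun t => u t - mean u x r) 4 (unifMeasure x r) ≤
        ENNReal.ofReal (8 * Real.pi * s) := by
    -- `s > ‖u‖` keeps the exponent `p` below finite when `‖u‖ = 0`
    intro s hs
    have hs0 : 0 < s := (norm_nonneg u).trans_lt hs
    have hpi := Real.pi_pos
    -- with this exponent the bound `exp (p ^ 2 * q / 4)` of the exponential moments is `exp 1`
    set p : ℝ := (Real.pi * s)⁻¹ with hp
    have hp0 : 0 < p := by positivity
    have hq : p ^ 2 * (2 * Real.pi * s) ^ 2 / 4 = 1 := by rw [hp]; field_simp; norm_num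
    have hus : (2 * Real.pi * ‖u‖) ^ 2 ≤ (2 * Real.pi * s) ^ 2 := by gcongr
    have hus' := ENNReal.ofReal_le_ofReal hus
    have hexp : ∀ v : HHalf, ‖v‖ = ‖u‖ → ∀ p', p' ^ 2 = p ^ 2 →
        ∫⁻ t, ENNReal.ofReal (Real.exp (p' * (v t - mean v x r).re)) ∂(unifMeasure x r) ≤
          ENNReal.ofReal (Real.exp 1) := by
      intro v hv p' hp'
      refine (lintegral_exp_sub_mean_le v.locallyIntegrable p' x hr (sq_nonneg _)
        ((v.energyOn_le _).trans (hv ▸ hus'))).trans_eq ?_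
      rw [hp', hq]
    have hv : ‖(-Complex.I) • u‖ = ‖u‖ := by rw [norm_smul]; simp
    have hvt : ∀ t, ((-Complex.I) • u : HHalf) t - mean ((-Complex.I) • u : HHalf) x r =
        -Complex.I * (u t - mean u x r) := by
      intro t
      have e : ((-Complex.I) • u : HHalf).toFun = (-Complex.I) • u.toFun := rfl
      rw [e, mean_smul, mul_sub]; rfl
    have a1 := hexp u rfl p rfl
    have a2 := hexp u rfl (-p) (neg_sq p)
    have a3 := hexp _ hv p rfl
    have a4 := hexp _ hv (-p) (neg_sq p)
    simp only [hvt] at a3 a4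
    have hm : AEMeasurable (fun t => u t - mean u x r) (unifMeasure x r) :=
      (u.locallyIntegrable.aestronglyMeasurable.mono_ac (unifMeasure_ac x r)).aemeasurable.sub
        aemeasurable_const
    rw [← ENNReal.pow_le_pow_left_iff four_ne_zero, ← lintegral_pow_four_eq,
      ← ENNReal.ofReal_pow (by positivity)]
    calc ∫⁻ t, ENNReal.ofReal (‖u t - mean u x r‖ ^ 4) ∂(unifMeasure x r)
        ≤ ENNReal.ofReal (192 / p ^ 4) * (ENNReal.ofReal (Real.exp 1) +
            ENNReal.ofReal (Real.exp 1) + ENNReal.ofReal (Real.exp 1) +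
            ENNReal.ofReal (Real.exp 1)) := lintegral_norm_pow_four_le _ hm hp0 a1 a2 a3 a4
      _ ≤ ENNReal.ofReal ((8 * Real.pi * s) ^ 4) := by
          rw [← ENNReal.ofReal_add (by positivity) (by positivity),
            ← ENNReal.ofReal_add (by positivity) (by positivity),
            ← ENNReal.ofReal_add (by positivity) (by positivity),
            ← ENNReal.ofReal_mul (by positivity)]
          refine ENNReal.ofReal_le_ofReal ?_
          have e : 192 / p ^ 4 = 192 * (Real.pi * s) ^ 4 := by rw [hp]; field_simp
          rw [e, show (8 * Real.pi * s) ^ 4 = 4096 * (Real.pi * s) ^ 4 by ring]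
          have h4 : 0 < (Real.pi * s) ^ 4 := by positivity
          nlinarith [Real.exp_one_lt_d9]
  have hlim : Tendsto (fun s => ENNReal.ofReal (8 * Real.pi * s)) (𝓝[>] ‖u‖)
      (𝓝 (ENNReal.ofReal (8 * Real.pi * ‖u‖))) :=
    ((ENNReal.continuous_ofReal.comp (by fun_prop)).tendsto _).mono_left nhdsWithin_le_nhds
  exact ge_of_tendsto hlim (eventually_mem_nhdsWithin.mono fun s hs => key s hs)

theorem lintegral_Ici_inv_cube_le {c : ℝ} (hc : 0 < c) :
    ∫⁻ y in Ici c, ENNReal.ofReal (1 / (2 * y ^ 3)) = ENNReal.ofReal (1 / (4 * c ^ 2)) := by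
  have hi := integrableOn_Ioi_rpow_of_lt (a := -3) (by norm_num) hc
  have hv := integral_Ioi_rpow_of_lt (a := -3) (by norm_num) hc
  have e : ∀ y ∈ Ioi c, ENNReal.ofReal (1 / (2 * y ^ 3)) =
      ENNReal.ofReal (1 / 2) * ENNReal.ofReal (y ^ (-3 : ℝ)) := by
    intro y hy
    have hy0 : 0 < y := hc.trans hy
    rw [← ENNReal.ofReal_mul (by norm_num), Real.rpow_neg hy0.le]
    congr 1
    rw [show (3 : ℝ) = (3 : ℕ) by norm_num, Real.rpow_natCast]
    field_simp
  rw [setLIntegral_congr Ioi_ae_eq_Ici.symm, setLIntegral_congr_fun measurableSet_Ioi e,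
    lintegral_const_mul' _ _ ENNReal.ofReal_ne_top, ← ofReal_integral_eq_lintegral_ofReal hi,
    hv, ← ENNReal.ofReal_mul (by norm_num)]
  · congr 1
    rw [show (-3 : ℝ) + 1 = -(2 : ℕ) by norm_num, Real.rpow_neg hc.le, Real.rpow_natCast]
    field_simp
    norm_num
  · filter_upwards [self_mem_ae_restrict measurableSet_Ioi] with y hy
    exact Real.rpow_nonneg (hc.trans hy).le _

/-- The weight `1 / (4 y⁴)` on the set of those `(x, y)` with `y > 0` for which `s` and `t` lie in
`(x - y, x + y]`. -/
noncomputable def coneWeight (z p : ℝ × ℝ) : ℝ≥0∞ :=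
  {w : (ℝ × ℝ) × (ℝ × ℝ) | 0 < w.1.2 ∧ (w.1.1 - w.1.2 < w.2.1 ∧ w.2.1 ≤ w.1.1 + w.1.2) ∧
    (w.1.1 - w.1.2 < w.2.2 ∧ w.2.2 ≤ w.1.1 + w.1.2)}.indicator
    (fun w => ENNReal.ofReal (1 / (4 * w.1.2 ^ 4))) (z, p)

theorem measurable_coneWeight : Measurable (Function.uncurry coneWeight) := by
  have : Function.uncurry coneWeight =
    {w : (ℝ × ℝ) × (ℝ × ℝ) | 0 < w.1.2 ∧ (w.1.1 - w.1.2 < w.2.1 ∧ w.2.1 ≤ w.1.1 + w.1.2) ∧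
    (w.1.1 - w.1.2 < w.2.2 ∧ w.2.2 ≤ w.1.1 + w.1.2)}.indicator
    (fun w => ENNReal.ofReal (1 / (4 * w.1.2 ^ 4))) := by
    ext ⟨z, p⟩; rfl
  rw [this]
  refine Measurable.indicator (by fun_prop) ?_
  have hcone : ∀ g : (ℝ × ℝ) × (ℝ × ℝ) → ℝ, Measurable g → MeasurableSet
      {w : (ℝ × ℝ) × (ℝ × ℝ) | w.1.1 - w.1.2 < g w ∧ g w ≤ w.1.1 + w.1.2} := fun g hg =>
    (measurableSet_lt (by fun_prop) hg).inter (measurableSet_le hg (by fun_prop))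
  have hpos : Measurable fun w : (ℝ × ℝ) × (ℝ × ℝ) => w.1.2 := by fun_prop
  exact (measurableSet_lt measurable_const hpos).inter
    ((hcone (fun w => w.2.1) (by fun_prop)).inter (hcone (fun w => w.2.2) (by fun_prop)))

theorem lintegral_coneWeight_le {s t : ℝ} (hst : s ≠ t) :
    ∫⁻ z, coneWeight z (s, t) ≤ ENNReal.ofReal (1 / (s - t) ^ 2) := by
  have hd : 0 < |s - t| / 2 := half_pos (abs_pos.2 (sub_ne_zero.2 hst))
  have hm : Measurable fun z => coneWeight z (s, t) :=
    measurable_coneWeight.comp (measurable_id.prodMk measurable_const)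
  rw [Measure.volume_eq_prod, lintegral_prod_symm' _ hm]
  have hle : ∀ y, ∫⁻ x, coneWeight (x, y) (s, t) ≤
      (Ici (|s - t| / 2)).indicator (fun y => ENNReal.ofReal (1 / (2 * y ^ 3))) y := by
    intro y
    by_cases hy : |s - t| / 2 ≤ y
    · have hy0 : 0 < y := hd.trans_le hy
      rw [indicator_of_mem (mem_Ici.2 hy)]
      calc ∫⁻ x, coneWeight (x, y) (s, t)
          ≤ ∫⁻ x, (Icc (s - y) (s + y)).indicator
              (fun _ => ENNReal.ofReal (1 / (4 * y ^ 4))) x := by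
            refine lintegral_mono fun x => ?_
            by_cases hx : x ∈ Icc (s - y) (s + y)
            · rw [indicator_of_mem hx]
              exact indicator_le_self' (fun _ _ => zero_le) _
            · rw [indicator_of_notMem hx, coneWeight, indicator_of_notMem]
              rintro ⟨-, ⟨h1, h2⟩, -⟩
              exact hx ⟨by dsimp at h1 h2; linarith, by dsimp at h1 h2; linarith⟩
        _ = ENNReal.ofReal (1 / (2 * y ^ 3)) := by
            rw [lintegral_indicator measurableSet_Icc, lintegral_const,
              Measure.restrict_apply_univ, Real.volume_Icc, ← ENNReal.ofReal_mul (by positivity)]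
            congr 1
            field_simp
            ring
    · rw [indicator_of_notMem (by simpa using hy)]
      refine le_of_eq ((lintegral_congr fun x => ?_).trans lintegral_zero)
      rw [coneWeight, indicator_of_notMem]
      rintro ⟨-, ⟨h1, h2⟩, h3, h4⟩
      dsimp at h1 h2 h3 h4
      refine hy ?_
      rw [div_le_iff₀ two_pos, abs_le]
      constructor <;> linarith
  refine (lintegral_mono hle).trans ?_
  rw [lintegral_indicator measurableSet_Ici, lintegral_Ici_inv_cube_le hd, div_pow, sq_abs]
  refine ENNReal.ofReal_le_ofReal (le_of_eq ?_)
  ring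

theorem setLIntegral_upperHalf_eq (f : ℝ × ℝ → ℝ≥0∞) :
    ∫⁻ z in upperHalf, f (z.re, z.im) = ∫⁻ p in {p : ℝ × ℝ | 0 < p.2}, f p :=
  Complex.volume_preserving_equiv_real_prod.setLIntegral_comp_preimage_emb
    Complex.measurableEquivRealProd.measurableEmbedding f {p : ℝ × ℝ | 0 < p.2}

/-- The square of the mean oscillation is integrable for the hyperbolic area, with integral at most
the `H^{1/2}` energy. -/
theorem lintegral_osc_sq_le {u : ℝ → ℂ} (hu : LocallyIntegrable u volume) :
    ∫⁻ z in upperHalf, osc u z.re z.im ^ 2 * ENNReal.ofReal (1 / z.im ^ 2) ≤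
      eLpNorm (diffQuot u) 2 volume ^ 2 := by
  have hmu : AEStronglyMeasurable (fun p : ℝ × ℝ => u p.1 - u p.2) volume :=
    hu.aestronglyMeasurable.comp_fst.sub hu.aestronglyMeasurable.comp_snd
  have hms : MeasurableSet {p : ℝ × ℝ | 0 < p.2} := measurableSet_lt (by fun_prop) (by fun_prop)
  rw [setLIntegral_upperHalf_eq (fun p => osc u p.1 p.2 ^ 2 * ENNReal.ofReal (1 / p.2 ^ 2)),
    ← lintegral_sq_eq]
  calc ∫⁻ z in {p : ℝ × ℝ | 0 < p.2}, osc u z.1 z.2 ^ 2 * ENNReal.ofReal (1 / z.2 ^ 2)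
      = ∫⁻ z in {p : ℝ × ℝ | 0 < p.2}, ∫⁻ p : ℝ × ℝ,
          coneWeight z p * ENNReal.ofReal (‖u p.1 - u p.2‖ ^ 2) := by
        refine setLIntegral_congr_fun hms fun z hz => ?_
        have hz : 0 < z.2 := hz
        rw [osc, ← lintegral_sq_eq, prod_unifMeasure, lintegral_smul_measure, smul_eq_mul,
          ← lintegral_indicator (measurableSet_Ioc.prod measurableSet_Ioc), mul_right_comm,
          ← ENNReal.ofReal_inv_of_pos (by positivity), ← ENNReal.ofReal_mul (by positivity),
          ← ENNReal.ofReal_mul (by positivity), ← lintegral_const_mul' _ _ ENNReal.ofReal_ne_top]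
        refine lintegral_congr fun p => ?_
        by_cases hp : p ∈ Ioc (z.1 - z.2) (z.1 + z.2) ×ˢ Ioc (z.1 - z.2) (z.1 + z.2)
        · rw [indicator_of_mem hp, coneWeight, indicator_of_mem (by exact ⟨hz, hp.1, hp.2⟩)]
          congr 2
          field_simp
          norm_num
        · rw [indicator_of_notMem hp, coneWeight, indicator_of_notMem, mul_zero, zero_mul]
          rintro ⟨-, h1, h2⟩
          exact hp ⟨h1, h2⟩
    _ ≤ ∫⁻ z : ℝ × ℝ, ∫⁻ p : ℝ × ℝ,
          coneWeight z p * ENNReal.ofReal (‖u p.1 - u p.2‖ ^ 2) := setLIntegral_le_lintegral _ _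
    _ = ∫⁻ p : ℝ × ℝ, ∫⁻ z : ℝ × ℝ,
          coneWeight z p * ENNReal.ofReal (‖u p.1 - u p.2‖ ^ 2) := by
        refine lintegral_lintegral_swap ?_
        have h1 : AEStronglyMeasurable (fun w : (ℝ × ℝ) × (ℝ × ℝ) => u w.2.1 - u w.2.2)
          (volume.prod volume) := hmu.comp_snd
        exact measurable_coneWeight.aemeasurable.mul
          ((ENNReal.continuous_ofReal.comp (by fun_prop : Continuous fun z : ℂ =>
            ‖z‖ ^ 2)).measurable.comp_aemeasurable h1.aemeasurable)
    _ ≤ ∫⁻ p : ℝ × ℝ, ENNReal.ofReal (‖diffQuot u p‖ ^ 2) := by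
        refine lintegral_mono fun p => ?_
        rw [lintegral_mul_const' _ _ ENNReal.ofReal_ne_top]
        rcases eq_or_ne p.1 p.2 with h | h
        · simp [h]
        · refine (mul_le_mul_left (lintegral_coneWeight_le h) _).trans (le_of_eq ?_)
          rw [← ENNReal.ofReal_mul (by positivity), diffQuot, norm_div, Complex.norm_real,
            Real.norm_eq_abs, div_pow, sq_abs]
          congr 1
          ring

/-! ### Estimates for the exponential -/

theorem norm_exp_sub_one_le_mul (w : ℂ) :
    ‖Complex.exp w - 1‖ ≤ ‖w‖ * (1 + ‖Complex.exp w‖) := by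
  have h := Convex.norm_image_sub_le_of_norm_hasDerivWithin_le (f := Complex.exp)
    (f' := Complex.exp) (s := {z : ℂ | z.re ≤ max 0 w.re}) (x := 0) (y := w)
    (C := 1 + ‖Complex.exp w‖) (fun z _ => (Complex.hasDerivAt_exp z).hasDerivWithinAt)
    (fun z hz => by
      have hz : z.re ≤ max 0 w.re := hz
      rw [Complex.norm_exp, Complex.norm_exp]
      rcases le_max_iff.1 hz with h | h
      · linarith [Real.exp_le_one_iff.2 h, Real.exp_pos w.re]
      · linarith [Real.exp_le_exp.2 h])
    (convex_halfSpace_re_le _) (by simp) (by simp)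
  simpa [mul_comm] using h

theorem norm_exp_sub_one_sub_le_mul (w : ℂ) :
    ‖Complex.exp w - 1 - w‖ ≤ ‖w‖ ^ 2 * (1 + ‖Complex.exp w‖) := by
  have h := Convex.norm_image_sub_le_of_norm_hasDerivWithin_le (f := fun z => Complex.exp z - z)
    (f' := fun z => Complex.exp z - 1) (s := {z : ℂ | z.re ≤ max 0 w.re} ∩ Metric.closedBall 0 ‖w‖)
    (x := 0) (y := w) (C := ‖w‖ * (1 + ‖Complex.exp w‖))
    (fun z _ => ((Complex.hasDerivAt_exp z).sub (hasDerivAt_id z)).hasDerivWithinAt)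
    (fun z hz => by
      have hz1 : z.re ≤ max 0 w.re := hz.1
      have hz2 : ‖z‖ ≤ ‖w‖ := by simpa using hz.2
      have h := Convex.norm_image_sub_le_of_norm_hasDerivWithin_le (f := Complex.exp)
        (f' := Complex.exp) (s := {z : ℂ | z.re ≤ max 0 w.re}) (x := 0) (y := z)
        (C := 1 + ‖Complex.exp w‖) (fun z _ => (Complex.hasDerivAt_exp z).hasDerivWithinAt)
        (fun z hz => by
          have hz : z.re ≤ max 0 w.re := hz
          rw [Complex.norm_exp, Complex.norm_exp]
          rcases le_max_iff.1 hz with h | h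
          · linarith [Real.exp_le_one_iff.2 h, Real.exp_pos w.re]
          · linarith [Real.exp_le_exp.2 h])
        (convex_halfSpace_re_le _) (by simp) hz1
      rw [sub_zero, Complex.exp_zero, mul_comm] at h
      exact h.trans (by gcongr))
    ((convex_halfSpace_re_le _).inter (convex_closedBall _ _)) (by simp) (by simp)
  have e : Complex.exp w - w - (Complex.exp 0 - 0) = Complex.exp w - 1 - w := by
    rw [Complex.exp_zero]; ring
  rw [e, sub_zero] at h
  exact h.trans (le_of_eq (by ring))

theorem holderTriple_four_four_two : ENNReal.HolderTriple 4 4 2 := by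
  constructor
  rw [← two_mul, show (4 : ℝ≥0∞) = 2 * 2 by norm_num,
    ENNReal.mul_inv (by norm_num) (by norm_num), ← mul_assoc,
    ENNReal.mul_inv_cancel two_ne_zero ENNReal.ofNat_ne_top, one_mul]

section ProbabilitySpace

variable {X : Type*} [MeasurableSpace X] {m : Measure X}

theorem lintegral_enorm_mul_le {f g : X → ℂ} (hf : AEStronglyMeasurable f m)
    (hg : AEStronglyMeasurable g m) :
    ∫⁻ x, ‖f x * g x‖ₑ ∂m ≤ eLpNorm f 2 m * eLpNorm g 2 m := by
  have := eLpNorm_smul_le_mul_eLpNorm (p := 2) (q := 2) (r := 1) hg hf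
  rwa [eLpNorm_one_eq_lintegral_enorm] at this

theorem lintegral_exp_mul_exp_sub_one_sub_le {w k : X → ℂ} (hw : AEStronglyMeasurable w m)
    (hk : AEStronglyMeasurable k m) {E F : ℝ≥0∞}
    (hE : eLpNorm (fun x => Complex.exp (w x)) 4 m ≤ E)
    (hE' : eLpNorm (fun x => Complex.exp (w x + k x)) 4 m ≤ E)
    (hF : eLpNorm k 4 m ≤ F) :
    ∫⁻ x, ‖Complex.exp (w x) * (Complex.exp (k x) - 1 - k x)‖ₑ ∂m ≤
      eLpNorm k 2 m * (F * (E + E)) := by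
  have := holderTriple_four_four_two
  have hn : ∀ v : X → ℂ, AEStronglyMeasurable v m →
      AEStronglyMeasurable (fun x => (‖Complex.exp (v x)‖ : ℂ)) m := fun v hv =>
    (by fun_prop : Continuous fun z : ℂ => (‖Complex.exp z‖ : ℂ)).comp_aestronglyMeasurable hv
  set g : X → ℂ := fun x => (‖Complex.exp (w x)‖ : ℂ) + (‖Complex.exp (w x + k x)‖ : ℂ) with hg
  have hgm : AEStronglyMeasurable g m := (hn w hw).add (hn _ (hw.add hk))
  have hg4 : eLpNorm g 4 m ≤ E + E := by
    refine (eLpNorm_add_le (hn w hw) (hn _ (hw.add hk)) (by norm_num)).trans (add_le_add ?_ ?_)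
    · exact le_trans (le_of_eq (eLpNorm_congr_norm_ae (.of_forall fun x => by simp))) hE
    · exact le_trans (le_of_eq (eLpNorm_congr_norm_ae (.of_forall fun x => by simp))) hE'
  have hkg : eLpNorm (k • g) 2 m ≤ F * (E + E) :=
    (eLpNorm_smul_le_mul_eLpNorm (p := 4) (q := 4) hgm hk).trans (mul_le_mul' hF hg4)
  refine le_trans (lintegral_mono fun x => ?_) ((lintegral_enorm_mul_le hk (hk.smul hgm)).trans
    (mul_le_mul_right hkg _))
  rw [enorm_le_iff_norm_le]
  have h1 := mul_le_mul_of_nonneg_left (norm_exp_sub_one_sub_le_mul (k x))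
    (norm_nonneg (Complex.exp (w x)))
  rw [norm_mul]
  refine h1.trans (le_of_eq ?_)
  rw [Pi.smul_apply', smul_eq_mul, norm_mul, norm_mul, hg]
  dsimp only
  rw [← Complex.ofReal_add, Complex.norm_real, Real.norm_of_nonneg (by positivity),
    Complex.exp_add, norm_mul]
  ring

variable [IsProbabilityMeasure m]

theorem eLpNorm_one_add_norm_exp_le {w : X → ℂ} (hw : AEStronglyMeasurable w m) {E : ℝ≥0∞}
    (hE : eLpNorm (fun x => Complex.exp (w x)) 4 m ≤ E) :
    eLpNorm (fun x => (1 + ‖Complex.exp (w x)‖ : ℂ)) 2 m ≤ 1 + E := by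
  have hexp : AEStronglyMeasurable (fun x => Complex.exp (w x)) m :=
    Complex.continuous_exp.comp_aestronglyMeasurable hw
  have h2 : AEStronglyMeasurable (fun x => (‖Complex.exp (w x)‖ : ℂ)) m :=
    Complex.continuous_ofReal.comp_aestronglyMeasurable hexp.norm
  refine (eLpNorm_add_le (f := fun _ => (1 : ℂ)) aestronglyMeasurable_const h2
    one_le_two).trans (add_le_add ?_ ?_)
  · rw [eLpNorm_const' _ (by norm_num) (by norm_num)]; simp
  · refine le_trans ?_ hE
    refine le_trans (le_of_eq ?_) (eLpNorm_le_eLpNorm_of_exponent_le (p := 2)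
      (by norm_num) hexp)
    exact eLpNorm_congr_norm_ae (.of_forall fun x => by simp)

theorem lintegral_exp_sub_one_le {w : X → ℂ} (hw : AEStronglyMeasurable w m) {E : ℝ≥0∞}
    (hE : eLpNorm (fun x => Complex.exp (w x)) 4 m ≤ E) :
    ∫⁻ x, ‖Complex.exp (w x) - 1‖ₑ ∂m ≤ eLpNorm w 2 m * (1 + E) := by
  have h2 : AEStronglyMeasurable (fun x => (1 + ‖Complex.exp (w x)‖ : ℂ)) m :=
    (by fun_prop : Continuous fun z : ℂ => (1 + ‖Complex.exp z‖ : ℂ)).comp_aestronglyMeasurable hw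
  refine le_trans (lintegral_mono fun x => ?_) ((lintegral_enorm_mul_le hw h2).trans
    (mul_le_mul_right (eLpNorm_one_add_norm_exp_le hw hE) _))
  rw [enorm_le_iff_norm_le, norm_mul]
  convert norm_exp_sub_one_le_mul (w x) using 2
  rw [← Complex.ofReal_one, ← Complex.ofReal_add, Complex.norm_real, Real.norm_of_nonneg]
  positivity

theorem lintegral_exp_mul_le {w k : X → ℂ} (hw : AEStronglyMeasurable w m)
    (hk : AEStronglyMeasurable k m) {E : ℝ≥0∞}
    (hE : eLpNorm (fun x => Complex.exp (w x)) 4 m ≤ E) :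
    ∫⁻ x, ‖Complex.exp (w x) * k x‖ₑ ∂m ≤ eLpNorm k 2 m * E := by
  have hexp : AEStronglyMeasurable (fun x => Complex.exp (w x)) m :=
    Complex.continuous_exp.comp_aestronglyMeasurable hw
  rw [mul_comm]
  refine (lintegral_enorm_mul_le hexp hk).trans (mul_le_mul_left ?_ _)
  exact (eLpNorm_le_eLpNorm_of_exponent_le (by norm_num) hexp).trans hE

end ProbabilitySpace

/-- The bound on the fourth moments of `exp (u - mean u)` for `‖u‖ ≤ 1`. -/
noncomputable def expBound : ℝ := Real.exp ((2 * Real.pi) ^ 2)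

theorem one_le_expBound : 1 ≤ expBound := Real.one_le_exp (by positivity)

theorem HHalf.eLpNorm_exp_sub_mean_le_expBound {u : HHalf} (hu : ‖u‖ ≤ 1) (x : ℝ) {r : ℝ}
    (hr : 0 < r) :
    eLpNorm (fun t => Complex.exp (u t - mean u x r)) 4 (unifMeasure x r) ≤
      ENNReal.ofReal expBound := by
  refine (u.eLpNorm_exp_sub_mean_le x hr).trans (ENNReal.ofReal_le_ofReal ?_)
  exact Real.exp_le_exp.2 (pow_le_pow_left₀ (by positivity)
    (mul_le_of_le_one_right (by positivity) hu) 2)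

theorem HHalf.aestronglyMeasurable_sub_mean (u : HHalf) (x r : ℝ) :
    AEStronglyMeasurable (fun t => u t - mean u x r) (unifMeasure x r) :=
  (u.locallyIntegrable.aestronglyMeasurable.mono_ac (unifMeasure_ac x r)).sub
    aestronglyMeasurable_const

theorem HHalf.lintegral_exp_sub_one_le {u : HHalf} (hu : ‖u‖ ≤ 1) (x : ℝ) {r : ℝ} (hr : 0 < r) :
    ∫⁻ t, ‖Complex.exp (u t - mean u x r) - 1‖ₑ ∂(unifMeasure x r) ≤
      osc u x r * ENNReal.ofReal (2 * expBound) := by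
  have := isProbabilityMeasure_unifMeasure x hr
  refine (WeilPetersson.lintegral_exp_sub_one_le (u.aestronglyMeasurable_sub_mean x r)
    (HHalf.eLpNorm_exp_sub_mean_le_expBound hu x hr)).trans
    (mul_le_mul' (eLpNorm_sub_mean_le u.locallyIntegrable x hr) ?_)
  rw [← ENNReal.ofReal_one, ← ENNReal.ofReal_add zero_le_one (zero_le_one.trans one_le_expBound)]
  exact ENNReal.ofReal_le_ofReal (by linarith [one_le_expBound])

theorem HHalf.lintegral_exp_mul_le {u : HHalf} (hu : ‖u‖ ≤ 1) (h : HHalf) (x : ℝ) {r : ℝ}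
    (hr : 0 < r) :
    ∫⁻ t, ‖Complex.exp (u t - mean u x r) * (h t - mean h x r)‖ₑ ∂(unifMeasure x r) ≤
      osc h x r * ENNReal.ofReal expBound := by
  have := isProbabilityMeasure_unifMeasure x hr
  exact (WeilPetersson.lintegral_exp_mul_le (u.aestronglyMeasurable_sub_mean x r)
    (h.aestronglyMeasurable_sub_mean x r)
    (HHalf.eLpNorm_exp_sub_mean_le_expBound hu x hr)).trans
    (mul_le_mul_left (eLpNorm_sub_mean_le h.locallyIntegrable x hr) _)

theorem HHalf.mean_add (u h : HHalf) (x : ℝ) {r : ℝ} (hr : 0 < r) :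
    mean (u + h : HHalf) x r = mean u x r + mean h x r :=
  integral_add (integrable_unifMeasure u.locallyIntegrable x hr)
    (integrable_unifMeasure h.locallyIntegrable x hr)

theorem HHalf.add_apply (u h : HHalf) (t : ℝ) : (u + h : HHalf) t = u t + h t := rfl

theorem HHalf.lintegral_exp_mul_exp_sub_one_sub_le {u h : HHalf} (hu : ‖u‖ ≤ 1)
    (huh : ‖u + h‖ ≤ 1) (x : ℝ) {r : ℝ} (hr : 0 < r) :
    ∫⁻ t, ‖Complex.exp (u t - mean u x r) *
        (Complex.exp (h t - mean h x r) - 1 - (h t - mean h x r))‖ₑ ∂(unifMeasure x r) ≤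
      osc h x r * ENNReal.ofReal (16 * Real.pi * expBound * ‖h‖) := by
  have := isProbabilityMeasure_unifMeasure x hr
  have he : (fun t => Complex.exp ((u + h : HHalf) t - mean (u + h : HHalf) x r)) =
      fun t => Complex.exp ((u t - mean u x r) + (h t - mean h x r)) := by
    funext t
    rw [HHalf.mean_add _ _ _ hr, HHalf.add_apply]
    congr 1; ring
  refine (WeilPetersson.lintegral_exp_mul_exp_sub_one_sub_le (u.aestronglyMeasurable_sub_mean x r)
    (h.aestronglyMeasurable_sub_mean x r)
    (HHalf.eLpNorm_exp_sub_mean_le_expBound hu x hr)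
    (he ▸ HHalf.eLpNorm_exp_sub_mean_le_expBound huh x hr)
    (h.eLpNorm_sub_mean_four_le x hr)).trans
    (mul_le_mul' (eLpNorm_sub_mean_le h.locallyIntegrable x hr) (le_of_eq ?_))
  have h1 := one_le_expBound
  rw [← ENNReal.ofReal_add (by linarith) (by linarith), ← ENNReal.ofReal_mul (by positivity)]
  congr 1; ring

/-- Finiteness of the means of `‖f‖` over all intervals `(x - r, x + r]` is local integrability. -/
theorem locallyIntegrable_of_lintegral_unifMeasure {f : ℝ → ℂ}
    (hf : AEStronglyMeasurable f volume)
    (h : ∀ x r, 0 < r → ∫⁻ t, ‖f t‖ₑ ∂(unifMeasure x r) < ⊤) : LocallyIntegrable f volume := by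
  intro x
  refine ⟨Ioc (x - 1) (x + 1), Ioc_mem_nhds (by linarith) (by linarith), hf.restrict, ?_⟩
  have := h x 1 one_pos
  rw [lintegral_unifMeasure] at this
  exact ENNReal.lt_top_of_mul_ne_top_right this.ne (by simp)

theorem HHalf.aestronglyMeasurable_exp (u : HHalf) :
    AEStronglyMeasurable (fun t => Complex.exp (u t)) volume :=
  Complex.continuous_exp.comp_aestronglyMeasurable u.locallyIntegrable.aestronglyMeasurable

theorem HHalf.locallyIntegrable_exp (u : HHalf) :
    LocallyIntegrable (fun t => Complex.exp (u t)) volume := by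
  refine locallyIntegrable_of_lintegral_unifMeasure u.aestronglyMeasurable_exp fun x r hr => ?_
  have := isProbabilityMeasure_unifMeasure x hr
  have e : (fun t => Complex.exp (u t)) =
      Complex.exp (mean u x r) • fun t => Complex.exp (u t - mean u x r) := by
    funext t
    rw [Pi.smul_apply, smul_eq_mul, ← Complex.exp_add, add_sub_cancel]
  rw [← eLpNorm_one_eq_lintegral_enorm, e, eLpNorm_const_smul]
  refine ENNReal.mul_lt_top enorm_lt_top ?_
  refine ((eLpNorm_le_eLpNorm_of_exponent_le (q := 4) (by norm_num) ?_).trans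
    (u.eLpNorm_exp_sub_mean_le x hr)).trans_lt ENNReal.ofReal_lt_top
  exact Complex.continuous_exp.comp_aestronglyMeasurable (u.aestronglyMeasurable_sub_mean x r)

theorem HHalf.locallyIntegrable_exp_mul (u h : HHalf) :
    LocallyIntegrable (fun t => Complex.exp (u t) * h t) volume := by
  refine locallyIntegrable_of_lintegral_unifMeasure
    (u.aestronglyMeasurable_exp.mul h.locallyIntegrable.aestronglyMeasurable) fun x r hr => ?_
  have := isProbabilityMeasure_unifMeasure x hr
  have e : (fun t => Complex.exp (u t) * h t) =
      fun t => Complex.exp (mean u x r) * (Complex.exp (u t - mean u x r) * (h t - mean h x r)) +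
        mean h x r * Complex.exp (u t) := by
    funext t
    have e1 : Complex.exp (u t) = Complex.exp (mean u x r) * Complex.exp (u t - mean u x r) := by
      rw [← Complex.exp_add, add_sub_cancel]
    rw [← mul_assoc, ← e1]
    ring
  have hI := lt_of_le_of_lt (WeilPetersson.lintegral_exp_mul_le
    (u.aestronglyMeasurable_sub_mean x r) (h.aestronglyMeasurable_sub_mean x r)
    (u.eLpNorm_exp_sub_mean_le x hr)) (ENNReal.mul_lt_top
      ((eLpNorm_sub_mean_le h.locallyIntegrable x hr).trans_lt
        ((h.osc_le x hr).trans_lt ENNReal.ofReal_lt_top)) ENNReal.ofReal_lt_top)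
  have i1 : Integrable (fun t => Complex.exp (u t - mean u x r) * (h t - mean h x r))
      (unifMeasure x r) :=
    ⟨(Complex.continuous_exp.comp_aestronglyMeasurable
      (u.aestronglyMeasurable_sub_mean x r)).mul (h.aestronglyMeasurable_sub_mean x r), hI⟩
  have i2 := (i1.const_mul (Complex.exp (mean u x r))).add
    ((integrable_unifMeasure u.locallyIntegrable_exp x hr).const_mul (mean h x r))
  exact (e ▸ i2 : Integrable (fun t => Complex.exp (u t) * h t) (unifMeasure x r)).2

/-! ### Smoothing by dilated kernels and the Beltrami quotient -/

/-- `(K_y * f)(x)` for a complex kernel `K`, where `K_y(s) = y⁻¹ K(y⁻¹ s)`. -/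
noncomputable def kerConv (K : ℝ → ℂ) (f : ℝ → ℂ) (x y : ℝ) : ℂ :=
  ∫ t : ℝ, ((y⁻¹ : ℝ) : ℂ) * K (y⁻¹ * (x - t)) * f t

/-- Continuous kernels supported in `[-1, 1]` and bounded by `M`. -/
structure IsKernel (K : ℝ → ℂ) (M : ℝ) : Prop where
  continuous : Continuous K
  support_subset : Function.support K ⊆ Icc (-1) 1
  norm_le : ∀ s, ‖K s‖ ≤ M


theorem IsKernel.nonneg {K : ℝ → ℂ} {M : ℝ} (hK : IsKernel K M) : 0 ≤ M :=
  (norm_nonneg _).trans (hK.norm_le 0)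

theorem IsKernel.eq_zero {K : ℝ → ℂ} {M : ℝ} (hK : IsKernel K M) {x y t : ℝ} (hy : 0 < y)
    (ht : t ∉ Icc (x - y) (x + y)) : K (y⁻¹ * (x - t)) = 0 := by
  by_contra h
  have h1 := hK.support_subset h
  rw [mem_Icc, inv_mul_eq_div, le_div_iff₀ hy, div_le_iff₀ hy] at h1
  exact ht ⟨by linarith [h1.2], by linarith [h1.1]⟩

theorem IsKernel.integrable {K : ℝ → ℂ} {M : ℝ} (hK : IsKernel K M) {f : ℝ → ℂ}
    (hf : LocallyIntegrable f volume) (x : ℝ) {y : ℝ} (hy : 0 < y) :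
    Integrable (fun t => ((y⁻¹ : ℝ) : ℂ) * K (y⁻¹ * (x - t)) * f t) volume := by
  have hc := hK.continuous
  refine hf.integrable_smul_left_of_hasCompactSupport
    (g := fun t => ((y⁻¹ : ℝ) : ℂ) * K (y⁻¹ * (x - t))) (by fun_prop)
    (HasCompactSupport.of_support_subset_isCompact (isCompact_Icc (a := x - y) (b := x + y)) ?_)
  intro t ht
  by_contra h
  exact ht (by dsimp only; rw [hK.eq_zero hy h, mul_zero])

theorem kerConv_add {K : ℝ → ℂ} {M : ℝ} (hK : IsKernel K M) {f g : ℝ → ℂ}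
    (hf : LocallyIntegrable f volume) (hg : LocallyIntegrable g volume) (x : ℝ) {y : ℝ}
    (hy : 0 < y) :
    kerConv K (fun t => f t + g t) x y = kerConv K f x y + kerConv K g x y := by
  simp only [kerConv, mul_add]
  exact integral_add (hK.integrable hf x hy) (hK.integrable hg x hy)

theorem locallyIntegrable_const_mul {f : ℝ → ℂ} (hf : LocallyIntegrable f volume) (c : ℂ) :
    LocallyIntegrable (fun t => c * f t) volume := hf.smul c

theorem locallyIntegrable_fun_sub {f g : ℝ → ℂ} (hf : LocallyIntegrable f volume)
    (hg : LocallyIntegrable g volume) : LocallyIntegrable (fun t => f t - g t) volume := hf.sub hg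

theorem kerConv_const_mul (K : ℝ → ℂ) (c : ℂ) (f : ℝ → ℂ) (x y : ℝ) :
    kerConv K (fun t => c * f t) x y = c * kerConv K f x y := by
  rw [kerConv, kerConv, ← integral_const_mul]
  congr 1; funext t; ring

theorem kerConv_sub {K : ℝ → ℂ} {M : ℝ} (hK : IsKernel K M) {f g : ℝ → ℂ}
    (hf : LocallyIntegrable f volume) (hg : LocallyIntegrable g volume) (x : ℝ) {y : ℝ}
    (hy : 0 < y) :
    kerConv K (fun t => f t - g t) x y = kerConv K f x y - kerConv K g x y := by
  rw [kerConv, kerConv, kerConv, ← integral_sub (hK.integrable hf x hy) (hK.integrable hg x hy)]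
  congr 1; funext t; ring

theorem kerConv_one (K : ℝ → ℂ) (x : ℝ) {y : ℝ} (hy : 0 < y) :
    kerConv K (fun _ => 1) x y = ∫ s, K s := by
  simp only [kerConv, mul_one]
  rw [integral_const_mul, integral_sub_left_eq_self (fun t => K (y⁻¹ * t)),
    Measure.integral_comp_mul_left, inv_inv, abs_of_pos hy, Complex.real_smul, ← mul_assoc,
    ← Complex.ofReal_mul, inv_mul_cancel₀ hy.ne', Complex.ofReal_one, one_mul]

theorem enorm_kerConv_le {K : ℝ → ℂ} {M : ℝ} (hK : IsKernel K M) (f : ℝ → ℂ) (x : ℝ) {y : ℝ}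
    (hy : 0 < y) :
    ‖kerConv K f x y‖ₑ ≤ ENNReal.ofReal (2 * M) * ∫⁻ t, ‖f t‖ₑ ∂(unifMeasure x y) := by
  have hM := hK.nonneg
  rw [lintegral_unifMeasure, ← mul_assoc, ← ENNReal.ofReal_inv_of_pos (by positivity),
    ← ENNReal.ofReal_mul (by positivity), setLIntegral_congr Ioc_ae_eq_Icc,
    ← lintegral_const_mul' _ _ ENNReal.ofReal_ne_top, ← lintegral_indicator measurableSet_Icc]
  refine (enorm_integral_le_lintegral_enorm _).trans (lintegral_mono fun t => ?_)
  by_cases ht : t ∈ Icc (x - y) (x + y)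
  · rw [indicator_of_mem ht, enorm_mul]
    refine mul_le_mul_left ?_ _
    rw [← ofReal_norm]
    refine ENNReal.ofReal_le_ofReal ?_
    rw [norm_mul, Complex.norm_real, Real.norm_of_nonneg (by positivity)]
    calc y⁻¹ * ‖K (y⁻¹ * (x - t))‖ ≤ y⁻¹ * M := by gcongr; exact hK.norm_le _
      _ = 2 * M * (2 * y)⁻¹ := by field_simp
  · rw [indicator_of_notMem ht, hK.eq_zero hy ht]
    simp

/-- The mean oscillation as a real number. -/
noncomputable def HHalf.oscR (u : HHalf) (x y : ℝ) : ℝ := (osc u x y).toReal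

theorem HHalf.oscR_nonneg (u : HHalf) (x y : ℝ) : 0 ≤ u.oscR x y := ENNReal.toReal_nonneg

theorem HHalf.oscR_le (u : HHalf) (x : ℝ) {y : ℝ} (hy : 0 < y) :
    u.oscR x y ≤ 2 * Real.pi * ‖u‖ :=
  ENNReal.toReal_le_of_le_ofReal (by positivity) (u.osc_le x hy)

theorem norm_kerConv_le_of_lintegral_le {K : ℝ → ℂ} {M : ℝ} (hK : IsKernel K M) {f : ℝ → ℂ}
    {h : HHalf} {x y c : ℝ} (hy : 0 < y) (hc : 0 ≤ c)
    (hf : ∫⁻ t, ‖f t‖ₑ ∂(unifMeasure x y) ≤ osc h x y * ENNReal.ofReal c) :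
    ‖kerConv K f x y‖ ≤ 2 * M * c * h.oscR x y := by
  have hM := hK.nonneg
  have hfin : osc h x y ≠ ⊤ := ((h.osc_le x hy).trans_lt ENNReal.ofReal_lt_top).ne
  have h1 : ‖kerConv K f x y‖ₑ ≤ ENNReal.ofReal (2 * M * c * h.oscR x y) := by
    refine (enorm_kerConv_le hK f x hy).trans ((mul_le_mul_right hf _).trans (le_of_eq ?_))
    rw [ENNReal.ofReal_mul (p := 2 * M * c) (by positivity),
      ENNReal.ofReal_mul (p := 2 * M) (by positivity), HHalf.oscR,
      ENNReal.ofReal_toReal hfin]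
    ring
  rwa [← ofReal_norm, ENNReal.ofReal_le_ofReal_iff
    (mul_nonneg (by positivity) (h.oscR_nonneg x y))] at h1

theorem HHalf.exp_eq (u : HHalf) (x y t : ℝ) : Complex.exp (u t) =
    Complex.exp (mean u x y) * Complex.exp (u t - mean u x y) := by
  rw [← Complex.exp_add, add_sub_cancel]

theorem HHalf.locallyIntegrable_exp_sub (u : HHalf) (c : ℂ) :
    LocallyIntegrable (fun t => Complex.exp (u t - c)) volume := by
  have e : (fun t => Complex.exp (u t - c)) = Complex.exp (-c) • fun t => Complex.exp (u t) := by
    funext t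
    rw [Pi.smul_apply, smul_eq_mul, ← Complex.exp_add]
    congr 1; ring
  rw [e]
  exact u.locallyIntegrable_exp.smul _

/-- Up to the factor `exp (mean u)`, smoothing `exp u` differs from the total mass of the kernel
by at most a multiple of the mean oscillation. -/
theorem norm_kerConv_exp_sub_le {K : ℝ → ℂ} {M : ℝ} (hK : IsKernel K M) {u : HHalf}
    (hu : ‖u‖ ≤ 1) (x : ℝ) {y : ℝ} (hy : 0 < y) :
    ‖Complex.exp (-mean u x y) * kerConv K (fun t => Complex.exp (u t)) x y - ∫ s, K s‖ ≤
      4 * M * expBound * u.oscR x y := by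
  have h := norm_kerConv_le_of_lintegral_le hK hy (by linarith [one_le_expBound])
    (HHalf.lintegral_exp_sub_one_le hu x hy)
  rw [kerConv_sub hK (u.locallyIntegrable_exp_sub _) (locallyIntegrable_const 1) x hy,
    kerConv_one K x hy] at h
  rw [← kerConv_const_mul]
  have e : (fun t => Complex.exp (-mean u x y) * Complex.exp (u t)) =
      fun t => Complex.exp (u t - mean u x y) := by
    funext t
    rw [← Complex.exp_add]; congr 1; ring
  rw [e]
  exact h.trans (le_of_eq (by ring))

/-- The derivative of `u ↦ (K_y * exp u)(x)` in the direction `h - mean h`, normalised by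
`exp (-mean u)`, is bounded by a multiple of the mean oscillation of `h`. -/
theorem norm_kerConv_exp_mul_le {K : ℝ → ℂ} {M : ℝ} (hK : IsKernel K M) {u : HHalf}
    (hu : ‖u‖ ≤ 1) (h : HHalf) (x : ℝ) {y : ℝ} (hy : 0 < y) :
    ‖Complex.exp (-mean u x y) * (kerConv K (fun t => Complex.exp (u t) * h t) x y -
      mean h x y * kerConv K (fun t => Complex.exp (u t)) x y)‖ ≤
      2 * M * expBound * h.oscR x y := by
  have h1 := norm_kerConv_le_of_lintegral_le hK hy (by linarith [one_le_expBound])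
    (HHalf.lintegral_exp_mul_le hu h x hy)
  rw [← kerConv_const_mul, ← kerConv_sub hK (u.locallyIntegrable_exp_mul h)
    (locallyIntegrable_const_mul u.locallyIntegrable_exp (mean h x y)) x hy, ← kerConv_const_mul]
  convert h1 using 3
  funext t
  have e1 : Complex.exp (u t - mean u x y) = Complex.exp (-mean u x y) * Complex.exp (u t) := by
    rw [← Complex.exp_add]; congr 1; ring
  rw [e1]
  ring

theorem norm_kerConv_exp_remainder_le {K : ℝ → ℂ} {M : ℝ} (hK : IsKernel K M) {u h : HHalf}
    (hu : ‖u‖ ≤ 1) (huh : ‖u + h‖ ≤ 1) (x : ℝ) {y : ℝ} (hy : 0 < y) :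
    ‖Complex.exp (-mean u x y) *
      (Complex.exp (-mean h x y) * kerConv K (fun t => Complex.exp ((u + h : HHalf) t)) x y -
        kerConv K (fun t => Complex.exp (u t)) x y -
        (kerConv K (fun t => Complex.exp (u t) * h t) x y -
          mean h x y * kerConv K (fun t => Complex.exp (u t)) x y))‖ ≤
      32 * Real.pi * M * expBound * ‖h‖ * h.oscR x y := by
  have h1 := norm_kerConv_le_of_lintegral_le hK hy (by have := one_le_expBound; positivity)
    (HHalf.lintegral_exp_mul_exp_sub_one_sub_le hu huh x hy)
  rw [← kerConv_const_mul K (mean h x y), ← kerConv_sub hK (u.locallyIntegrable_exp_mul h)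
    (locallyIntegrable_const_mul u.locallyIntegrable_exp (mean h x y)) x hy, ← kerConv_const_mul,
    ← kerConv_sub hK (locallyIntegrable_const_mul (u + h).locallyIntegrable_exp
      (Complex.exp (-mean h x y))) u.locallyIntegrable_exp x hy,
    ← kerConv_sub hK (locallyIntegrable_fun_sub (locallyIntegrable_const_mul
      (u + h).locallyIntegrable_exp (Complex.exp (-mean h x y))) u.locallyIntegrable_exp)
      (locallyIntegrable_fun_sub (u.locallyIntegrable_exp_mul h)
      (locallyIntegrable_const_mul u.locallyIntegrable_exp (mean h x y))) x hy, ← kerConv_const_mul]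
  refine le_trans (le_of_eq ?_) (h1.trans (le_of_eq (by ring)))
  congr 2
  funext t
  rw [HHalf.add_apply]
  have e1 : Complex.exp (u t - mean u x y) = Complex.exp (-mean u x y) * Complex.exp (u t) := by
    rw [← Complex.exp_add]; congr 1; ring
  have e2 : Complex.exp (h t - mean h x y) = Complex.exp (-mean h x y) * Complex.exp (h t) := by
    rw [← Complex.exp_add]; congr 1; ring
  rw [e1, e2, Complex.exp_add]
  ring

/-- The second order remainder of a quotient. -/
theorem norm_div_sub_div_sub_le {n₀ d₀ n₁ d₁ n d : ℂ} {A B : ℝ} (hn₀ : ‖n₀‖ ≤ 1)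
    (hd₀ : 1 ≤ ‖d₀‖) (hd : 1 ≤ ‖d‖) (hn₁ : ‖n₁‖ ≤ A) (hd₁ : ‖d₁‖ ≤ A)
    (hn : ‖n - n₀ - n₁‖ ≤ B) (hd' : ‖d - d₀ - d₁‖ ≤ B) :
    ‖n / d - n₀ / d₀ - (n₁ * d₀ - n₀ * d₁) / d₀ ^ 2‖ ≤ 2 * B + 2 * A * (A + B) := by
  have hA : 0 ≤ A := (norm_nonneg _).trans hn₁
  have hB : 0 ≤ B := (norm_nonneg _).trans hn
  have z₀ : d₀ ≠ 0 := norm_pos_iff.1 (by linarith)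
  have z : d ≠ 0 := norm_pos_iff.1 (by linarith)
  have e : n / d - n₀ / d₀ - (n₁ * d₀ - n₀ * d₁) / d₀ ^ 2 =
      (n - n₀ - n₁) / d - n₀ * (d - d₀ - d₁) / (d * d₀) -
        (n₁ / d - n₀ * d₁ / (d * d₀)) * ((d - d₀) / d₀) := by
    field_simp
    ring
  have hdd : ‖d - d₀‖ ≤ A + B := by
    calc ‖d - d₀‖ = ‖d₁ + (d - d₀ - d₁)‖ := by congr 1; ring
      _ ≤ A + B := (norm_add_le _ _).trans (add_le_add hd₁ hd')
  have hdiv : ∀ {w v : ℂ} {c : ℝ}, ‖w‖ ≤ c → 1 ≤ ‖v‖ → ‖w / v‖ ≤ c := fun {w v c} hw hv => by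
    rw [norm_div]; exact (div_le_self (norm_nonneg _) hv).trans hw
  have hprod : 1 ≤ ‖d * d₀‖ := by rw [norm_mul]; exact one_le_mul_of_one_le_of_one_le hd hd₀
  have hmul : ∀ {w : ℂ} {c : ℝ}, ‖w‖ ≤ c → ‖n₀ * w‖ ≤ c := fun {w c} hw => by
    rw [norm_mul]; exact (mul_le_of_le_one_left (norm_nonneg _) hn₀).trans hw
  have t1 := hdiv hn hd
  have t2 := hdiv (hmul hd') hprod
  have t3 : ‖n₁ / d - n₀ * d₁ / (d * d₀)‖ ≤ A + A :=
    (norm_sub_le _ _).trans (add_le_add (hdiv hn₁ hd) (hdiv (hmul hd₁) hprod))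
  have t4 := hdiv hdd hd₀
  have t5 : ‖(n₁ / d - n₀ * d₁ / (d * d₀)) * ((d - d₀) / d₀)‖ ≤ (A + A) * (A + B) := by
    rw [norm_mul]; gcongr
  rw [e]
  refine (norm_sub_le _ _).trans ?_
  have := norm_sub_le ((n - n₀ - n₁) / d) (n₀ * (d - d₀ - d₁) / (d * d₀))
  linarith

/-- The quotient `(b_y * exp u) / (a_y * exp u)` at `z = x + i y`. -/
noncomputable def beltramiFun (a b : ℝ → ℂ) (u : HHalf) (z : ℂ) : ℂ :=
  kerConv b (fun t => Complex.exp (u t)) z.re z.im /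
    kerConv a (fun t => Complex.exp (u t)) z.re z.im

/-- The derivative of `beltramiFun a b` at `u` in the direction `h`. -/
noncomputable def beltramiDeriv (a b : ℝ → ℂ) (u h : HHalf) (z : ℂ) : ℂ :=
  (kerConv b (fun t => Complex.exp (u t) * h t) z.re z.im *
      kerConv a (fun t => Complex.exp (u t)) z.re z.im -
    kerConv b (fun t => Complex.exp (u t)) z.re z.im *
      kerConv a (fun t => Complex.exp (u t) * h t) z.re z.im) /
    kerConv a (fun t => Complex.exp (u t)) z.re z.im ^ 2

/-- A radius within which `exp u` is, on every interval, close enough to a constant. -/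
noncomputable def smallRadius (M : ℝ) : ℝ := 1 / (1 + 8 * Real.pi * M * expBound)

section Estimates

variable {a b : ℝ → ℂ} {M : ℝ}

theorem smallRadius_pos (hM : 0 ≤ M) : 0 < smallRadius M := by
  have := one_le_expBound
  unfold smallRadius
  positivity

theorem norm_le_one_of_lt_smallRadius (hM : 0 ≤ M) {u : HHalf} (hu : ‖u‖ < smallRadius M) :
    ‖u‖ ≤ 1 := by
  have := one_le_expBound
  refine hu.le.trans (div_le_one_of_le₀ ?_ (by positivity))
  have : 0 ≤ 8 * Real.pi * M * expBound := by positivity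
  linarith

theorem mul_oscR_le_one (hM : 0 ≤ M) {u : HHalf} (hu : ‖u‖ < smallRadius M) (x : ℝ) {y : ℝ}
    (hy : 0 < y) : 4 * M * expBound * u.oscR x y ≤ 1 := by
  have hE := one_le_expBound
  have h1 : u.oscR x y ≤ 2 * Real.pi * smallRadius M :=
    (u.oscR_le x hy).trans (by gcongr)
  calc 4 * M * expBound * u.oscR x y ≤ 4 * M * expBound * (2 * Real.pi * smallRadius M) := by
        gcongr
    _ = (8 * Real.pi * M * expBound) / (1 + 8 * Real.pi * M * expBound) := by
        unfold smallRadius; ring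
    _ ≤ 1 := div_le_one_of_le₀ (by linarith) (by positivity)

theorem norm_numerator_le (hb : IsKernel b M) (hb0 : ∫ s, b s = 0) {u : HHalf}
    (hu : ‖u‖ < smallRadius M) (x : ℝ) {y : ℝ} (hy : 0 < y) :
    ‖Complex.exp (-mean u x y) * kerConv b (fun t => Complex.exp (u t)) x y‖ ≤
      4 * M * expBound * u.oscR x y := by
  have h := norm_kerConv_exp_sub_le hb (norm_le_one_of_lt_smallRadius hb.nonneg hu) x hy
  rwa [hb0, sub_zero] at h

theorem one_le_norm_denominator (ha : IsKernel a M) (ha2 : ∫ s, a s = 2) {u : HHalf}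
    (hu : ‖u‖ < smallRadius M) (x : ℝ) {y : ℝ} (hy : 0 < y) :
    1 ≤ ‖Complex.exp (-mean u x y) * kerConv a (fun t => Complex.exp (u t)) x y‖ := by
  have h := norm_kerConv_exp_sub_le ha (norm_le_one_of_lt_smallRadius ha.nonneg hu) x hy
  rw [ha2] at h
  have h1 := mul_oscR_le_one ha.nonneg hu x hy
  have h2 := norm_sub_norm_le (2 : ℂ)
    (Complex.exp (-mean u x y) * kerConv a (fun t => Complex.exp (u t)) x y)
  rw [norm_sub_rev, Complex.norm_ofNat] at h2
  linarith

theorem denominator_ne_zero (ha : IsKernel a M) (ha2 : ∫ s, a s = 2) {u : HHalf}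
    (hu : ‖u‖ < smallRadius M) (x : ℝ) {y : ℝ} (hy : 0 < y) :
    kerConv a (fun t => Complex.exp (u t)) x y ≠ 0 := by
  intro h0
  have := one_le_norm_denominator ha ha2 hu x hy
  rw [h0, mul_zero, norm_zero] at this
  linarith

theorem norm_beltramiFun_le (ha : IsKernel a M) (ha2 : ∫ s, a s = 2) (hb : IsKernel b M)
    (hb0 : ∫ s, b s = 0) {u : HHalf} (hu : ‖u‖ < smallRadius M) {z : ℂ} (hz : 0 < z.im) :
    ‖beltramiFun a b u z‖ ≤ 4 * M * expBound * u.oscR z.re z.im := by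
  have h1 := norm_numerator_le hb hb0 hu z.re hz
  have h2 := one_le_norm_denominator ha ha2 hu z.re hz
  rw [beltramiFun, ← mul_div_mul_left _ _ (Complex.exp_ne_zero (-mean u z.re z.im)), norm_div]
  exact (div_le_self (norm_nonneg _) h2).trans h1

/-- The derivative is unchanged when the exponentials are multiplied by `c` and a constant `κ` is
subtracted from `h`; with `c = exp (-mean u)` and `κ = mean h` every factor becomes bounded. -/
theorem beltramiDeriv_eq (a b : ℝ → ℂ) (u h : HHalf) (z : ℂ) (c κ : ℂ) (hc : c ≠ 0) :
    beltramiDeriv a b u h z =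
    ((c * (kerConv b (fun t => Complex.exp (u t) * h t) z.re z.im -
        κ * kerConv b (fun t => Complex.exp (u t)) z.re z.im)) *
      (c * kerConv a (fun t => Complex.exp (u t)) z.re z.im) -
    (c * kerConv b (fun t => Complex.exp (u t)) z.re z.im) *
      (c * (kerConv a (fun t => Complex.exp (u t) * h t) z.re z.im -
        κ * kerConv a (fun t => Complex.exp (u t)) z.re z.im))) /
    (c * kerConv a (fun t => Complex.exp (u t)) z.re z.im) ^ 2 := by
  rw [beltramiDeriv, mul_pow, ← mul_div_mul_left _ _ (pow_ne_zero 2 hc)]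
  congr 1
  ring

theorem norm_beltramiDeriv_le (ha : IsKernel a M) (ha2 : ∫ s, a s = 2) (hb : IsKernel b M)
    (hb0 : ∫ s, b s = 0) {u : HHalf} (hu : ‖u‖ < smallRadius M) (h : HHalf) {z : ℂ}
    (hz : 0 < z.im) :
    ‖beltramiDeriv a b u h z‖ ≤ 4 * M * expBound * h.oscR z.re z.im := by
  have hu1 := norm_le_one_of_lt_smallRadius ha.nonneg hu
  have h1 := (norm_numerator_le hb hb0 hu z.re hz).trans (mul_oscR_le_one ha.nonneg hu z.re hz)
  have h2 := one_le_norm_denominator ha ha2 hu z.re hz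
  have h3 := norm_kerConv_exp_mul_le ha hu1 h z.re hz
  have h4 := norm_kerConv_exp_mul_le hb hu1 h z.re hz
  rw [beltramiDeriv_eq a b u h z _ (mean h z.re z.im) (Complex.exp_ne_zero (-mean u z.re z.im))]
  generalize Complex.exp (-mean u z.re z.im) * kerConv b (fun t => Complex.exp (u t)) z.re z.im = n₀
    at *
  generalize Complex.exp (-mean u z.re z.im) * kerConv a (fun t => Complex.exp (u t)) z.re z.im = d₀
    at *
  generalize Complex.exp (-mean u z.re z.im) * (_ - _) = n₁ at h4 ⊢
  generalize Complex.exp (-mean u z.re z.im) * (_ - _) = d₁ at h3 ⊢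
  have hd : d₀ ≠ 0 := norm_pos_iff.1 (by linarith)
  have e : (n₁ * d₀ - n₀ * d₁) / d₀ ^ 2 = n₁ / d₀ - n₀ * d₁ / d₀ / d₀ := by
    field_simp
  rw [e]
  refine (norm_sub_le _ _).trans ?_
  rw [norm_div, norm_div, norm_div, norm_mul]
  have t1 : ‖n₁‖ / ‖d₀‖ ≤ ‖n₁‖ := div_le_self (norm_nonneg _) h2
  have t2 : ‖n₀‖ * ‖d₁‖ / ‖d₀‖ / ‖d₀‖ ≤ ‖d₁‖ :=
    (div_le_self (by positivity) h2).trans ((div_le_self (by positivity) h2).trans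
      (mul_le_of_le_one_left (norm_nonneg _) h1))
  linarith

/-- The remainder is quadratic in `h`, but one factor is the mean oscillation of `h` rather than its
norm, so that the bound can be integrated against the hyperbolic area. -/
theorem norm_beltramiFun_remainder_le (ha : IsKernel a M) (ha2 : ∫ s, a s = 2)
    (hb : IsKernel b M) (hb0 : ∫ s, b s = 0) {u h : HHalf} (hu : ‖u‖ < smallRadius M)
    (huh : ‖u + h‖ < smallRadius M) {z : ℂ} (hz : 0 < z.im) :
    ‖beltramiFun a b (u + h) z - beltramiFun a b u z - beltramiDeriv a b u h z‖ ≤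
      (2 * (32 * Real.pi * M * expBound) + 2 * (2 * M * expBound) *
        (2 * M * expBound * (2 * Real.pi) + 32 * Real.pi * M * expBound * (4 * Real.pi))) * ‖h‖ *
        h.oscR z.re z.im := by
  have hM := ha.nonneg
  have hE := one_le_expBound
  have hpi := Real.pi_pos
  have hu1 := norm_le_one_of_lt_smallRadius ha.nonneg hu
  have huh1 := norm_le_one_of_lt_smallRadius ha.nonneg huh
  have h1 := (norm_numerator_le hb hb0 hu z.re hz).trans (mul_oscR_le_one ha.nonneg hu z.re hz)
  have h2 := one_le_norm_denominator ha ha2 hu z.re hz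
  have h2' := one_le_norm_denominator ha ha2 huh z.re hz
  have h3 := norm_kerConv_exp_mul_le ha hu1 h z.re hz
  have h4 := norm_kerConv_exp_mul_le hb hu1 h z.re hz
  have h5 := norm_kerConv_exp_remainder_le ha hu1 huh1 z.re hz
  have h6 := norm_kerConv_exp_remainder_le hb hu1 huh1 z.re hz
  have hs := h.oscR_le z.re hz
  have hs0 := h.oscR_nonneg z.re z.im
  have hh2 : ‖h‖ ≤ 2 := by
    have : h = (u + h) - u := by abel
    rw [this]
    exact (norm_sub_le _ _).trans (by linarith)
  have hfun : beltramiFun a b (u + h) z =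
      (Complex.exp (-mean u z.re z.im) * (Complex.exp (-mean h z.re z.im) *
        kerConv b (fun t => Complex.exp ((u + h : HHalf) t)) z.re z.im)) /
      (Complex.exp (-mean u z.re z.im) * (Complex.exp (-mean h z.re z.im) *
        kerConv a (fun t => Complex.exp ((u + h : HHalf) t)) z.re z.im)) := by
    rw [mul_div_mul_left _ _ (Complex.exp_ne_zero _), mul_div_mul_left _ _ (Complex.exp_ne_zero _)]
    rfl
  rw [HHalf.mean_add u h z.re hz, neg_add, Complex.exp_add, mul_assoc] at h2'
  rw [mul_sub, mul_sub] at h5 h6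
  rw [hfun, beltramiDeriv_eq a b u h z _ (mean h z.re z.im)
      (Complex.exp_ne_zero (-mean u z.re z.im)), beltramiFun,
    ← mul_div_mul_left (kerConv b (fun t => Complex.exp (u t)) z.re z.im) _
      (Complex.exp_ne_zero (-mean u z.re z.im))]
  refine (norm_div_sub_div_sub_le h1 h2 h2' h4 h3 h6 h5).trans ?_
  set s := h.oscR z.re z.im
  have t1 : 2 * M * expBound * s + 32 * Real.pi * M * expBound * ‖h‖ * s ≤
      (2 * M * expBound * (2 * Real.pi) + 32 * Real.pi * M * expBound * (4 * Real.pi)) * ‖h‖ := by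
    have e1 : 2 * M * expBound * s ≤ 2 * M * expBound * (2 * Real.pi * ‖h‖) := by gcongr
    have e2 : 32 * Real.pi * M * expBound * ‖h‖ * s ≤
        32 * Real.pi * M * expBound * ‖h‖ * (4 * Real.pi) := by
      gcongr
      nlinarith
    linarith
  have t2 := mul_le_mul_of_nonneg_left t1 (by positivity : 0 ≤ 2 * (2 * M * expBound * s))
  linarith

end Estimates

/-! ### The Beltrami quotient as an element of `𝓛(𝕌)` -/

theorem aestronglyMeasurable_kerConv {K : ℝ → ℂ} (hK : Continuous K) {f : ℝ → ℂ}
    (hf : AEStronglyMeasurable f volume) (m : Measure ℂ) :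
    AEStronglyMeasurable (fun z : ℂ => kerConv K f z.re z.im) m := by
  have h1 : Measurable fun p : ℂ × ℝ =>
      ((p.1.im⁻¹ : ℝ) : ℂ) * K (p.1.im⁻¹ * (p.1.re - p.2)) := by
    have := hK.measurable
    fun_prop
  exact AEStronglyMeasurable.integral_prod_right' (μ := m) (ν := volume)
    (h1.aestronglyMeasurable.mul (hf.comp_snd (μ := m)))

theorem aestronglyMeasurable_beltramiFun {a b : ℝ → ℂ} (ha : Continuous a) (hb : Continuous b)
    (u : HHalf) (m : Measure ℂ) : AEStronglyMeasurable (beltramiFun a b u) m :=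
  ((aestronglyMeasurable_kerConv hb u.aestronglyMeasurable_exp m).aemeasurable.div
    (aestronglyMeasurable_kerConv ha
      u.aestronglyMeasurable_exp m).aemeasurable).aestronglyMeasurable

theorem aestronglyMeasurable_beltramiDeriv {a b : ℝ → ℂ} (ha : Continuous a) (hb : Continuous b)
    (u h : HHalf) (m : Measure ℂ) : AEStronglyMeasurable (beltramiDeriv a b u h) m := by
  have e := u.aestronglyMeasurable_exp
  have eh := u.aestronglyMeasurable_exp.mul h.locallyIntegrable.aestronglyMeasurable
  exact ((((aestronglyMeasurable_kerConv hb eh m).mul (aestronglyMeasurable_kerConv ha e m)).sub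
    ((aestronglyMeasurable_kerConv hb e m).mul
      (aestronglyMeasurable_kerConv ha eh m))).aemeasurable.div
    ((aestronglyMeasurable_kerConv ha e m).aemeasurable.pow_const 2)).aestronglyMeasurable

theorem ae_upperHalf {P : ℂ → Prop} (h : ∀ z : ℂ, 0 < z.im → P z) :
    ∀ᵐ z ∂(volume.restrict upperHalf), P z :=
  ae_restrict_of_forall_mem (measurableSet_lt measurable_const Complex.measurable_im) h

theorem WPSpace.ext_ae {μ ν : WPSpace} (h : μ.toLp =ᵐ[volume.restrict upperHalf] ν.toLp) :
    μ = ν := Subtype.ext (Lp.ext h)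

theorem hypEnergy_le_of_osc {F : ℂ → ℂ} {h : HHalf} {c : ℝ}
    (hF : ∀ᵐ z ∂(volume.restrict upperHalf), ‖F z‖ ≤ c * h.oscR z.re z.im) :
    hypEnergy F ≤ ENNReal.ofReal ((c * (2 * Real.pi * ‖h‖)) ^ 2) := by
  have h1 := lintegral_osc_sq_le h.locallyIntegrable
  rw [HHalf.eLpNorm_diffQuot, ← ENNReal.ofReal_pow (by positivity)] at h1
  rw [mul_pow, ENNReal.ofReal_mul (by positivity)]
  refine le_trans ?_ (mul_le_mul_right h1 _)
  rw [← lintegral_const_mul' _ _ ENNReal.ofReal_ne_top]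
  refine lintegral_mono_ae ?_
  filter_upwards [hF, ae_upperHalf fun z hz => hz] with z hz hy
  have hfin : osc h z.re z.im ≠ ⊤ := ((h.osc_le z.re hy).trans_lt ENNReal.ofReal_lt_top).ne
  rw [← ENNReal.ofReal_toReal hfin, ← ENNReal.ofReal_pow ENNReal.toReal_nonneg, ← mul_assoc,
    ← ENNReal.ofReal_mul (by positivity), ← ENNReal.ofReal_mul (by positivity), ← mul_pow,
    mul_one_div]
  refine ENNReal.ofReal_le_ofReal (div_le_div_of_nonneg_right ?_ (by positivity))
  exact pow_le_pow_left₀ (norm_nonneg _) hz 2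

theorem ae_norm_le_of_osc {F : ℂ → ℂ} {h : HHalf} {c : ℝ} (hc : 0 ≤ c)
    (hF : ∀ᵐ z ∂(volume.restrict upperHalf), ‖F z‖ ≤ c * h.oscR z.re z.im) :
    ∀ᵐ z ∂(volume.restrict upperHalf), ‖F z‖ ≤ c * (2 * Real.pi * ‖h‖) := by
  filter_upwards [hF, ae_upperHalf fun z hz => hz] with z hz hy
  exact hz.trans (mul_le_mul_of_nonneg_left (h.oscR_le z.re hy) hc)

/-- A measurable function that is dominated by the mean oscillation of an element of `H^{1/2}`
represents an element of `𝓛(𝕌)`. -/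
theorem exists_wpSpace_of_osc {F : ℂ → ℂ}
    (hm : AEStronglyMeasurable F (volume.restrict upperHalf)) {h : HHalf} {c : ℝ} (hc : 0 ≤ c)
    (hF : ∀ z : ℂ, 0 < z.im → ‖F z‖ ≤ c * h.oscR z.re z.im) :
    ∃ μ : WPSpace, μ.toLp =ᵐ[volume.restrict upperHalf] F := by
  have hF' := ae_upperHalf hF
  have hL := memLp_top_of_bound hm _ (ae_norm_le_of_osc hc hF')
  refine ⟨⟨hL.toLp F, ?_⟩, hL.coeFn_toLp⟩
  change hypEnergy _ < ⊤
  rw [hypEnergy_congr hL.coeFn_toLp]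
  exact (hypEnergy_le_of_osc hF').trans_lt ENNReal.ofReal_lt_top

theorem norm_toLp_le_of_ae_bound {μ : WPSpace} {C : ℝ} (hC : 0 ≤ C)
    (h : ∀ᵐ z ∂(volume.restrict upperHalf), ‖μ.toLp z‖ ≤ C) : ‖μ.toLp‖ ≤ C := by
  rw [Lp.norm_def, eLpNorm_exponent_top]
  exact ENNReal.toReal_le_of_le_ofReal hC (eLpNormEssSup_le_of_ae_bound h)

/-- The norm of the embedding of functions dominated by the mean oscillation. -/
noncomputable def oscConst : ℝ := 2 * Real.pi + Real.sqrt (1 / Real.pi) * (2 * Real.pi)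

theorem WPSpace.norm_le_of_osc {μ : WPSpace} {F : ℂ → ℂ}
    (hμ : μ.toLp =ᵐ[volume.restrict upperHalf] F) {h : HHalf} {c : ℝ} (hc : 0 ≤ c)
    (hF : ∀ z : ℂ, 0 < z.im → ‖F z‖ ≤ c * h.oscR z.re z.im) :
    ‖μ‖ ≤ c * oscConst * ‖h‖ := by
  have hF' : ∀ᵐ z ∂(volume.restrict upperHalf), ‖μ.toLp z‖ ≤ c * h.oscR z.re z.im := by
    filter_upwards [hμ, ae_upperHalf hF] with z h1 h2
    rwa [h1]
  have h1 := norm_toLp_le_of_ae_bound (by positivity) (ae_norm_le_of_osc hc hF')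
  have h2 := ENNReal.toReal_le_of_le_ofReal (by positivity) (hypEnergy_le_of_osc hF')
  have h3 : Real.sqrt (1 / Real.pi * (hypEnergy μ.toLp).toReal) ≤
      Real.sqrt (1 / Real.pi) * (c * (2 * Real.pi * ‖h‖)) := by
    rw [Real.sqrt_mul (by positivity)]
    refine mul_le_mul_of_nonneg_left ?_ (Real.sqrt_nonneg _)
    exact (Real.sqrt_le_sqrt h2).trans (le_of_eq (Real.sqrt_sq (by positivity)))
  rw [WPSpace.norm_def]
  refine (add_le_add h1 h3).trans (le_of_eq ?_)
  rw [oscConst]; ring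

theorem toLp_add_ae (μ ν : WPSpace) :
    (μ + ν).toLp =ᵐ[volume.restrict upperHalf] fun z => μ.toLp z + ν.toLp z :=
  Lp.coeFn_add μ.toLp ν.toLp

theorem toLp_sub_ae (μ ν : WPSpace) :
    (μ - ν).toLp =ᵐ[volume.restrict upperHalf] fun z => μ.toLp z - ν.toLp z :=
  Lp.coeFn_sub μ.toLp ν.toLp

theorem toLp_smul_ae (c : ℂ) (μ : WPSpace) :
    (c • μ).toLp =ᵐ[volume.restrict upperHalf] fun z => c * μ.toLp z :=
  Lp.coeFn_smul c μ.toLp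

section Holomorphy

variable {a b : ℝ → ℂ} {M : ℝ}

theorem beltramiDeriv_add (ha : IsKernel a M) (hb : IsKernel b M) (u h k : HHalf) {z : ℂ}
    (hz : 0 < z.im) :
    beltramiDeriv a b u (h + k) z = beltramiDeriv a b u h z + beltramiDeriv a b u k z := by
  have e : (fun t => Complex.exp (u t) * (h + k : HHalf) t) =
      fun t => Complex.exp (u t) * h t + Complex.exp (u t) * k t := by
    funext t; rw [HHalf.add_apply, mul_add]
  rw [beltramiDeriv, e, kerConv_add ha (u.locallyIntegrable_exp_mul h)
    (u.locallyIntegrable_exp_mul k) _ hz, kerConv_add hb (u.locallyIntegrable_exp_mul h)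
    (u.locallyIntegrable_exp_mul k) _ hz, beltramiDeriv, beltramiDeriv, ← add_div]
  congr 1
  ring

theorem beltramiDeriv_smul (a b : ℝ → ℂ) (u h : HHalf) (c : ℂ) (z : ℂ) :
    beltramiDeriv a b u (c • h) z = c * beltramiDeriv a b u h z := by
  have e : (fun t => Complex.exp (u t) * (c • h : HHalf) t) =
      fun t => c * (Complex.exp (u t) * h t) := by
    funext t
    rw [show (c • h : HHalf) t = c * h t from rfl]
    ring
  rw [beltramiDeriv, e, kerConv_const_mul, kerConv_const_mul, beltramiDeriv, ← mul_div_assoc]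
  congr 1
  ring

/-- The map `u ↦ (b_y * exp u) / (a_y * exp u)` from a ball of `H^{1/2}` to `𝓛(𝕌)` is
holomorphic. -/
theorem differentiableAt_of_toLp_eq_beltramiFun (ha : IsKernel a M) (ha2 : ∫ s, a s = 2)
    (hb : IsKernel b M) (hb0 : ∫ s, b s = 0) {Λ : HHalf → WPSpace}
    (hΛ : ∀ u : HHalf, ‖u‖ < smallRadius M →
      (Λ u).toLp =ᵐ[volume.restrict upperHalf] beltramiFun a b u)
    {u : HHalf} (hu : ‖u‖ < smallRadius M) : DifferentiableAt ℂ Λ u := by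
  have hM := ha.nonneg
  have hE := one_le_expBound
  have hpi := Real.pi_pos
  have hb1 : ∀ h : HHalf, ∀ z : ℂ, 0 < z.im →
      ‖beltramiDeriv a b u h z‖ ≤ 4 * M * expBound * h.oscR z.re z.im :=
    fun h z hz => norm_beltramiDeriv_le ha ha2 hb hb0 hu h hz
  choose L hL using fun h : HHalf => exists_wpSpace_of_osc
    (aestronglyMeasurable_beltramiDeriv ha.continuous hb.continuous u h _) (by positivity) (hb1 h)
  let L' : HHalf →ₗ[ℂ] WPSpace :=
    { toFun := L
      map_add' := fun h k => WPSpace.ext_ae <| by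
        filter_upwards [hL (h + k), hL h, hL k, toLp_add_ae (L h) (L k),
          ae_upperHalf fun z hz => hz] with z h1 h2 h3 h4 hz
        rw [h1, h4, h2, h3, beltramiDeriv_add ha hb u h k hz]
      map_smul' := fun c h => WPSpace.ext_ae <| by
        filter_upwards [hL (c • h), hL h, toLp_smul_ae c (L h)] with z h1 h2 h3
        rw [h1, RingHom.id_apply, h3, h2, beltramiDeriv_smul] }
  let L'' : HHalf →L[ℂ] WPSpace := L'.mkContinuous (4 * M * expBound * oscConst)
    fun h => WPSpace.norm_le_of_osc (hL h) (by positivity) (hb1 h)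
  set C : ℝ := 2 * (32 * Real.pi * M * expBound) + 2 * (2 * M * expBound) *
    (2 * M * expBound * (2 * Real.pi) + 32 * Real.pi * M * expBound * (4 * Real.pi)) with hC
  have hC0 : 0 ≤ C := by positivity
  have key : ∀ v : HHalf, ‖v‖ < smallRadius M →
      ‖Λ v - Λ u - L'' (v - u)‖ ≤ C * oscConst * ‖v - u‖ ^ 2 := by
    intro v hv
    have hvu : u + (v - u) = v := by abel
    have hrem : ∀ z : ℂ, 0 < z.im →
        ‖beltramiFun a b v z - beltramiFun a b u z - beltramiDeriv a b u (v - u) z‖ ≤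
          C * ‖v - u‖ * (v - u).oscR z.re z.im := fun z hz => by
      have := norm_beltramiFun_remainder_le ha ha2 hb hb0 (h := v - u) hu (by rwa [hvu]) hz
      rwa [hvu] at this
    refine (WPSpace.norm_le_of_osc (F := fun z => beltramiFun a b v z - beltramiFun a b u z -
      beltramiDeriv a b u (v - u) z) ?_ (by positivity) hrem).trans (le_of_eq (by ring))
    filter_upwards [toLp_sub_ae (Λ v - Λ u) (L'' (v - u)), toLp_sub_ae (Λ v) (Λ u), hΛ v hv,
      hΛ u hu, hL (v - u)] with z h1 h2 h3 h4 h5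
    rw [h1, h2, h3, h4]
    congr 1
  refine HasFDerivAt.differentiableAt (f' := L'') (HasFDerivAt.of_isLittleO ?_)
  have hball : ∀ᶠ v in 𝓝 u, ‖v‖ < smallRadius M :=
    (continuous_norm.tendsto u).eventually_lt_const hu
  have hO : (fun v => Λ v - Λ u - L'' (v - u)) =O[𝓝 u] fun v => ‖v - u‖ ^ 2 :=
    Asymptotics.IsBigO.of_bound (C * oscConst) (hball.mono fun v hv => by
      rw [Real.norm_of_nonneg (by positivity)]
      exact key v hv)
  have ht : Tendsto (fun v => v - u) (𝓝 u) (𝓝 0) := by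
    have := (continuous_sub_right u).tendsto u
    rwa [sub_self] at this
  exact hO.trans_isLittleO ((Asymptotics.isLittleO_norm_pow_id one_lt_two).comp_tendsto ht)

theorem exists_beltramiMap (ha : IsKernel a M) (ha2 : ∫ s, a s = 2) (hb : IsKernel b M)
    (hb0 : ∫ s, b s = 0) : ∃ Λ : HHalf → WPSpace, ∀ u : HHalf, ‖u‖ < smallRadius M →
      (Λ u).toLp =ᵐ[volume.restrict upperHalf] beltramiFun a b u := by
  classical
  have hM := ha.nonneg
  have hE := one_le_expBound
  have h : ∀ u : HHalf, ∃ μ : WPSpace, ‖u‖ < smallRadius M →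
      μ.toLp =ᵐ[volume.restrict upperHalf] beltramiFun a b u := fun u => by
    by_cases hu : ‖u‖ < smallRadius M
    · obtain ⟨μ, hμ⟩ := exists_wpSpace_of_osc
        (aestronglyMeasurable_beltramiFun ha.continuous hb.continuous u _) (by positivity)
        (fun z hz => norm_beltramiFun_le ha ha2 hb hb0 hu hz)
      exact ⟨μ, fun _ => hμ⟩
    · exact ⟨0, fun h => absurd h hu⟩
  choose Λ hΛ using h
  exact ⟨Λ, hΛ⟩

end Holomorphy

/-! ### Derivatives of the smoothing of a primitive -/

/-- The primitive of `f` that vanishes at `0`. -/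
noncomputable def primitive (f : ℝ → ℂ) (x : ℝ) : ℂ := ∫ t in (0 : ℝ)..x, f t

theorem continuous_primitive {f : ℝ → ℂ} (hf : LocallyIntegrable f volume) :
    Continuous (primitive f) :=
  intervalIntegral.continuous_primitive
    (fun a b => intervalIntegrable_of_locallyIntegrable hf a b) 0

theorem primitive_sub {f : ℝ → ℂ} (hf : LocallyIntegrable f volume) (p t : ℝ) :
    primitive f t - primitive f p = ∫ τ in p..t, f τ := by
  rw [primitive, primitive, intervalIntegral.integral_interval_sub_left
    (intervalIntegrable_of_locallyIntegrable hf _ _)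
    (intervalIntegrable_of_locallyIntegrable hf _ _)]

/-- Fubini's theorem on a triangle. -/
theorem integral_mul_integral_eq {k f : ℝ → ℂ} {p q : ℝ} (hpq : p ≤ q)
    (hk : IntervalIntegrable k volume p q) (hf : IntervalIntegrable f volume p q) :
    ∫ t in p..q, k t * ∫ τ in p..t, f τ = ∫ τ in p..q, (∫ t in τ..q, k t) * f τ := by
  set F : ℝ → ℝ → ℂ := fun t τ => if τ ≤ t then k t * f τ else 0 with hF
  have hint : IntegrableOn (Function.uncurry F) (uIoc p q ×ˢ uIoc p q) volume := by
    rw [uIoc_of_le hpq, IntegrableOn, Measure.volume_eq_prod, ← Measure.prod_restrict]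
    have h1 := ((hk.1).integrable.mul_prod hf.1.integrable).indicator
      (measurableSet_le measurable_snd measurable_fst : MeasurableSet {w : ℝ × ℝ | w.2 ≤ w.1})
    refine h1.congr (.of_forall fun w => ?_)
    simp only [hF, Function.uncurry, indicator, mem_ofPred_eq]
  have hswap := intervalIntegral_intervalIntegral_swap (F := F) hint
  have hl : ∫ t in p..q, k t * ∫ τ in p..t, f τ = ∫ t in p..q, ∫ τ in p..q, F t τ := by
    refine intervalIntegral.integral_congr fun t ht => ?_
    rw [uIcc_of_le hpq] at ht
    simp only [hF]
    rw [← intervalIntegral.integral_const_mul, intervalIntegral.integral_of_le ht.1,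
      intervalIntegral.integral_of_le hpq, ← integral_indicator measurableSet_Ioc,
      ← integral_indicator measurableSet_Ioc]
    congr 1; funext τ
    by_cases h1 : τ ∈ Ioc p t
    · rw [indicator_of_mem h1, indicator_of_mem (show τ ∈ Ioc p q from ⟨h1.1, h1.2.trans ht.2⟩),
      if_pos h1.2]
    · rw [indicator_of_notMem h1]
      by_cases h2 : τ ∈ Ioc p q
      · rw [indicator_of_mem h2, if_neg fun h => h1 ⟨h2.1, h⟩]
      · rw [indicator_of_notMem h2]
  have hr : ∫ τ in p..q, (∫ t in τ..q, k t) * f τ = ∫ τ in p..q, ∫ t in p..q, F t τ := by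
    refine intervalIntegral.integral_congr fun τ hτ => ?_
    rw [uIcc_of_le hpq] at hτ
    simp only [hF]
    rw [← intervalIntegral.integral_mul_const, intervalIntegral.integral_of_le hτ.2,
      intervalIntegral.integral_of_le hpq, ← integral_Icc_eq_integral_Ioc,
      ← integral_Icc_eq_integral_Ioc, ← integral_indicator measurableSet_Icc,
      ← integral_indicator measurableSet_Icc]
    congr 1; funext t
    by_cases h1 : t ∈ Icc τ q
    · rw [indicator_of_mem h1, indicator_of_mem (show t ∈ Icc p q from ⟨hτ.1.trans h1.1, h1.2⟩),
      if_pos h1.1]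
    · rw [indicator_of_notMem h1]
      by_cases h2 : t ∈ Icc p q
      · rw [indicator_of_mem h2, if_neg fun h => h1 ⟨h, h2.2⟩]
      · rw [indicator_of_notMem h2]
  rw [hl, hr, hswap]

/-- The primitive of a kernel that vanishes to the left of its support. -/
noncomputable def kerPrimitive (K : ℝ → ℂ) (s : ℝ) : ℂ := ∫ σ in (-1 : ℝ)..s, K σ

theorem hasDerivAt_kerPrimitive {K : ℝ → ℂ} (hK : Continuous K) (s : ℝ) :
    HasDerivAt (kerPrimitive K) (K s) s :=
  intervalIntegral.integral_hasDerivAt_right (hK.intervalIntegrable _ _)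
    hK.stronglyMeasurable.stronglyMeasurableAtFilter hK.continuousAt

theorem continuous_kerPrimitive {K : ℝ → ℂ} (hK : Continuous K) : Continuous (kerPrimitive K) :=
  continuous_iff_continuousAt.2 fun s => (hasDerivAt_kerPrimitive hK s).continuousAt

theorem IsKernel.kerConv_eq_intervalIntegral {K : ℝ → ℂ} {M : ℝ} (hK : IsKernel K M) (f : ℝ → ℂ)
    {x y p q : ℝ} (hy : 0 < y) (hp : p < x - y) (hq : x + y < q) :
    kerConv K f x y = ∫ t in p..q, ((y⁻¹ : ℝ) : ℂ) * K (y⁻¹ * (x - t)) * f t := by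
  rw [kerConv, intervalIntegral.integral_of_le (by linarith),
    setIntegral_eq_integral_of_forall_compl_eq_zero]
  intro t ht
  rw [hK.eq_zero hy, mul_zero, zero_mul]
  exact fun h => ht ⟨by linarith [h.1], by linarith [h.2]⟩

theorem IsKernel.integral_tail {K : ℝ → ℂ} {M : ℝ} (hK : IsKernel K M) {x y q : ℝ} (hy : 0 < y)
    (hq : x + y < q) (τ : ℝ) :
    ∫ t in τ..q, ((y⁻¹ : ℝ) : ℂ) * K (y⁻¹ * (x - t)) = kerPrimitive K (y⁻¹ * (x - τ)) := by
  have hd : ∀ t ∈ uIcc τ q, HasDerivAt (fun t => -kerPrimitive K (y⁻¹ * (x - t)))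
      (((y⁻¹ : ℝ) : ℂ) * K (y⁻¹ * (x - t))) t := fun t _ => by
    have h1 : HasDerivAt (fun t => y⁻¹ * (x - t)) (-y⁻¹) t := by
      have := ((hasDerivAt_id t).const_sub x).const_mul y⁻¹
      simpa using this
    have h2 := ((hasDerivAt_kerPrimitive hK.continuous (y⁻¹ * (x - t))).scomp t h1).neg
    refine h2.congr_deriv ?_
    rw [Complex.real_smul]; push_cast; ring
  have hc := hK.continuous
  rw [intervalIntegral.integral_eq_sub_of_hasDerivAt hd
    (Continuous.intervalIntegrable (by fun_prop) _ _)]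
  have h0 : kerPrimitive K (y⁻¹ * (x - q)) = 0 := by
    rw [kerPrimitive, intervalIntegral.integral_symm, intervalIntegral.integral_zero_ae, neg_zero]
    have hle : y⁻¹ * (x - q) ≤ -1 := by
      rw [inv_mul_eq_div, div_le_iff₀ hy]; linarith
    filter_upwards [compl_mem_ae_iff.2 (measure_singleton (-1 : ℝ))] with s hne hs
    rw [uIoc_of_le hle] at hs
    by_contra h
    exact hne (le_antisymm hs.2 (hK.support_subset h).1)
  rw [h0]; ring

/-- Integration by parts for the smoothing of a primitive. -/
theorem IsKernel.kerConv_primitive {K : ℝ → ℂ} {M : ℝ} (hK : IsKernel K M) {f : ℝ → ℂ}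
    (hf : LocallyIntegrable f volume) {x y p q : ℝ} (hy : 0 < y) (hp : p < x - y)
    (hq : x + y < q) :
    kerConv K (primitive f) x y = primitive f p * (∫ s, K s) +
      ∫ t in p..q, kerPrimitive K (y⁻¹ * (x - t)) * f t := by
  have hc := hK.continuous
  have hpf := continuous_primitive hf
  have e : primitive f = fun t => primitive f p * 1 + (primitive f t - primitive f p) := by
    funext t; ring
  have h1 : kerConv K (primitive f) x y = primitive f p * (∫ s, K s) +
      kerConv K (fun t => primitive f t - primitive f p) x y := by
    conv_lhs => rw [e]
    rw [kerConv_add hK (locallyIntegrable_const _) (by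
      exact (hpf.sub continuous_const).locallyIntegrable) x hy, kerConv_const_mul,
      kerConv_one K x hy]
  rw [h1, hK.kerConv_eq_intervalIntegral _ hy hp hq]
  congr 1
  simp_rw [primitive_sub hf]
  rw [integral_mul_integral_eq (by linarith) (Continuous.intervalIntegrable (by fun_prop) _ _)
    (intervalIntegrable_of_locallyIntegrable hf _ _)]
  simp_rw [hK.integral_tail hy hq]

theorem hasDerivAt_integral_kerPrimitive {K : ℝ → ℂ} {M : ℝ} (hK : IsKernel K M) {f : ℝ → ℂ}
    {p q : ℝ} (hpq : p ≤ q) (hf : IntervalIntegrable f volume p q) {θ θ' : ℝ → ℝ → ℝ} {s₀ B : ℝ}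
    {S : Set ℝ} (hS : S ∈ 𝓝 s₀) (hθ : ∀ s ∈ S, Continuous (θ s)) (hθ' : Continuous (θ' s₀))
    (hd : ∀ s ∈ S, ∀ t, HasDerivAt (fun s => θ s t) (θ' s t) s)
    (hB : ∀ s ∈ S, ∀ t ∈ Icc p q, |θ' s t| ≤ B) :
    HasDerivAt (fun s => ∫ t in p..q, kerPrimitive K (θ s t) * f t)
      (∫ t in p..q, (θ' s₀ t : ℂ) * K (θ s₀ t) * f t) s₀ := by
  have hc := hK.continuous
  have hM := hK.nonneg
  have hcp := continuous_kerPrimitive hc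
  have hs₀ := mem_of_mem_nhds hS
  have hθ₀ := hθ s₀ hs₀
  have hfm : AEStronglyMeasurable f (volume.restrict (uIoc p q)) := by
    rw [uIoc_of_le hpq]; exact hf.1.aestronglyMeasurable
  refine (intervalIntegral.hasDerivAt_integral_of_dominated_loc_of_deriv_le (μ := volume)
    (F := fun s t => kerPrimitive K (θ s t) * f t)
    (F' := fun s t => (θ' s t : ℂ) * K (θ s t) * f t)
    (bound := fun t => B * M * ‖f t‖) hS ?_ ?_ ?_ ?_ ?_ ?_).2
  · filter_upwards [hS] with s hs
    exact (hcp.comp (hθ s hs)).aestronglyMeasurable.mul hfm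
  · exact hf.continuousOn_mul (hcp.comp hθ₀).continuousOn
  · exact (by fun_prop : Continuous fun t => (θ' s₀ t : ℂ) * K (θ s₀ t)).aestronglyMeasurable.mul
      hfm
  · refine .of_forall fun t ht s hs => ?_
    rw [uIoc_of_le hpq] at ht
    have h1 := hB s hs t (Ioc_subset_Icc_self ht)
    rw [norm_mul, norm_mul, Complex.norm_real, Real.norm_eq_abs]
    gcongr
    · exact (abs_nonneg _).trans h1
    · exact hK.norm_le _
  · exact hf.norm.const_mul _
  · refine .of_forall fun t _ s hs => ?_
    have h2 := ((hasDerivAt_kerPrimitive hc (θ s t)).scomp s (hd s hs t)).mul_const (f t)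
    simpa [Complex.real_smul] using h2

/-- The first moment kernel `s ↦ s K(s)`. -/
noncomputable def momentKernel (K : ℝ → ℂ) (s : ℝ) : ℂ := s * K s

theorem hasDerivAt_kerConv_primitive_fst {K : ℝ → ℂ} {M : ℝ} (hK : IsKernel K M) {f : ℝ → ℂ}
    (hf : LocallyIntegrable f volume) (x : ℝ) {y : ℝ} (hy : 0 < y) :
    HasDerivAt (fun x => kerConv K (primitive f) x y) (kerConv K f x y) x := by
  have hp : x - y - 2 < x - y := by linarith
  have hq : x + y < x + y + 2 := by linarith
  have h := hasDerivAt_integral_kerPrimitive hK (p := x - y - 2) (q := x + y + 2) (by linarith)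
    (intervalIntegrable_of_locallyIntegrable hf _ _) (θ := fun s t => y⁻¹ * (s - t))
    (θ' := fun _ _ => y⁻¹) (s₀ := x) (B := y⁻¹) univ_mem (fun s _ => by fun_prop)
    continuous_const (fun s _ t => by simpa using ((hasDerivAt_id s).sub_const t).const_mul y⁻¹)
    (fun s _ t _ => (abs_of_pos (inv_pos.2 hy)).le)
  rw [← hK.kerConv_eq_intervalIntegral f hy hp hq] at h
  refine (h.const_add (primitive f (x - y - 2) * ∫ s, K s)).congr_of_eventuallyEq ?_
  filter_upwards [Ioo_mem_nhds (by linarith : x - 1 < x) (by linarith : x < x + 1)] with x' hx'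
  exact hK.kerConv_primitive hf hy (by linarith [hx'.1]) (by linarith [hx'.2])

theorem IsKernel.momentKernel {K : ℝ → ℂ} {M : ℝ} (hK : IsKernel K M) :
    IsKernel (momentKernel K) M := by
  have hc := hK.continuous
  refine ⟨by unfold WeilPetersson.momentKernel; fun_prop,
    fun s hs => hK.support_subset (right_ne_zero_of_mul hs), fun s => ?_⟩
  by_cases h : K s = 0
  · rw [WeilPetersson.momentKernel, h, mul_zero, norm_zero]; exact hK.nonneg
  · have h1 := hK.support_subset h
    rw [WeilPetersson.momentKernel, norm_mul, Complex.norm_real, Real.norm_eq_abs]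
    exact (mul_le_of_le_one_left (norm_nonneg _) (abs_le.2 h1)).trans (hK.norm_le s)

theorem hasDerivAt_kerConv_primitive_snd {K : ℝ → ℂ} {M : ℝ} (hK : IsKernel K M) {f : ℝ → ℂ}
    (hf : LocallyIntegrable f volume) (x : ℝ) {y : ℝ} (hy : 0 < y) :
    HasDerivAt (fun y => kerConv K (primitive f) x y) (-kerConv (momentKernel K) f x y) y := by
  have hp : x - 2 * y < x - y := by linarith
  have hq : x + y < x + 2 * y := by linarith
  have hS : Ioo (y / 2) (2 * y) ∈ 𝓝 y := Ioo_mem_nhds (by linarith) (by linarith)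
  have h := hasDerivAt_integral_kerPrimitive hK (p := x - 2 * y) (q := x + 2 * y) (by linarith)
    (intervalIntegrable_of_locallyIntegrable hf _ _) (θ := fun s t => s⁻¹ * (x - t))
    (θ' := fun s t => -(s ^ 2)⁻¹ * (x - t)) (s₀ := y) (B := ((y / 2) ^ 2)⁻¹ * (2 * y)) hS
    (fun s _ => by fun_prop) (by fun_prop)
    (fun s hs t => (hasDerivAt_inv (by linarith [hs.1] : s ≠ 0)).mul_const (x - t))
    (fun s hs t ht => by
      have hs0 : 0 < s := by linarith [hs.1]
      rw [abs_mul, abs_neg, abs_of_pos (by positivity)]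
      gcongr
      · exact hs.1.le
      · rw [abs_le]; constructor <;> linarith [ht.1, ht.2])
  have e : ∫ t in (x - 2 * y)..(x + 2 * y), ((-(y ^ 2)⁻¹ * (x - t) : ℝ) : ℂ) *
      K (y⁻¹ * (x - t)) * f t = -kerConv (momentKernel K) f x y := by
    rw [hK.momentKernel.kerConv_eq_intervalIntegral f hy hp hq, ← intervalIntegral.integral_neg]
    congr 1; funext t
    rw [momentKernel]
    push_cast
    have : (y : ℂ) ≠ 0 := by exact_mod_cast hy.ne'
    field_simp
  rw [e] at h
  refine (h.const_add (primitive f (x - 2 * y) * ∫ s, K s)).congr_of_eventuallyEq ?_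
  filter_upwards [hS] with y' hy'
  exact hK.kerConv_primitive hf (by linarith [hy'.1]) (by linarith [hy'.2]) (by linarith [hy'.2])

/-! ### Comparison of the extension with a linear map -/

/-- On every interval `f` is, in the mean, within the relative error `ε` of a nonzero constant. -/
def IsNearlyConstant (f : ℝ → ℂ) (ε : ℝ) : Prop :=
  ∀ X R : ℝ, 0 < R → ∃ c : ℂ, c ≠ 0 ∧
    ∫⁻ t, ‖f t - c‖ₑ ∂(unifMeasure X R) ≤ ENNReal.ofReal (ε * ‖c‖)

theorem lintegral_unifMeasure_mono (g : ℝ → ℝ≥0∞) {x y X R : ℝ} (hy : 0 < y) (hR : 0 < R)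
    (h : Ioc (x - y) (x + y) ⊆ Ioc (X - R) (X + R)) :
    ∫⁻ t, g t ∂(unifMeasure x y) ≤ ENNReal.ofReal (R / y) * ∫⁻ t, g t ∂(unifMeasure X R) := by
  rw [lintegral_unifMeasure, lintegral_unifMeasure, ← mul_assoc,
    ← ENNReal.ofReal_inv_of_pos (by positivity), ← ENNReal.ofReal_inv_of_pos (by positivity),
    ← ENNReal.ofReal_mul (by positivity), show R / y * (2 * R)⁻¹ = (2 * y)⁻¹ by field_simp]
  exact mul_le_mul_right (lintegral_mono_set h) _

theorem kerConv_const (K : ℝ → ℂ) (c : ℂ) (x : ℝ) {y : ℝ} (hy : 0 < y) :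
    kerConv K (fun _ => c) x y = c * ∫ s, K s := by
  have := kerConv_const_mul K c (fun _ => 1) x y
  rwa [kerConv_one K x hy, mul_one] at this

theorem norm_kerConv_sub_const_le {K : ℝ → ℂ} {N : ℝ} (hK : IsKernel K N) {f : ℝ → ℂ}
    (hf : LocallyIntegrable f volume) {x y X R : ℝ} (hy : 0 < y) (hR : 0 < R)
    (h : Ioc (x - y) (x + y) ⊆ Ioc (X - R) (X + R)) {c : ℂ} {η : ℝ} (hη : 0 ≤ η)
    (hc : ∫⁻ t, ‖f t - c‖ₑ ∂(unifMeasure X R) ≤ ENNReal.ofReal η) :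
    ‖kerConv K f x y - c * ∫ s, K s‖ ≤ 2 * N * (R / y) * η := by
  have hN := hK.nonneg
  rw [← kerConv_const K c x hy, ← kerConv_sub hK hf (locallyIntegrable_const c) x hy]
  have h1 : ‖kerConv K (fun t => f t - c) x y‖ₑ ≤ ENNReal.ofReal (2 * N * (R / y) * η) := by
    rw [ENNReal.ofReal_mul (by positivity), ENNReal.ofReal_mul (by positivity), mul_assoc]
    exact (enorm_kerConv_le hK _ x hy).trans (mul_le_mul_right
      ((lintegral_unifMeasure_mono _ hy hR h).trans (mul_le_mul_right hc _)) _)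
  rwa [← ofReal_norm, ENNReal.ofReal_le_ofReal_iff (by positivity)] at h1

/-- The smoothing of the primitive of `f`, as a function of `z = x + i y`. -/
noncomputable def smoothExt (K f : ℝ → ℂ) (z : ℂ) : ℂ := kerConv K (primitive f) z.re z.im

section Quasiconformal

variable {K : ℝ → ℂ} {N : ℝ} {f : ℝ → ℂ}

/-- Near a point the extension is a small Lipschitz perturbation of `z ↦ c z`. -/
theorem norm_smoothExt_sub_sub_le_near (hK : IsKernel K N) (hK1 : ∫ s, K s = 1)
    (hKm : ∫ s, momentKernel K s = -Complex.I) (hf : LocallyIntegrable f volume) {z₀ : ℂ}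
    (hz₀ : 0 < z₀.im) {c : ℂ} {η : ℝ} (hη : 0 ≤ η)
    (hc : ∫⁻ t, ‖f t - c‖ₑ ∂(unifMeasure z₀.re (2 * z₀.im)) ≤ ENNReal.ofReal η) {z w : ℂ}
    (hz : ‖z - z₀‖ ≤ z₀.im / 2) (hw : ‖w - z₀‖ ≤ z₀.im / 2) :
    ‖smoothExt K f z - smoothExt K f w - c * (z - w)‖ ≤ 16 * N * η * ‖z - w‖ := by
  have hN := hK.nonneg
  have bounds : ∀ v : ℂ, ‖v - z₀‖ ≤ z₀.im / 2 → v.re ∈ Icc (z₀.re - z₀.im / 2) (z₀.re + z₀.im / 2)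
      ∧ v.im ∈ Icc (z₀.im / 2) (3 * z₀.im / 2) := fun v hv => by
    have h1 := abs_le.1 ((Complex.abs_re_le_norm _).trans hv)
    have h2 := abs_le.1 ((Complex.abs_im_le_norm _).trans hv)
    rw [Complex.sub_re] at h1
    rw [Complex.sub_im] at h2
    exact ⟨⟨by linarith, by linarith⟩, by linarith, by linarith⟩
  obtain ⟨hzx, hzy⟩ := bounds z hz
  obtain ⟨hwx, hwy⟩ := bounds w hw
  have est : ∀ {L : ℝ → ℂ}, IsKernel L N →
      ∀ x ∈ Icc (z₀.re - z₀.im / 2) (z₀.re + z₀.im / 2),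
      ∀ y ∈ Icc (z₀.im / 2) (3 * z₀.im / 2), ‖kerConv L f x y - c * ∫ s, L s‖ ≤ 8 * N * η := by
    intro L hL x hx y hy
    have hy0 : 0 < y := by linarith [hy.1]
    refine (norm_kerConv_sub_const_le hL hf hy0 (by positivity) (Ioc_subset_Ioc
      (by linarith [hx.1, hy.2]) (by linarith [hx.2, hy.2])) hη hc).trans ?_
    have : 2 * z₀.im / y ≤ 4 := by rw [div_le_iff₀ hy0]; linarith [hy.1]
    calc 2 * N * (2 * z₀.im / y) * η ≤ 2 * N * 4 * η := by gcongr
      _ = 8 * N * η := by ring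
  set H : ℝ → ℝ → ℂ := fun x y => kerConv K (primitive f) x y - c * ((x : ℂ) + y * Complex.I)
    with hH
  have hHx : ‖H z.re z.im - H w.re z.im‖ ≤ 8 * N * η * ‖z.re - w.re‖ := by
    have hy0 : 0 < z.im := by linarith [hzy.1]
    refine Convex.norm_image_sub_le_of_norm_hasDerivWithin_le (f := fun x => H x z.im)
      (f' := fun x => kerConv K f x z.im - c) (s := Icc (z₀.re - z₀.im / 2) (z₀.re + z₀.im / 2))
      (fun x _ => HasDerivAt.hasDerivWithinAt ?_) (fun x hx => ?_) (convex_Icc _ _) hwx hzx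
    · have h1 := ((hasDerivAt_id x).ofReal_comp.add_const (z.im * Complex.I)).const_mul c
      have h2 := (hasDerivAt_kerConv_primitive_fst hK hf x hy0).sub h1
      exact h2.congr_deriv (by simp)
    · have := est hK x hx z.im hzy
      rwa [hK1, mul_one] at this
  have hHy : ‖H w.re z.im - H w.re w.im‖ ≤ 8 * N * η * ‖z.im - w.im‖ := by
    refine Convex.norm_image_sub_le_of_norm_hasDerivWithin_le (f := fun y => H w.re y)
      (f' := fun y => -kerConv (momentKernel K) f w.re y - c * Complex.I)
      (s := Icc (z₀.im / 2) (3 * z₀.im / 2))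
      (fun y hy => HasDerivAt.hasDerivWithinAt ?_) (fun y hy => ?_) (convex_Icc _ _) hwy hzy
    · have h1 := (((hasDerivAt_id y).ofReal_comp.mul_const Complex.I).const_add
        (w.re : ℂ)).const_mul c
      have h2 := (hasDerivAt_kerConv_primitive_snd hK hf w.re
        (by linarith [hy.1] : 0 < y)).sub h1
      exact h2.congr_deriv (by simp)
    · have := est hK.momentKernel w.re hwx y hy
      rw [hKm] at this
      rw [← norm_neg]
      refine le_trans (le_of_eq ?_) this
      congr 1; ring
  have e : smoothExt K f z - smoothExt K f w - c * (z - w) =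
      (H z.re z.im - H w.re z.im) + (H w.re z.im - H w.re w.im) := by
    have h1 : c * (z - w) = c * ((z.re : ℂ) + z.im * Complex.I) -
        c * ((w.re : ℂ) + w.im * Complex.I) := by
      rw [Complex.re_add_im, Complex.re_add_im]; ring
    rw [h1, hH]
    simp only [smoothExt]
    ring
  rw [e]
  refine (norm_add_le _ _).trans ((add_le_add hHx hHy).trans ?_)
  have h1 : ‖z.re - w.re‖ ≤ ‖z - w‖ := by
    rw [← Complex.sub_re]; exact Complex.abs_re_le_norm _
  have h2 : ‖z.im - w.im‖ ≤ ‖z - w‖ := by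
    rw [← Complex.sub_im]; exact Complex.abs_im_le_norm _
  have h3 := mul_le_mul_of_nonneg_left (add_le_add h1 h2) (by positivity : 0 ≤ 8 * N * η)
  linarith

theorem kerConv_id (hK : IsKernel K N) (hK1 : ∫ s, K s = 1)
    (hKm : ∫ s, momentKernel K s = -Complex.I) (x : ℝ) {y : ℝ} (hy : 0 < y) :
    kerConv K (fun t => (t : ℂ)) x y = x + y * Complex.I := by
  have e : kerConv K (fun t => (t : ℂ)) x y =
      x * kerConv K (fun _ => 1) x y - y * kerConv (momentKernel K) (fun _ => 1) x y := by
    rw [kerConv, kerConv, kerConv, ← integral_const_mul, ← integral_const_mul, ← integral_sub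
      ((hK.integrable (locallyIntegrable_const 1) x hy).const_mul _)
      ((hK.momentKernel.integrable (locallyIntegrable_const 1) x hy).const_mul _)]
    congr 1; funext t
    rw [momentKernel]
    push_cast
    have : (y : ℂ) ≠ 0 := by exact_mod_cast hy.ne'
    field_simp
    ring
  rw [e, kerConv_one _ _ hy, kerConv_one _ _ hy, hK1, hKm]
  ring

theorem norm_primitive_sub_le (hf : LocallyIntegrable f volume) {X R t : ℝ} {c : ℂ} {η : ℝ}
    (hR : 0 < R) (hη : 0 ≤ η)
    (hc : ∫⁻ t, ‖f t - c‖ₑ ∂(unifMeasure X R) ≤ ENNReal.ofReal η)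
    (ht : t ∈ Ioc (X - R) (X + R)) :
    ‖primitive f t - primitive f X - c * (t - X)‖ ≤ 2 * R * η := by
  have e : primitive f t - primitive f X - c * (t - X) = ∫ τ in X..t, (f τ - c) := by
    rw [intervalIntegral.integral_sub (intervalIntegrable_of_locallyIntegrable hf _ _)
      intervalIntegrable_const, primitive_sub hf, intervalIntegral.integral_const,
      Complex.real_smul]
    push_cast; ring
  have hsub : uIoc X t ⊆ Ioc (X - R) (X + R) := by
    rintro τ ⟨h1, h2⟩
    exact ⟨(le_min (by linarith) ht.1.le).trans_lt h1, h2.trans (max_le (by linarith) ht.2)⟩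
  have h1 : ‖∫ τ in X..t, (f τ - c)‖ₑ ≤ ENNReal.ofReal (2 * R * η) := by
    rw [← ofReal_norm, intervalIntegral.norm_intervalIntegral_eq, ofReal_norm]
    refine (enorm_integral_le_lintegral_enorm _).trans ((lintegral_mono_set hsub).trans ?_)
    rw [lintegral_unifMeasure] at hc
    have h0 : ENNReal.ofReal (2 * R) ≠ 0 := by rw [ne_eq, ENNReal.ofReal_eq_zero]; linarith
    rw [ENNReal.ofReal_mul (by positivity)]
    refine le_trans (le_of_eq ?_) (mul_le_mul_right hc _)
    rw [← mul_assoc, ENNReal.mul_inv_cancel h0 ENNReal.ofReal_ne_top, one_mul]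
  rw [e]
  rwa [← ofReal_norm, ENNReal.ofReal_le_ofReal_iff (by positivity)] at h1

/-- On the scale of an interval that contains the shadows of two points, the extension differs
from `z ↦ c z` by an error that is small compared with the length of the interval. -/
theorem norm_smoothExt_sub_sub_le_far (hK : IsKernel K N) (hK1 : ∫ s, K s = 1)
    (hKm : ∫ s, momentKernel K s = -Complex.I) (hf : LocallyIntegrable f volume) {X R : ℝ}
    (hR : 0 < R) {c : ℂ} {η : ℝ} (hη : 0 ≤ η)
    (hc : ∫⁻ t, ‖f t - c‖ₑ ∂(unifMeasure X R) ≤ ENNReal.ofReal η) {z w : ℂ}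
    (hz0 : 0 < z.im) (hw0 : 0 < w.im)
    (hz : Ioc (z.re - z.im) (z.re + z.im) ⊆ Ioc (X - R) (X + R))
    (hw : Ioc (w.re - w.im) (w.re + w.im) ⊆ Ioc (X - R) (X + R)) :
    ‖smoothExt K f z - smoothExt K f w - c * (z - w)‖ ≤ 8 * N * R * η := by
  have hN := hK.nonneg
  have hpf := continuous_primitive hf
  set g : ℝ → ℂ := fun t => primitive f t - primitive f X - c * (t - X) with hg
  have hgl : LocallyIntegrable g volume := Continuous.locallyIntegrable (by rw [hg]; fun_prop)
  have hgb : ∀ v : ℂ, 0 < v.im → Ioc (v.re - v.im) (v.re + v.im) ⊆ Ioc (X - R) (X + R) →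
      ‖kerConv K g v.re v.im‖ ≤ 4 * N * R * η := by
    intro v hv hsub
    have := isProbabilityMeasure_unifMeasure v.re hv
    have h1 : ∫⁻ t, ‖g t‖ₑ ∂(unifMeasure v.re v.im) ≤ ENNReal.ofReal (2 * R * η) := by
      refine le_trans (lintegral_mono_ae ?_) (le_of_eq (?_ :
        ∫⁻ _, ENNReal.ofReal (2 * R * η) ∂(unifMeasure v.re v.im) = _))
      · refine Measure.smul_absolutelyContinuous.ae_le ?_
        filter_upwards [self_mem_ae_restrict measurableSet_Ioc] with t ht
        rw [← ofReal_norm]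
        exact ENNReal.ofReal_le_ofReal (norm_primitive_sub_le hf hR hη hc (hsub ht))
      · simp
    have h2 : ‖kerConv K g v.re v.im‖ₑ ≤ ENNReal.ofReal (4 * N * R * η) := by
      refine (enorm_kerConv_le hK g v.re hv).trans ((mul_le_mul_right h1 _).trans (le_of_eq ?_))
      rw [← ENNReal.ofReal_mul (by positivity)]
      congr 1; ring
    rwa [← ofReal_norm, ENNReal.ofReal_le_ofReal_iff (by positivity)] at h2
  have hsplit : ∀ v : ℂ, 0 < v.im →
      smoothExt K f v = kerConv K g v.re v.im + (primitive f X - c * X) + c * v := by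
    intro v hv
    have e : primitive f = fun t => g t + ((primitive f X - c * X) + c * t) := by
      funext t; rw [hg]; ring
    rw [smoothExt]
    conv_lhs => rw [e]
    rw [kerConv_add hK hgl (Continuous.locallyIntegrable (by fun_prop)) _ hv,
      kerConv_add hK (locallyIntegrable_const _) (Continuous.locallyIntegrable (by fun_prop)) _ hv,
      kerConv_const K _ _ hv, kerConv_const_mul, kerConv_id hK hK1 hKm _ hv, hK1,
      Complex.re_add_im]
    ring
  rw [hsplit z hz0, hsplit w hw0]
  calc _ = ‖kerConv K g z.re z.im - kerConv K g w.re w.im‖ := by congr 1; ring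
    _ ≤ 4 * N * R * η + 4 * N * R * η :=
        (norm_sub_le _ _).trans (add_le_add (hgb z hz0 hz) (hgb w hw0 hw))
    _ = _ := by ring

/-- If two points had the same image, the comparison with `z ↦ c z`, at the scale of the larger
height or of the distance of the points, would bound `‖c‖ * ‖z - w‖` by a fraction of itself. -/
theorem injOn_smoothExt (hK : IsKernel K N) (hK1 : ∫ s, K s = 1)
    (hKm : ∫ s, momentKernel K s = -Complex.I) (hf : LocallyIntegrable f volume) {ε : ℝ}
    (hε : 0 ≤ ε) (hfε : IsNearlyConstant f ε) (hNε : 64 * (N * ε) ≤ 1) :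
    InjOn (smoothExt K f) upperHalf := by
  have hN := hK.nonneg
  have main : ∀ z w : ℂ, 0 < z.im → 0 < w.im → w.im ≤ z.im → smoothExt K f z = smoothExt K f w →
      z = w := by
    intro z w hz hw hwz heq
    by_contra hne
    have hd : 0 < ‖z - w‖ := norm_pos_iff.2 (sub_ne_zero.2 hne)
    have hre := Complex.abs_re_le_norm (z - w)
    rw [Complex.sub_re] at hre
    rcases le_or_gt ‖z - w‖ (z.im / 2) with hnear | hfar
    · obtain ⟨c, hc0, hc⟩ := hfε z.re (2 * z.im) (by positivity)
      have h := norm_smoothExt_sub_sub_le_near hK hK1 hKm hf hz (by positivity) hc (z := z) (w := w)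
        (by simpa using (half_pos hz).le) (by rwa [norm_sub_rev])
      rw [heq, sub_self, zero_sub, norm_neg, norm_mul] at h
      have hcd : 0 < ‖c‖ * ‖z - w‖ := mul_pos (norm_pos_iff.2 hc0) hd
      nlinarith
    · have hR : 0 < |z.re - w.re| + z.im := by positivity
      obtain ⟨c, hc0, hc⟩ := hfε z.re _ hR
      have h := norm_smoothExt_sub_sub_le_far hK hK1 hKm hf hR (by positivity) hc hz hw
        (Ioc_subset_Ioc (by linarith [abs_nonneg (z.re - w.re)])
          (by linarith [abs_nonneg (z.re - w.re)]))
        (Ioc_subset_Ioc (by linarith [le_abs_self (z.re - w.re)])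
          (by linarith [neg_abs_le (z.re - w.re)]))
      rw [heq, sub_self, zero_sub, norm_neg, norm_mul] at h
      have hcd : 0 < ‖c‖ * ‖z - w‖ := mul_pos (norm_pos_iff.2 hc0) hd
      have h3 : |z.re - w.re| + z.im ≤ 3 * ‖z - w‖ := by linarith
      have h4 : 8 * N * (|z.re - w.re| + z.im) * (ε * ‖c‖) ≤
          8 * N * (3 * ‖z - w‖) * (ε * ‖c‖) := by gcongr
      nlinarith
  intro z hz w hw heq
  rcases le_total w.im z.im with h | h
  · exact main z w hz hw h heq
  · exact (main w z hw hz h heq.symm).symm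

/-- Around every point the extension is close enough to a nonzero multiple of the identity for the
inverse function theorem to apply. -/
theorem exists_approximatesLinearOn_smoothExt (hK : IsKernel K N) (hK1 : ∫ s, K s = 1)
    (hKm : ∫ s, momentKernel K s = -Complex.I) (hf : LocallyIntegrable f volume) {ε : ℝ}
    (hε : 0 ≤ ε) (hfε : IsNearlyConstant f ε) (hNε : 64 * (N * ε) ≤ 1) {z₀ : ℂ}
    (hz₀ : 0 < z₀.im) : ∃ c : ℂ, c ≠ 0 ∧
      ApproximatesLinearOn (smoothExt K f) (c • ContinuousLinearMap.id ℂ ℂ)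
        (Metric.closedBall z₀ (z₀.im / 2)) (‖c‖₊ / 2) := by
  have hN := hK.nonneg
  obtain ⟨c, hc0, hc⟩ := hfε z₀.re (2 * z₀.im) (by positivity)
  refine ⟨c, hc0, fun z hz w hw => ?_⟩
  rw [mem_closedBall_iff_norm] at hz hw
  have h := norm_smoothExt_sub_sub_le_near hK hK1 hKm hf hz₀ (by positivity) hc hz hw
  refine h.trans ?_
  rw [NNReal.coe_div, coe_nnnorm, NNReal.coe_ofNat]
  have := mul_nonneg (norm_nonneg c) (norm_nonneg (z - w))
  nlinarith

end Quasiconformal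

/-! ### Quasiconformality of the extension -/

section Quasiconformal

variable {K : ℝ → ℂ} {N : ℝ} {f : ℝ → ℂ}

theorem map_nhds_smoothExt (hK : IsKernel K N) (hK1 : ∫ s, K s = 1)
    (hKm : ∫ s, momentKernel K s = -Complex.I) (hf : LocallyIntegrable f volume) {ε : ℝ}
    (hε : 0 ≤ ε) (hfε : IsNearlyConstant f ε) (hNε : 64 * (N * ε) ≤ 1) {z₀ : ℂ}
    (hz₀ : 0 < z₀.im) : map (smoothExt K f) (𝓝 z₀) = 𝓝 (smoothExt K f z₀) := by
  obtain ⟨c, hc0, hc⟩ := exists_approximatesLinearOn_smoothExt hK hK1 hKm hf hε hfε hNε hz₀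
  have hc' : ‖c‖₊ ≠ 0 := nnnorm_ne_zero_iff.2 hc0
  refine hc.map_nhds_eq
    { toFun := fun w => c⁻¹ * w
      nnnorm := ‖c‖₊⁻¹
      bound' := fun w => by simp
      right_inv' := fun w => by simp [mul_inv_cancel_left₀ hc0] }
    (Metric.closedBall_mem_nhds _ (half_pos hz₀)) (Or.inr ?_)
  change ‖c‖₊ / 2 < (‖c‖₊⁻¹)⁻¹
  rw [inv_inv]
  exact NNReal.half_lt_self hc'

theorem isOpenEmbedding_smoothExt (hK : IsKernel K N) (hK1 : ∫ s, K s = 1)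
    (hKm : ∫ s, momentKernel K s = -Complex.I) (hf : LocallyIntegrable f volume) {ε : ℝ}
    (hε : 0 ≤ ε) (hfε : IsNearlyConstant f ε) (hNε : 64 * (N * ε) ≤ 1) :
    Topology.IsOpenEmbedding (upperHalf.domRestrict (smoothExt K f)) := by
  have hopen : IsOpen upperHalf := isOpen_lt continuous_const Complex.continuous_im
  have hmap : ∀ z : upperHalf, map (upperHalf.domRestrict (smoothExt K f)) (𝓝 z) =
      𝓝 (smoothExt K f z) := fun z => by
    rw [← map_nhds_smoothExt hK hK1 hKm hf hε hfε hNε (show 0 < (z : ℂ).im from z.2),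
      ← hopen.nhdsWithin_eq z.2, ← map_nhds_subtype_val, Filter.map_map]
    rfl
  refine Topology.IsOpenEmbedding.of_continuous_injective_isOpenMap
    (continuous_iff_continuousAt.2 fun z => (hmap z).le) ?_
    (IsOpenMap.of_nhds_le fun z => (hmap z).ge)
  exact injOn_iff_injective.1 (injOn_smoothExt hK hK1 hKm hf hε hfε hNε)

theorem exists_bound_kerConv (hK : IsKernel K N) (hf : LocallyIntegrable f volume) {a b c d : ℝ}
    (hab : a ≤ b) (hc : 0 < c) (hcd : c ≤ d) :
    ∃ B : NNReal, ∀ x ∈ Icc a b, ∀ y ∈ Icc c d, ‖kerConv K f x y‖₊ ≤ B := by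
  have hR : 0 < (b - a) / 2 + d := by linarith
  set I := ∫⁻ t, ‖f t‖ₑ ∂(unifMeasure ((a + b) / 2) ((b - a) / 2 + d)) with hI
  have hfin : I ≠ ⊤ := (integrable_unifMeasure hf _ hR).2.ne
  set B := ENNReal.ofReal (2 * N) * (ENNReal.ofReal (((b - a) / 2 + d) / c) * I) with hB
  have hBfin : B ≠ ⊤ := ENNReal.mul_ne_top ENNReal.ofReal_ne_top
    (ENNReal.mul_ne_top ENNReal.ofReal_ne_top hfin)
  refine ⟨B.toNNReal, fun x hx y hy => ?_⟩
  have hy0 : 0 < y := hc.trans_le hy.1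
  rw [← ENNReal.coe_le_coe, ENNReal.coe_toNNReal hBfin]
  refine (enorm_kerConv_le hK f x hy0).trans (mul_le_mul_right
    ((lintegral_unifMeasure_mono _ hy0 hR (Ioc_subset_Ioc (by linarith [hx.1, hy.2])
      (by linarith [hx.2, hy.2]))).trans (mul_le_mul_left (ENNReal.ofReal_le_ofReal ?_) _)) _)
  exact div_le_div_of_nonneg_left hR.le hc hy.1

/-- The extension is even Lipschitz on compact rectangles, since its partial derivatives are
bounded there. -/
theorem isACL_smoothExt (hK : IsKernel K N) (hf : LocallyIntegrable f volume) :
    IsACL (smoothExt K f) upperHalf := by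
  intro a b c d hab hcd hsub
  have hc : 0 < c := by
    have : (⟨a, c⟩ : ℂ) ∈ Icc a b ×ℂ Icc c d :=
      Complex.mem_reProdIm.2 ⟨left_mem_Icc.2 hab, left_mem_Icc.2 hcd⟩
    exact hsub this
  constructor
  · obtain ⟨B, hB⟩ := exists_bound_kerConv hK hf hab hc hcd
    filter_upwards [self_mem_ae_restrict measurableSet_Icc] with y hy
    refine LipschitzOnWith.absolutelyContinuousOnInterval (K := B) ?_
    rw [uIcc_of_le hab]
    exact (convex_Icc a b).lipschitzOnWith_of_nnnorm_hasDerivWithin_le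
      (fun x _ => (hasDerivAt_kerConv_primitive_fst hK hf x
        (hc.trans_le hy.1)).hasDerivWithinAt) (fun x hx => hB x hx y hy)
  · obtain ⟨B, hB⟩ := exists_bound_kerConv hK.momentKernel hf hab hc hcd
    filter_upwards [self_mem_ae_restrict measurableSet_Icc] with x hx
    refine LipschitzOnWith.absolutelyContinuousOnInterval (K := B) ?_
    rw [uIcc_of_le hcd]
    exact (convex_Icc c d).lipschitzOnWith_of_nnnorm_hasDerivWithin_le
      (fun y hy => (hasDerivAt_kerConv_primitive_snd hK hf x
        (hc.trans_le hy.1)).hasDerivWithinAt)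
      (fun y hy => by rw [nnnorm_neg]; exact hB x hx y hy)

theorem lineDeriv_smoothExt_one (hK : IsKernel K N) (hf : LocallyIntegrable f volume) {z : ℂ}
    (hz : 0 < z.im) : lineDeriv ℝ (smoothExt K f) z 1 = kerConv K f z.re z.im := by
  refine HasLineDerivAt.lineDeriv ?_
  have h := (hasDerivAt_kerConv_primitive_fst hK hf (z.re + 0) hz).comp_const_add z.re 0
  rw [add_zero] at h
  refine h.congr_of_eventuallyEq (.of_forall fun t => ?_)
  simp [smoothExt]

theorem lineDeriv_smoothExt_I (hK : IsKernel K N) (hf : LocallyIntegrable f volume) {z : ℂ}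
    (hz : 0 < z.im) :
    lineDeriv ℝ (smoothExt K f) z Complex.I = -kerConv (momentKernel K) f z.re z.im := by
  refine HasLineDerivAt.lineDeriv ?_
  have h := (hasDerivAt_kerConv_primitive_snd hK hf z.re
    (by rwa [add_zero] : 0 < z.im + 0)).comp_const_add z.im 0
  rw [add_zero] at h
  refine h.congr_of_eventuallyEq (.of_forall fun t => ?_)
  simp [smoothExt]

/-- The kernel `(1 + i s) K(s)` of `2 ∂`, and the kernel `(1 - i s) K(s)` of `2 ∂̄`, according to
the sign `σ = 1` or `σ = -1`. -/
noncomputable def wirtingerKernel (σ : ℝ) (K : ℝ → ℂ) (s : ℝ) : ℂ :=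
  K s + σ * Complex.I * momentKernel K s

theorem IsKernel.wirtingerKernel (hK : IsKernel K N) {σ : ℝ} (hσ : |σ| ≤ 1) :
    IsKernel (wirtingerKernel σ K) (2 * N) := by
  have hc := hK.continuous
  have hm := hK.momentKernel.continuous
  refine ⟨by unfold WeilPetersson.wirtingerKernel; fun_prop, fun s hs => ?_, fun s => ?_⟩
  · by_contra h
    have h0 : K s = 0 := by
      by_contra h1; exact h (hK.support_subset h1)
    exact hs (by simp [WeilPetersson.wirtingerKernel, WeilPetersson.momentKernel, h0])
  · have h1 := hK.norm_le s
    have h2 := hK.momentKernel.norm_le s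
    have h3 : ‖(σ : ℂ) * Complex.I * WeilPetersson.momentKernel K s‖ ≤ N := by
      rw [norm_mul, norm_mul, Complex.norm_I, mul_one, Complex.norm_real, Real.norm_eq_abs]
      exact (mul_le_of_le_one_left (norm_nonneg _) hσ).trans h2
    rw [WeilPetersson.wirtingerKernel]
    linarith [norm_add_le (K s) ((σ : ℂ) * Complex.I * WeilPetersson.momentKernel K s)]

theorem kerConv_wirtingerKernel (hK : IsKernel K N) (σ : ℝ) (hf : LocallyIntegrable f volume)
    (x : ℝ) {y : ℝ} (hy : 0 < y) :
    kerConv (wirtingerKernel σ K) f x y =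
      kerConv K f x y + σ * Complex.I * kerConv (momentKernel K) f x y := by
  rw [kerConv, kerConv, kerConv, ← integral_const_mul, ← integral_add (hK.integrable hf x hy)
    ((hK.momentKernel.integrable hf x hy).const_mul _)]
  congr 1; funext t
  rw [wirtingerKernel]
  ring

theorem dz_smoothExt (hK : IsKernel K N) (hf : LocallyIntegrable f volume) {z : ℂ}
    (hz : 0 < z.im) :
    dz (smoothExt K f) z = kerConv (wirtingerKernel 1 K) f z.re z.im / 2 := by
  rw [dz, lineDeriv_smoothExt_one hK hf hz, lineDeriv_smoothExt_I hK hf hz,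
    kerConv_wirtingerKernel hK _ hf _ hz]
  push_cast; ring

theorem dzbar_smoothExt (hK : IsKernel K N) (hf : LocallyIntegrable f volume) {z : ℂ}
    (hz : 0 < z.im) :
    dzbar (smoothExt K f) z = kerConv (wirtingerKernel (-1) K) f z.re z.im / 2 := by
  rw [dzbar, lineDeriv_smoothExt_one hK hf hz, lineDeriv_smoothExt_I hK hf hz,
    kerConv_wirtingerKernel hK _ hf _ hz]
  push_cast; ring

end Quasiconformal

/-! ### The kernel of the construction -/

/-- The complex kernel `φ - i ψ`. -/
noncomputable def semmesKernel (φ ψ : ℝ → ℝ) (s : ℝ) : ℂ := φ s - Complex.I * ψ s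

theorem exists_isKernel_semmesKernel {φ ψ : ℝ → ℝ} (hφ : Continuous φ)
    (hφ_supp : Function.support φ ⊆ Icc (-1) 1) (hψ : Continuous ψ)
    (hψ_supp : Function.support ψ ⊆ Icc (-1) 1) :
    ∃ N : ℝ, 1 ≤ N ∧ IsKernel (semmesKernel φ ψ) N := by
  have hc : Continuous (semmesKernel φ ψ) := by unfold semmesKernel; fun_prop
  have hs : Function.support (semmesKernel φ ψ) ⊆ Icc (-1) 1 := fun s hs => by
    by_contra h
    have h1 : φ s = 0 := by by_contra h1; exact h (hφ_supp h1)
    have h2 : ψ s = 0 := by by_contra h1; exact h (hψ_supp h1)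
    exact hs (by simp [semmesKernel, h1, h2])
  obtain ⟨C, hC⟩ := hc.bounded_above_of_compact_support
    (HasCompactSupport.of_support_subset_isCompact isCompact_Icc hs)
  exact ⟨max 1 C, le_max_left _ _, hc, hs, fun s => (hC s).trans (le_max_right _ _)⟩

theorem integral_eq_zero_of_odd {g : ℝ → ℝ} (hg : ∀ x, g (-x) = -g x) : ∫ x, g x = 0 := by
  have h := integral_neg_eq_self g volume
  simp_rw [hg, integral_neg] at h
  linarith

section Moments

variable {φ ψ : ℝ → ℝ} (hφ : Continuous φ) (hφ_supp : Function.support φ ⊆ Icc (-1) 1)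
  (hψ : Continuous ψ) (hψ_supp : Function.support ψ ⊆ Icc (-1) 1)

theorem integrable_of_support_subset_Icc {g : ℝ → ℝ} (hg : Continuous g)
    (hs : Function.support g ⊆ Icc (-1) 1) : Integrable g volume :=
  hg.integrable_of_hasCompactSupport
    (HasCompactSupport.of_support_subset_isCompact isCompact_Icc hs)

theorem integral_ofReal_sub_I_mul {g h : ℝ → ℝ} (hg : Integrable g volume)
    (hh : Integrable h volume) : ∫ s, ((g s : ℂ) - Complex.I * h s) =
      ((∫ s, g s : ℝ) : ℂ) - Complex.I * ((∫ s, h s : ℝ) : ℂ) := by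
  rw [integral_sub hg.ofReal (hh.ofReal.const_mul _), integral_const_mul,
    integral_complex_ofReal, integral_complex_ofReal]

include hφ hφ_supp hψ hψ_supp

theorem integral_semmesKernel (hφ_int : ∫ x, φ x = 1) (hψ_odd : ∀ x, ψ (-x) = -ψ x) :
    ∫ s, semmesKernel φ ψ s = 1 := by
  refine (integral_ofReal_sub_I_mul (integrable_of_support_subset_Icc hφ hφ_supp)
    (integrable_of_support_subset_Icc hψ hψ_supp)).trans ?_
  rw [hφ_int, integral_eq_zero_of_odd hψ_odd]
  simp

theorem integral_momentKernel_semmesKernel (hφ_even : ∀ x, φ (-x) = φ x)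
    (hψ_int : ∫ x, ψ x * x = 1) :
    ∫ s, momentKernel (semmesKernel φ ψ) s = -Complex.I := by
  have hs : ∀ {g : ℝ → ℝ}, Function.support g ⊆ Icc (-1) 1 →
      Function.support (fun x => g x * x) ⊆ Icc (-1) 1 := fun h x hx =>
    h (left_ne_zero_of_mul hx)
  have hodd : ∫ x, φ x * x = 0 := integral_eq_zero_of_odd fun x => by rw [hφ_even]; ring
  have e := integral_ofReal_sub_I_mul
    (integrable_of_support_subset_Icc (hφ.mul continuous_id) (hs hφ_supp))
    (integrable_of_support_subset_Icc (hψ.mul continuous_id) (hs hψ_supp))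
  refine Eq.trans ?_ (e.trans ?_)
  · congr 1; funext s
    simp [momentKernel, semmesKernel]
    ring
  · change ((∫ x, φ x * x : ℝ) : ℂ) - Complex.I * ((∫ x, ψ x * x : ℝ) : ℂ) = _
    rw [hodd, hψ_int]
    simp

end Moments

theorem integral_wirtingerKernel {K : ℝ → ℂ} {N : ℝ} (hK : IsKernel K N) (hK1 : ∫ s, K s = 1)
    (hKm : ∫ s, momentKernel K s = -Complex.I) (σ : ℝ) :
    ∫ s, wirtingerKernel σ K s = 1 + σ := by
  have h := kerConv_wirtingerKernel hK σ (locallyIntegrable_const 1) 0 one_pos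
  rw [kerConv_one _ _ one_pos, kerConv_one _ _ one_pos, kerConv_one _ _ one_pos, hK1, hKm] at h
  rw [h]
  linear_combination -(σ : ℂ) * Complex.I_mul_I

theorem integrable_dilation_mul {g : ℝ → ℝ} (hg : Continuous g)
    (hs : Function.support g ⊆ Icc (-1) 1) {f : ℝ → ℂ} (hf : LocallyIntegrable f volume)
    (x : ℝ) {y : ℝ} (hy : y ≠ 0) :
    Integrable (fun t => ((y⁻¹ * g (y⁻¹ * (x - t)) : ℝ) : ℂ) * f t) volume := by
  refine hf.integrable_smul_left_of_hasCompactSupport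
    (g := fun t => ((y⁻¹ * g (y⁻¹ * (x - t)) : ℝ) : ℂ)) (by fun_prop)
    (HasCompactSupport.of_support_subset_isCompact (isCompact_closedBall x |y|) fun t ht => ?_)
  have h1 : g (y⁻¹ * (x - t)) ≠ 0 := fun h0 => ht (by simp [h0])
  have h2 := abs_le.2 (hs h1)
  rw [abs_mul, abs_inv, inv_mul_eq_div, div_le_one (abs_pos.2 hy)] at h2
  rwa [Metric.mem_closedBall, Real.dist_eq, abs_sub_comm]

theorem semmesExt_eq_smoothExt {φ ψ : ℝ → ℝ} (hφ : Continuous φ)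
    (hφ_supp : Function.support φ ⊆ Icc (-1) 1) (hψ : Continuous ψ)
    (hψ_supp : Function.support ψ ⊆ Icc (-1) 1) {u : ℝ → ℂ} {f : ℝ → ℂ}
    (hf : LocallyIntegrable f volume) (huf : gammaCurve u = primitive f) :
    semmesExt φ ψ u = smoothExt (semmesKernel φ ψ) f := by
  funext z
  have hp := (continuous_primitive hf).locallyIntegrable (μ := volume)
  rw [semmesExt, smoothExt, huf]
  rcases eq_or_ne z.im 0 with hy | hy
  · simp [dilConv, kerConv, hy]
  · rw [dilConv, dilConv, kerConv, ← integral_const_mul,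
      ← integral_sub (integrable_dilation_mul hφ hφ_supp hp _ hy)
      ((integrable_dilation_mul hψ hψ_supp hp _ hy).const_mul _)]
    congr 1; funext t
    rw [semmesKernel]
    push_cast
    ring

/-! ### The normalised exponential -/

section Exponential

variable {u : HHalf}

/-- The density `e^u / ∫₀¹ e^u` of `γ_u`. -/
noncomputable def normExp (u : HHalf) (t : ℝ) : ℂ :=
  (∫ τ in (0 : ℝ)..1, Complex.exp (u τ))⁻¹ * Complex.exp (u t)

theorem locallyIntegrable_normExp (u : HHalf) : LocallyIntegrable (normExp u) volume :=
  locallyIntegrable_const_mul u.locallyIntegrable_exp _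

theorem gammaCurve_eq_primitive (u : HHalf) : gammaCurve u = primitive (normExp u) := by
  funext x
  rw [gammaCurve, primitive]
  simp only [normExp]
  rw [intervalIntegral.integral_const_mul, div_eq_inv_mul]

theorem kerConv_normExp (K : ℝ → ℂ) (u : HHalf) (x y : ℝ) :
    kerConv K (normExp u) x y = (∫ τ in (0 : ℝ)..1, Complex.exp (u τ))⁻¹ *
      kerConv K (fun t => Complex.exp (u t)) x y := kerConv_const_mul _ _ _ _ _

theorem lintegral_exp_sub_exp_mean_le (hu : ‖u‖ ≤ 1) (x : ℝ) {r : ℝ} (hr : 0 < r) :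
    ∫⁻ t, ‖Complex.exp (u t) - Complex.exp (mean u x r)‖ₑ ∂(unifMeasure x r) ≤
      ENNReal.ofReal (4 * Real.pi * expBound * ‖u‖ * ‖Complex.exp (mean u x r)‖) := by
  have hE := one_le_expBound
  have e : ∀ t, ‖Complex.exp (u t) - Complex.exp (mean u x r)‖ₑ =
      ‖Complex.exp (mean u x r)‖ₑ * ‖Complex.exp (u t - mean u x r) - 1‖ₑ := fun t => by
    rw [← enorm_mul, mul_sub, mul_one, ← u.exp_eq]
  simp_rw [e]
  rw [lintegral_const_mul' _ _ enorm_ne_top]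
  refine (mul_le_mul_right ((HHalf.lintegral_exp_sub_one_le hu x hr).trans
    (mul_le_mul_left (u.osc_le x hr) _)) _).trans (le_of_eq ?_)
  rw [← ofReal_norm, ← ENNReal.ofReal_mul (by positivity), ← ENNReal.ofReal_mul (by positivity)]
  congr 1; ring

/-- On `(0, 1]` the mean of `exp u` differs from `exp (mean u)` by less than `|exp (mean u)|`. -/
theorem integral_exp_ne_zero (hu : ‖u‖ ≤ 1) (hε : 4 * Real.pi * expBound * ‖u‖ < 1) :
    ∫ t in (0 : ℝ)..1, Complex.exp (u t) ≠ 0 := by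
  have h1 := lintegral_exp_sub_exp_mean_le hu (1 / 2) (r := 1 / 2) (by norm_num)
  have hp := isProbabilityMeasure_unifMeasure (1 / 2) (r := 1 / 2) (by norm_num)
  set c := Complex.exp (mean u (1 / 2) (1 / 2)) with hc
  have hc0 : c ≠ 0 := Complex.exp_ne_zero _
  have hm := mean_eq (fun t => Complex.exp (u t)) (1 / 2) (r := 1 / 2) (by norm_num)
  norm_num at hm
  rw [← hm]
  intro h0
  have h2 : ∫ t, (Complex.exp (u t) - c) ∂(unifMeasure (1 / 2) (1 / 2)) = -c := by
    rw [integral_sub (integrable_unifMeasure u.locallyIntegrable_exp _ (by norm_num))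
      (integrable_const _)]
    have : ∫ t, Complex.exp (u t) ∂(unifMeasure (1 / 2) (1 / 2)) = 0 := h0
    rw [this, integral_const, probReal_univ, one_smul, zero_sub]
  have h3 := (enorm_integral_le_lintegral_enorm _).trans h1
  rw [h2, enorm_neg, ← ofReal_norm, ENNReal.ofReal_le_ofReal_iff (by
    have := one_le_expBound; positivity)] at h3
  have := norm_pos_iff.2 hc0
  nlinarith

/-- On each interval the constant is `exp (mean u)`, up to the normalisation. -/
theorem isNearlyConstant_normExp (hu : ‖u‖ ≤ 1) (hε : 4 * Real.pi * expBound * ‖u‖ < 1) :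
    IsNearlyConstant (normExp u) (4 * Real.pi * expBound * ‖u‖) := by
  intro X R hR
  have hE := one_le_expBound
  have h0 := integral_exp_ne_zero hu hε
  set c := ∫ τ in (0 : ℝ)..1, Complex.exp (u τ) with hc
  refine ⟨c⁻¹ * Complex.exp (mean u X R),
    mul_ne_zero (inv_ne_zero h0) (Complex.exp_ne_zero _), ?_⟩
  have e : ∀ t, ‖normExp u t - c⁻¹ * Complex.exp (mean u X R)‖ₑ =
      ‖c⁻¹‖ₑ * ‖Complex.exp (u t) - Complex.exp (mean u X R)‖ₑ := fun t => by
    rw [← enorm_mul, mul_sub]; rfl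
  simp_rw [e]
  rw [lintegral_const_mul' _ _ enorm_ne_top]
  refine (mul_le_mul_right (lintegral_exp_sub_exp_mean_le hu X hR) _).trans (le_of_eq ?_)
  rw [← ofReal_norm, ← ENNReal.ofReal_mul (norm_nonneg _), norm_mul]
  congr 1; ring

end Exponential

/-! ### Conclusion -/

theorem mul_norm_le_of_lt_smallRadius {M : ℝ} (hM : 0 ≤ M) {u : HHalf}
    (hu : ‖u‖ < smallRadius M) : 8 * Real.pi * M * expBound * ‖u‖ ≤ 1 := by
  have hE := one_le_expBound
  have h0 : 0 ≤ 8 * Real.pi * M * expBound := by positivity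
  rw [smallRadius, lt_div_iff₀ (by linarith)] at hu
  nlinarith [norm_nonneg u]

theorem smallRadius_anti {M M' : ℝ} (hM : 0 ≤ M) (h : M ≤ M') :
    smallRadius M' ≤ smallRadius M := by
  have hE := one_le_expBound
  unfold smallRadius
  gcongr

/-- The extension of a small element of `H^{1/2}` is quasiconformal, with Beltrami coefficient the
quotient of the smoothings of `exp u` by the two Wirtinger kernels. -/
theorem isQuasiconformalOn_smoothExt {K : ℝ → ℂ} {N : ℝ} (hN : 1 ≤ N) (hK : IsKernel K N)
    (hK1 : ∫ s, K s = 1) (hKm : ∫ s, momentKernel K s = -Complex.I) {u : HHalf}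
    (hu : ‖u‖ < smallRadius (64 * N)) :
    (∫ t in (0 : ℝ)..1, Complex.exp (u t)) ≠ 0 ∧
      IsQuasiconformalOn (smoothExt K (normExp u)) upperHalf ∧
      ∀ z : ℂ, 0 < z.im → dz (smoothExt K (normExp u)) z ≠ 0 ∧
        beltramiFun (wirtingerKernel 1 K) (wirtingerKernel (-1) K) u z =
          dzbar (smoothExt K (normExp u)) z / dz (smoothExt K (normExp u)) z ∧
        ‖beltramiFun (wirtingerKernel 1 K) (wirtingerKernel (-1) K) u z‖ ≤ 1 / 2 := by
  have hE := one_le_expBound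
  have hpi := Real.pi_pos
  have hu0 := norm_nonneg u
  have hsmall := mul_norm_le_of_lt_smallRadius (by linarith) hu
  have hu1 := norm_le_one_of_lt_smallRadius (by linarith) hu
  have hu2 : ‖u‖ < smallRadius (2 * N) :=
    hu.trans_le (smallRadius_anti (by linarith) (by linarith))
  set ε := 4 * Real.pi * expBound * ‖u‖ with hε
  have hε0 : 0 ≤ ε := by positivity
  have hNε : 64 * (N * ε) ≤ 1 := by
    have : 8 * Real.pi * (64 * N) * expBound * ‖u‖ = 128 * (N * ε) := by rw [hε]; ring
    have h0 : 0 ≤ N * ε := by positivity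
    linarith
  have hε1 : ε < 1 := by nlinarith
  have hf := locallyIntegrable_normExp u
  have hnc := isNearlyConstant_normExp hu1 hε1
  have hc0 := integral_exp_ne_zero hu1 hε1
  have ha := hK.wirtingerKernel (σ := 1) (by simp)
  have hb := hK.wirtingerKernel (σ := -1) (by simp)
  have ha2 : ∫ s, wirtingerKernel 1 K s = 2 := by
    rw [integral_wirtingerKernel hK hK1 hKm]; norm_num
  have hb0 : ∫ s, wirtingerKernel (-1) K s = 0 := by
    rw [integral_wirtingerKernel hK hK1 hKm]; norm_num
  have hpt : ∀ z : ℂ, 0 < z.im → dz (smoothExt K (normExp u)) z ≠ 0 ∧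
      beltramiFun (wirtingerKernel 1 K) (wirtingerKernel (-1) K) u z =
        dzbar (smoothExt K (normExp u)) z / dz (smoothExt K (normExp u)) z ∧
      ‖beltramiFun (wirtingerKernel 1 K) (wirtingerKernel (-1) K) u z‖ ≤ 1 / 2 := by
    intro z hz
    rw [dz_smoothExt hK hf hz, dzbar_smoothExt hK hf hz, kerConv_normExp, kerConv_normExp]
    refine ⟨div_ne_zero (mul_ne_zero (inv_ne_zero hc0)
      (denominator_ne_zero ha ha2 hu2 z.re hz)) two_ne_zero, ?_, ?_⟩
    · rw [div_div_div_cancel_right₀ two_ne_zero, mul_div_mul_left _ _ (inv_ne_zero hc0)]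
      rfl
    · refine (norm_beltramiFun_le ha ha2 hb hb0 hu2 hz).trans ?_
      calc 4 * (2 * N) * expBound * u.oscR z.re z.im
          ≤ 4 * (2 * N) * expBound * (2 * Real.pi * ‖u‖) := by
            gcongr; exact u.oscR_le z.re hz
        _ = 4 * (N * ε) := by rw [hε]; ring
        _ ≤ 1 / 2 := by linarith
  refine ⟨hc0, ⟨isOpenEmbedding_smoothExt hK hK1 hKm hf hε0 hnc hNε, isACL_smoothExt hK hf,
    1 / 2, by norm_num, by norm_num, ae_upperHalf fun z hz => ?_⟩, hpt⟩
  obtain ⟨h1, h2, h3⟩ := hpt z hz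
  rwa [h2, norm_div, div_le_iff₀ (norm_pos_iff.2 h1)] at h3

end WeilPetersson

theorem lemma6p1 (φ ψ : ℝ → ℝ)
    (hφ : ContDiff ℝ ∞ φ) (hφ_supp : Function.support φ ⊆ Icc (-1) 1)
    (hφ_even : ∀ x, φ (-x) = φ x) (hφ_int : (∫ x, φ x) = 1)
    (hψ : ContDiff ℝ ∞ ψ) (hψ_supp : Function.support ψ ⊆ Icc (-1) 1)
    (hψ_odd : ∀ x, ψ (-x) = -ψ x) (hψ_int : (∫ x, ψ x * x) = 1) :
    ∃ δ : ℝ, 0 < δ ∧ ∃ C : ℝ, ∃ Λ : HHalf → WPSpace,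
      (∀ u : HHalf, ‖u‖ < δ →
        LocallyIntegrable (fun t => Complex.exp (u t)) volume ∧
        (∫ t in (0 : ℝ)..1, Complex.exp (u t)) ≠ 0 ∧
        IsQuasiconformalOn (semmesExt φ ψ u) upperHalf ∧
        IsBeltramiCoeffOn (Λ u).toLp (semmesExt φ ψ u) upperHalf ∧
        Λ u ∈ wpBeltrami ∧
        ‖Λ u‖ ≤ C * ‖u‖) ∧
      DifferentiableOn ℂ Λ {u : HHalf | ‖u‖ < δ} := by
  have hφc := hφ.continuous
  have hψc := hψ.continuous
  have hE := one_le_expBound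
  obtain ⟨N, hN, hK⟩ := exists_isKernel_semmesKernel hφc hφ_supp hψc hψ_supp
  have hK1 := integral_semmesKernel hφc hφ_supp hψc hψ_supp hφ_int hψ_odd
  have hKm := integral_momentKernel_semmesKernel hφc hφ_supp hψc hψ_supp hφ_even hψ_int
  have ha := hK.wirtingerKernel (σ := 1) (by simp)
  have hb := hK.wirtingerKernel (σ := -1) (by simp)
  have ha2 : ∫ s, wirtingerKernel 1 (semmesKernel φ ψ) s = 2 := by
    rw [integral_wirtingerKernel hK hK1 hKm]; norm_num
  have hb0 : ∫ s, wirtingerKernel (-1) (semmesKernel φ ψ) s = 0 := by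
    rw [integral_wirtingerKernel hK hK1 hKm]; norm_num
  obtain ⟨Λ, hΛ⟩ := exists_beltramiMap ha ha2 hb hb0
  have hanti : smallRadius (64 * N) ≤ smallRadius (2 * N) :=
    smallRadius_anti (by linarith) (by linarith)
  refine ⟨smallRadius (64 * N), smallRadius_pos (by linarith), 4 * (2 * N) * expBound * oscConst, Λ,
    fun u hu => ?_, fun u hu => ?_⟩
  · obtain ⟨h1, h2, h3⟩ := isQuasiconformalOn_smoothExt hN hK hK1 hKm hu
    rw [semmesExt_eq_smoothExt hφc hφ_supp hψc hψ_supp (locallyIntegrable_normExp u)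
      (gammaCurve_eq_primitive u)]
    have hu2 := hu.trans_le hanti
    refine ⟨u.locallyIntegrable_exp, h1, h2, ?_, ?_, ?_⟩
    · filter_upwards [hΛ u hu2, ae_upperHalf h3] with z hz h
      exact ⟨h.1, hz.trans h.2.1⟩
    · refine (norm_toLp_le_of_ae_bound (C := 1 / 2) (by norm_num) ?_).trans_lt (by norm_num)
      filter_upwards [hΛ u hu2, ae_upperHalf h3] with z hz h
      rw [hz]
      exact h.2.2
    · exact WPSpace.norm_le_of_osc (hΛ u hu2) (by positivity)
        fun z hz => norm_beltramiFun_le ha ha2 hb hb0 hu2 hz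
  · exact (differentiableAt_of_toLp_eq_beltramiFun ha ha2 hb hb0 hΛ
      (hu.trans_le hanti)).differentiableWithinAt
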